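/- Let $k$ be a field, $H$ a finite-dimensional Hopf algebra over $k$ with antipode $S$, and $A$ a right $H$-comodule algebra with coaction $\rho: A\to A\otimes_k H$, $a\mapsto a_{(0)}\otimes a_{(1)}$. Let $B=\{a\in A:\rho(a)=a\otimes 1\}$ and assume that $A|B$ is $H$-Galois, i.e. the map $\beta: A\otimes_B A\to A\otimes_k H$, $a\otimes a'\mapsto a\,a'_{(0)}\otimes a'_{(1)}$, is bijective. Let $R=C_A(B)$ be the centralizer, $\mathcal{S}=\mathrm{End}({}_BA_B)$, and $T=(A\otimes_BA)^B$ the ring of $B$-central elements with product $tt'={t'}^1t^1\otimes t^2{t'}^2$ and unit $1\otimes 1$. Then $A|B$ has depth two: there are finite families $t_i,u_j\in T$ and $\beta_i,\gamma_j\in\mathcal{S}$ with $a\otimes a'=\sum_i t_i\beta_i(a)a'$ (a left quasibasis) and $a\otimes a'=\sum_j a\gamma_j(a')u_j$ (a right quasibasis) for all $a,a'\in A$. For every right quasibasis, the opposite ring $T^{op}$ with $$\tilde s(r)=r\otimes 1,\quad \tilde t(r)=1\otimes r,\quad \Delta(t)=\sum_j (t^1\otimes\gamma_j(t^2))\otimes_R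 u_j,\quad \varepsilon(t)=t^1t^2$$ is a left bialgebroid over $R$, and it is a Hopf algebroid in the sense of Lu, of the type of Lu's smash product theorem. Precisely: (1) $S$ is bijective, so that $H^{op}$ is a Hopf algebra with antipode $\overline S=S^{-1}$. There is a left module algebra structure on $R$ over the Drinfel'd double $D(H^{op})=(H^{op})^{*\,cop}\bowtie H^{op}$ in which $H^{op}$ acts by the Miyashita–Ulbrich action ($h\cdot r=r\triangleleft h:=t^1rt^2$, where $t=t^1\otimes t^2=\beta^{-1}(1\otimes h)$) and the dual acts through the coaction ($p\cdot r=r_{(0)}\,p(r_{(1)})$). For dual bases $h_i$ of $H^{op}$ and $p_i$ of its dual, $\sum_i(p_i\cdot u)(h_i\cdot v)=vu$ for all $u,v\in R$. (2) The smash product $R\rtimes H^{op}$ is a Hopf algebroid over $R$ in the sense of Lu with $$\tilde s(r)=r\rtimes 1,\quad \tilde t(r)=\sum_i(p_i\cdot r)\rtimes h_i=r_{(0)}\rtimes r_{(1)},\quad \Delta(r\rtimes h)=(r\rtimes h_{(1)})\otimes_R(1\rtimes h_{(2)}),\quad \varepsilon(r\rtimes h)=\varepsilon(h)r$$ and antipode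 $$\tau(r\rtimes h)=\sum_i(1\rtimes\overline S(h))\,\tilde t\big(\overline S^2(h_i)\cdot(p_i\cdot r)\big)=(1\rtimes\overline S(h))\,(w_{(0)}\rtimes w_{(1)}),\qquad w=r_{(0)}\triangleleft\overline S^2(r_{(1)}).$$ (3) $\beta$ restricts to an algebra isomorphism $\Phi:T^{op}\to R\rtimes H^{op}$, which is an isomorphism of left bialgebroids over the identity of $R$, and $T^{op}$ is a Hopf algebroid in the sense of Lu with antipode $\Phi^{-1}\tau\Phi$. Here a Hopf algebroid in the sense of Lu is a left bialgebroid $(L,R,\tilde s,\tilde t,\Delta,\varepsilon)$ with an algebra anti-automorphism $\tau$ of $L$ such that $\tau\tilde t=\tilde s$, $\tau(a_{(1)})a_{(2)}=\tilde t(\varepsilon(\tau(a)))$ for all $a\in L$, and $\mu(\mathrm{id}\otimes\tau)\eta\Delta=\tilde s\varepsilon$ for some $k$-linear section $\eta:L\otimes_RL\to L\otimes_kL$ of the canonical projection, where $\mu$ is the multiplication of $L$. -/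

import Mathlib

open scoped TensorProduct

noncomputable section

/-! ## Left bialgebroids and Lu's Hopf algebroids -/

section Bialgebroid

variable {k R L : Type*} [CommRing k] [Ring R] [Algebra k R] [Ring L] [Algebra k L]

/-- The relations `t(r) a ⊗ b = a ⊗ s(r) b` defining `L ⊗_R L` as a quotient of `L ⊗_k L`, where
`L` is an `R`-bimodule through `r · a · r' = s(r) t(r') a`. -/
def bimoduleRelations (s t : R →ₗ[k] L) : Submodule k (L ⊗[k] L) :=
  Submodule.span k {x | ∃ (r : R) (a b : L), x = (t r * a) ⊗ₜ[k] b - a ⊗ₜ[k] (s r * b)}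

/-- `L ⊗_R L`. -/
abbrev BimoduleTensor (s t : R →ₗ[k] L) : Type _ := (L ⊗[k] L) ⧸ bimoduleRelations s t

/-- The relations defining `L ⊗_R L ⊗_R L` as a quotient of `L ⊗_k (L ⊗_k L)`. -/
def bimoduleRelations₃ (s t : R →ₗ[k] L) : Submodule k (L ⊗[k] (L ⊗[k] L)) :=
  Submodule.span k
    ({x | ∃ (r : R) (a b c : L),
        x = (t r * a) ⊗ₜ[k] (b ⊗ₜ[k] c) - a ⊗ₜ[k] ((s r * b) ⊗ₜ[k] c)} ∪
      {x | ∃ (r : R) (a b c : L),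
        x = a ⊗ₜ[k] ((t r * b) ⊗ₜ[k] c) - a ⊗ₜ[k] (b ⊗ₜ[k] (s r * c))})

/-- `L ⊗_R L ⊗_R L`. -/
abbrev BimoduleTensor₃ (s t : R →ₗ[k] L) : Type _ :=
  (L ⊗[k] (L ⊗[k] L)) ⧸ bimoduleRelations₃ s t

/-- The canonical map `(L ⊗_R L) ⊗_k L → L ⊗_R L ⊗_R L`, curried. -/
def BimoduleTensor.joinRight (s t : R →ₗ[k] L) :
    BimoduleTensor s t →ₗ[k] L →ₗ[k] BimoduleTensor₃ s t :=
  (bimoduleRelations s t).liftQ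
    (TensorProduct.curry
      ((bimoduleRelations₃ s t).mkQ ∘ₗ (TensorProduct.assoc k L L L).toLinearMap)) (by
    refine Submodule.span_le.2 ?_
    rintro _ ⟨r, a, b, rfl⟩
    rw [SetLike.mem_coe, LinearMap.mem_ker]
    ext c
    simp only [map_sub, LinearMap.sub_apply, LinearMap.zero_apply, TensorProduct.curry_apply,
      LinearMap.comp_apply, LinearEquiv.coe_coe, TensorProduct.assoc_tmul]
    rw [← map_sub]
    exact (Submodule.Quotient.mk_eq_zero _).2
      (Submodule.subset_span (Or.inl ⟨r, a, b, c, rfl⟩)))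

/-- The canonical map `L ⊗_k (L ⊗_R L) → L ⊗_R L ⊗_R L`, curried (second argument first). -/
def BimoduleTensor.joinLeft (s t : R →ₗ[k] L) :
    BimoduleTensor s t →ₗ[k] L →ₗ[k] BimoduleTensor₃ s t :=
  (bimoduleRelations s t).liftQ (TensorProduct.curry (bimoduleRelations₃ s t).mkQ).flip (by
    refine Submodule.span_le.2 ?_
    rintro _ ⟨r, b, c, rfl⟩
    rw [SetLike.mem_coe, LinearMap.mem_ker]
    ext a
    simp only [map_sub, LinearMap.sub_apply, LinearMap.zero_apply, TensorProduct.curry_apply,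
      LinearMap.flip_apply]
    rw [← map_sub]
    exact (Submodule.Quotient.mk_eq_zero _).2
      (Submodule.subset_span (Or.inr ⟨r, a, b, c, rfl⟩)))

variable (k R L) in
/-- The data `(L, R, s, t, Δ, ε)` of a left bialgebroid; the axioms are in `IsLeftBialgebroid`. -/
structure LeftBialgebroidData where
  /-- the source map -/
  source : R →ₗ[k] L
  /-- the target map -/
  target : R →ₗ[k] L
  /-- the coproduct -/
  comul : L →ₗ[k] BimoduleTensor source target
  /-- the counit -/
  counit : L →ₗ[k] R

namespace LeftBialgebroidData

variable (D : LeftBialgebroidData k R L)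

/-- The projection `L ⊗_k L → L ⊗_R L`. -/
def proj : L ⊗[k] L →ₗ[k] BimoduleTensor D.source D.target :=
  (bimoduleRelations D.source D.target).mkQ

/-- `a ⊗ b ↦ Δ(a) ⊗ b`, from `L ⊗_k L` to `L ⊗_R L ⊗_R L`. -/
def comulLeft : L ⊗[k] L →ₗ[k] BimoduleTensor₃ D.source D.target :=
  TensorProduct.lift (BimoduleTensor.joinRight D.source D.target ∘ₗ D.comul)

/-- `a ⊗ b ↦ a ⊗ Δ(b)`, from `L ⊗_k L` to `L ⊗_R L ⊗_R L`. -/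
def comulRight : L ⊗[k] L →ₗ[k] BimoduleTensor₃ D.source D.target :=
  TensorProduct.lift (BimoduleTensor.joinLeft D.source D.target ∘ₗ D.comul).flip

/-- `a ⊗ b ↦ s(ε(a)) b`. -/
def counitLeft : L ⊗[k] L →ₗ[k] L :=
  LinearMap.mul' k L ∘ₗ TensorProduct.map (D.source ∘ₗ D.counit) LinearMap.id

/-- `a ⊗ b ↦ t(ε(b)) a`. -/
def counitRight : L ⊗[k] L →ₗ[k] L :=
  LinearMap.mul' k L ∘ₗ TensorProduct.map (D.target ∘ₗ D.counit) LinearMap.id ∘ₗ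
    (TensorProduct.comm k L L).toLinearMap

/-- The axioms of a left bialgebroid. Operations on `L ⊗_R L` that are only well defined on the
image of `Δ`, or only by virtue of the other axioms, are computed on arbitrary representatives
in `L ⊗_k L`. -/
structure IsLeftBialgebroid : Prop where
  source_one : D.source 1 = 1
  source_mul : ∀ r r', D.source (r * r') = D.source r * D.source r'
  target_one : D.target 1 = 1
  target_mul : ∀ r r', D.target (r * r') = D.target r' * D.target r
  source_target_comm : ∀ r r', D.source r * D.target r' = D.target r' * D.source r
  /-- `Δ(r · a · r') = r · Δ(a) · r'` -/
  comul_bimodule : ∀ (r r' : R) (a : L) (x : L ⊗[k] L), D.proj x = D.comul a →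
    D.comul (D.source r * D.target r' * a) = D.proj ((D.source r ⊗ₜ[k] D.target r') * x)
  /-- `ε(r · a · r') = r ε(a) r'` -/
  counit_bimodule : ∀ (r r' : R) (a : L),
    D.counit (D.source r * D.target r' * a) = r * D.counit a * r'
  coassoc : ∀ (a : L) (x : L ⊗[k] L), D.proj x = D.comul a → D.comulLeft x = D.comulRight x
  counit_left : ∀ (a : L) (x : L ⊗[k] L), D.proj x = D.comul a → D.counitLeft x = a
  counit_right : ∀ (a : L) (x : L ⊗[k] L), D.proj x = D.comul a → D.counitRight x = a
  /-- `a₁ t(r) ⊗ a₂ = a₁ ⊗ a₂ s(r)` -/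
  takeuchi : ∀ (r : R) (a : L) (x : L ⊗[k] L), D.proj x = D.comul a →
    D.proj (x * (D.target r ⊗ₜ[k] 1)) = D.proj (x * (1 ⊗ₜ[k] D.source r))
  comul_one : D.comul 1 = D.proj (1 ⊗ₜ[k] 1)
  comul_mul : ∀ (a b : L) (x y : L ⊗[k] L), D.proj x = D.comul a → D.proj y = D.comul b →
    D.comul (a * b) = D.proj (x * y)
  counit_one : D.counit 1 = 1
  counit_mul_source : ∀ a b, D.counit (a * b) = D.counit (a * D.source (D.counit b))
  counit_mul_target : ∀ a b, D.counit (a * b) = D.counit (a * D.target (D.counit b))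

/-- `(L, R, s, t, Δ, ε, τ)` is a Hopf algebroid in the sense of Lu: a left bialgebroid with an
algebra anti-automorphism `τ` such that `τ t = s`, `τ(a₁) a₂ = t(ε(τ(a)))`, and, for some linear
section `η` of `L ⊗_k L → L ⊗_R L`, `μ (id ⊗ τ) η Δ = s ε`. -/
structure IsLuHopfAlgebroid (τ : L →ₗ[k] L) : Prop where
  isLeftBialgebroid : D.IsLeftBialgebroid
  bijective : Function.Bijective τ
  antipode_one : τ 1 = 1
  antipode_mul : ∀ a b, τ (a * b) = τ b * τ a
  antipode_target : ∀ r, τ (D.target r) = D.source r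
  antipode_left : ∀ (a : L) (x : L ⊗[k] L), D.proj x = D.comul a →
    LinearMap.mul' k L (τ.rTensor L x) = D.target (D.counit (τ a))
  antipode_right : ∃ η : BimoduleTensor D.source D.target →ₗ[k] L ⊗[k] L,
    (∀ y, D.proj (η y) = y) ∧
    ∀ a, LinearMap.mul' k L (τ.lTensor L (η (D.comul a))) = D.source (D.counit a)

/-- The pair of algebra homomorphisms `(F, f)` is a homomorphism of bialgebroids. -/
structure IsHom {R' L' : Type*} [Ring R'] [Algebra k R'] [Ring L'] [Algebra k L']
    (D : LeftBialgebroidData k R L) (D' : LeftBialgebroidData k R' L')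
    (F : L →ₐ[k] L') (f : R →ₐ[k] R') : Prop where
  map_source : ∀ r, F (D.source r) = D'.source (f r)
  map_target : ∀ r, F (D.target r) = D'.target (f r)
  map_comul : ∀ (a : L) (x : L ⊗[k] L), D.proj x = D.comul a →
    D'.comul (F a) = D'.proj (TensorProduct.map F.toLinearMap F.toLinearMap x)
  map_counit : ∀ a, D'.counit (F a) = f (D.counit a)

end LeftBialgebroidData

end Bialgebroid

/-! ## Module algebras and smash products -/

section Smash

/-- A left `H`-module algebra structure on `V`, for a bialgebra `H`. -/
structure ModuleAlgebra (k H V : Type*) [CommRing k] [Ring H] [Bialgebra k H] [Ring V]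
    [Algebra k V] where
  /-- the action -/
  act : H →ₐ[k] Module.End k V
  /-- `h · 1 = ε(h) 1` -/
  act_one_right : ∀ h, act h 1 = algebraMap k V (Coalgebra.counit h)
  /-- `h · (u v) = (h₁ · u) (h₂ · v)` -/
  act_mul_right : ∀ h u v, act h (u * v) = LinearMap.mul' k V
    (TensorProduct.homTensorHomMap (RingHom.id k) V V V V
      (TensorProduct.map act.toLinearMap act.toLinearMap (Coalgebra.comul h)) (u ⊗ₜ[k] v))

variable {k H V : Type*} [CommRing k] [Ring H] [Bialgebra k H] [Ring V] [Algebra k V]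

namespace ModuleAlgebra

variable (M : ModuleAlgebra k H V)

/-- The underlying `k`-module `V ⊗ H` of the smash product `V ⋊ H`. -/
def Smash (_ : ModuleAlgebra k H V) : Type _ := V ⊗[k] H

namespace Smash

instance : AddCommGroup M.Smash := inferInstanceAs (AddCommGroup (V ⊗[k] H))
instance : Module k M.Smash := inferInstanceAs (Module k (V ⊗[k] H))

/-- The identity map, from the smash product to `V ⊗ H`. -/
def equiv : M.Smash ≃ₗ[k] V ⊗[k] H := LinearEquiv.refl k _

end Smash

/-- The diagonal action of `H` on `V ⊗ H`: `h · (w ⊗ g) = h₁ · w ⊗ h₂ g`. -/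
def diag : H →ₐ[k] Module.End k (V ⊗[k] H) :=
  (Module.endTensorEndAlgHom (R := k) (S := k) (A := k) (M := V) (N := H)).comp
    ((Algebra.TensorProduct.map M.act (Algebra.lmul k H)).comp (Bialgebra.comulAlgHom k H))

/-- Left multiplication by `V` on `V ⊗ H`. -/
def leftV : V →ₐ[k] Module.End k (V ⊗[k] H) :=
  (Module.endTensorEndAlgHom (R := k) (S := k) (A := k) (M := V) (N := H)).comp
    (Algebra.TensorProduct.includeLeft.comp (Algebra.lmul k V))

/-- The multiplication of the smash product, as a map `x ↦ (y ↦ x y)`: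
`(v ⋊ h) (w ⋊ g) = v (h₁ · w) ⋊ h₂ g`. -/
def smashMul : V ⊗[k] H →ₗ[k] Module.End k (V ⊗[k] H) :=
  TensorProduct.lift ((LinearMap.mul k (Module.End k (V ⊗[k] H))).compl₁₂
    (leftV (k := k) (H := H) (V := V)).toLinearMap M.diag.toLinearMap)

theorem smashMul_tmul (v : V) (h : H) : M.smashMul (v ⊗ₜ h) = leftV v * M.diag h := rfl

theorem leftV_tmul (v w : V) (g : H) :
    leftV (k := k) v (w ⊗ₜ[k] g) = (v * w) ⊗ₜ[k] g := rfl

theorem diag_tmul (h g : H) (w : V) : M.diag h (w ⊗ₜ[k] g) =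
    TensorProduct.map (LinearMap.applyₗ w ∘ₗ M.act.toLinearMap) (LinearMap.mulRight k g)
      (Coalgebra.comul h) := by
  have key : ∀ x : H ⊗[k] H,
      (Module.endTensorEndAlgHom (R := k) (S := k) (A := k) (M := V) (N := H))
        (Algebra.TensorProduct.map M.act (Algebra.lmul k H) x) (w ⊗ₜ[k] g) =
      TensorProduct.map (LinearMap.applyₗ w ∘ₗ M.act.toLinearMap) (LinearMap.mulRight k g) x := by
    intro x
    induction x with
    | zero => simp
    | add x y hx hy => simp only [map_add, LinearMap.add_apply, hx, hy]
    | tmul a b => rfl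
  exact key _

theorem smashMul_tmul_tmul (v w : V) (h g : H) : M.smashMul (v ⊗ₜ h) (w ⊗ₜ g) =
    TensorProduct.map (LinearMap.mulLeft k v ∘ₗ LinearMap.applyₗ w ∘ₗ M.act.toLinearMap)
      (LinearMap.mulRight k g) (Coalgebra.comul h) := by
  rw [smashMul_tmul, Module.End.mul_apply, diag_tmul]
  generalize (Coalgebra.comul h : H ⊗[k] H) = x
  induction x with
  | zero => simp
  | add x y hx hy => simp only [map_add, hx, hy]
  | tmul a b => simp [leftV_tmul]

theorem diag_mul_leftV (h : H) (w : V) :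
    M.diag h * leftV w = TensorProduct.lift ((LinearMap.mul k (Module.End k (V ⊗[k] H))).compl₁₂
      (leftV.toLinearMap ∘ₗ LinearMap.applyₗ w ∘ₗ M.act.toLinearMap) M.diag.toLinearMap)
      (Coalgebra.comul h) := by
  refine TensorProduct.ext' fun u f => ?_
  let Ψ : H ⊗[k] (H ⊗[k] H) →ₗ[k] V ⊗[k] H :=
    TensorProduct.map (LinearMap.mul' k V) LinearMap.id ∘ₗ
      (TensorProduct.assoc k V V H).symm.toLinearMap ∘ₗ
      TensorProduct.map (LinearMap.applyₗ w ∘ₗ M.act.toLinearMap)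
        (TensorProduct.map (LinearMap.applyₗ u ∘ₗ M.act.toLinearMap) (LinearMap.mulRight k f))
  have h1 : ∀ x : H ⊗[k] H,
      TensorProduct.lift ((LinearMap.mul k (Module.End k (V ⊗[k] H))).compl₁₂
      (leftV.toLinearMap ∘ₗ LinearMap.applyₗ w ∘ₗ M.act.toLinearMap) M.diag.toLinearMap)
      x (u ⊗ₜ f) = Ψ (Coalgebra.comul.lTensor H x) := by
    intro x
    induction x with
    | zero => simp
    | add x y hx hy => simp only [map_add, LinearMap.add_apply, hx, hy]
    | tmul a b =>
      simp only [TensorProduct.lift.tmul, LinearMap.compl₁₂_apply, LinearMap.comp_apply,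
        LinearMap.mul_apply', AlgHom.toLinearMap_apply, Module.End.mul_apply, diag_tmul,
        LinearMap.lTensor_tmul]
      generalize (Coalgebra.comul b : H ⊗[k] H) = y
      induction y with
      | zero => simp
      | add x y hx hy => simp only [map_add, TensorProduct.tmul_add, hx, hy]
      | tmul c d => simp [leftV_tmul, Ψ]
  have h2 : ∀ x : H ⊗[k] H,
      TensorProduct.map (LinearMap.applyₗ (w * u) ∘ₗ M.act.toLinearMap) (LinearMap.mulRight k f) x
        = Ψ (TensorProduct.assoc k H H H (Coalgebra.comul.rTensor H x)) := by
    intro x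
    induction x with
    | zero => simp
    | add x y hx hy => simp only [map_add, hx, hy]
    | tmul a b =>
      simp only [TensorProduct.map_tmul, LinearMap.comp_apply, AlgHom.toLinearMap_apply,
        LinearMap.applyₗ_apply_apply, LinearMap.rTensor_tmul, M.act_mul_right]
      generalize (Coalgebra.comul a : H ⊗[k] H) = y
      induction y with
      | zero => simp
      | add x y hx hy =>
        simp only [map_add, TensorProduct.add_tmul, LinearMap.add_apply, hx, hy]
      | tmul c d => simp [Ψ]
  rw [h1, Module.End.mul_apply, leftV_tmul, diag_tmul, h2, Coalgebra.coassoc_apply]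

theorem smashMul_assoc (x y : V ⊗[k] H) :
    M.smashMul (M.smashMul x y) = M.smashMul x * M.smashMul y := by
  have h1 : ∀ (v : V) (z : V ⊗[k] H), M.smashMul (leftV v z) = leftV v * M.smashMul z := by
    intro v z
    induction z with
    | zero => simp
    | add x y hx hy => simp only [map_add, hx, hy, mul_add]
    | tmul a b => rw [leftV_tmul, smashMul_tmul, smashMul_tmul, map_mul, mul_assoc]
  have h2 : ∀ (h : H) (z : V ⊗[k] H), M.smashMul (M.diag h z) = M.diag h * M.smashMul z := by
    intro h z
    induction z with
    | zero => simp
    | add x y hx hy => simp only [map_add, hx, hy, mul_add]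
    | tmul w g =>
      rw [smashMul_tmul, ← mul_assoc, diag_mul_leftV, diag_tmul]
      generalize (Coalgebra.comul h : H ⊗[k] H) = y
      induction y with
      | zero => simp
      | add x y hx hy => simp only [map_add, hx, hy, add_mul]
      | tmul c d => simp [smashMul_tmul, mul_assoc]
  induction x with
  | zero => simp
  | add x y hx hy => simp only [map_add, LinearMap.add_apply, hx, hy, add_mul]
  | tmul v h => rw [smashMul_tmul, Module.End.mul_apply, h1, h2, mul_assoc]

theorem smashMul_one_left : M.smashMul (1 ⊗ₜ 1) = 1 := by
  rw [smashMul_tmul, map_one, map_one, one_mul]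

theorem smashMul_one_right (x : V ⊗[k] H) : M.smashMul x (1 ⊗ₜ 1) = x := by
  induction x with
  | zero => simp
  | add x y hx hy => simp only [map_add, LinearMap.add_apply, hx, hy]
  | tmul v h =>
    have h1 : (LinearMap.mulLeft k v ∘ₗ LinearMap.applyₗ (1 : V) ∘ₗ M.act.toLinearMap) =
        (LinearMap.toSpanSingleton k V v) ∘ₗ (Coalgebra.counit : H →ₗ[k] k) := by
      ext a
      simp [M.act_one_right, Algebra.algebraMap_eq_smul_one]
    have h2 := congrArg (TensorProduct.map (LinearMap.toSpanSingleton k V v) LinearMap.id)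
      (Coalgebra.rTensor_counit_comul (R := k) h)
    rw [smashMul_tmul_tmul, h1, LinearMap.mulRight_one]
    rw [LinearMap.rTensor, ← LinearMap.comp_apply, ← TensorProduct.map_comp] at h2
    simpa using h2

namespace Smash

instance : Mul M.Smash := ⟨fun x y => M.smashMul x y⟩
instance : One M.Smash := ⟨((1 : V) ⊗ₜ[k] (1 : H) : V ⊗[k] H)⟩

instance : Ring M.Smash :=
  { (inferInstance : AddCommGroup M.Smash), (inferInstance : Mul M.Smash),
    (inferInstance : One M.Smash) with
    left_distrib := fun x y z => map_add (M.smashMul x) y z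
    right_distrib := fun x y z => LinearMap.congr_fun (map_add M.smashMul x y) z
    zero_mul := fun x => LinearMap.congr_fun (map_zero M.smashMul) x
    mul_zero := fun x => map_zero (M.smashMul x)
    mul_assoc := fun x y z => congrArg (fun f => f z) (M.smashMul_assoc x y)
    one_mul := fun x => congrArg (fun f => f x) M.smashMul_one_left
    mul_one := fun x => M.smashMul_one_right x }

instance : Algebra k M.Smash :=
  Algebra.ofModule
    (fun c x y => LinearMap.congr_fun (map_smul M.smashMul c x) y)
    (fun c x y => map_smul (M.smashMul x) c y)

end Smash
end ModuleAlgebra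
end Smash

/-! ## Opposite bialgebra, bijective antipodes, and the Drinfel'd double -/

section Double

/-- `H^op`: the opposite algebra with the same coalgebra structure. -/
instance MulOpposite.instBialgebraOpposite {k H : Type*} [CommRing k] [Ring H] [Bialgebra k H] :
    Bialgebra k Hᵐᵒᵖ :=
  Bialgebra.mk' k Hᵐᵒᵖ (by simp [MulOpposite.counit_def])
    (by intro a b; simp [MulOpposite.counit_def, mul_comm])
    (by simp [MulOpposite.comul_def, Algebra.TensorProduct.one_def])
    (by
      intro a b
      have key : ∀ x y : H ⊗[k] H,
          TensorProduct.map (MulOpposite.opLinearEquiv k).toLinearMap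
            (MulOpposite.opLinearEquiv k).toLinearMap (x * y) =
          TensorProduct.map (MulOpposite.opLinearEquiv k).toLinearMap
            (MulOpposite.opLinearEquiv k).toLinearMap y *
          TensorProduct.map (MulOpposite.opLinearEquiv k).toLinearMap
            (MulOpposite.opLinearEquiv k).toLinearMap x := by
        intro x y
        induction x with
        | zero => simp
        | add x x' hx hx' => simp only [add_mul, mul_add, map_add, hx, hx']
        | tmul a b =>
          induction y with
          | zero => simp
          | add x x' hx hx' => simp only [add_mul, mul_add, map_add, hx, hx']
          | tmul c d => simp
      simp only [MulOpposite.comul_def, LinearMap.comp_apply, LinearEquiv.coe_coe,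
        MulOpposite.coe_opLinearEquiv_symm, MulOpposite.unop_mul, Bialgebra.comul_mul, key])

/-- An antipode of the bialgebra `H` that is a bijective map. -/
structure BijectiveAntipode (k H : Type*) [CommRing k] [Ring H] [Bialgebra k H] where
  /-- the antipode -/
  S : H ≃ₗ[k] H
  mul_antipode_rTensor_comul : LinearMap.mul' k H ∘ₗ S.toLinearMap.rTensor H ∘ₗ Coalgebra.comul =
    (Algebra.linearMap k H) ∘ₗ Coalgebra.counit
  mul_antipode_lTensor_comul : LinearMap.mul' k H ∘ₗ S.toLinearMap.lTensor H ∘ₗ Coalgebra.comul =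
    (Algebra.linearMap k H) ∘ₗ Coalgebra.counit

variable {k H : Type*} [Field k] [Ring H] [Bialgebra k H]

theorem BijectiveAntipode.counit_symm (S : BijectiveAntipode k H) (a : H) :
    Coalgebra.counit (R := k) (S.S.symm a) = Coalgebra.counit (R := k) a := by
  let _ : HopfAlgebra k H :=
    { antipode := S.S.toLinearMap
      mul_antipode_rTensor_comul := S.mul_antipode_rTensor_comul
      mul_antipode_lTensor_comul := S.mul_antipode_lTensor_comul }
  have h := HopfAlgebra.counit_antipode (R := k) (S.S.symm a)
  have h' : HopfAlgebra.antipode k (S.S.symm a) = a := S.S.apply_symm_apply a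
  rw [h'] at h
  exact h.symm

/-- The underlying vector space `H^* ⊗ H` of the Drinfel'd double `D(H) = H^{*cop} ⋈ H`. -/
abbrev DrinfeldDouble (k H : Type*) [Field k] [Ring H] [Bialgebra k H] : Type _ :=
  Module.Dual k H ⊗[k] H

namespace DrinfeldDouble

/-- The convolution product of `H^*`. -/
def dualMul : Module.Dual k H ⊗[k] Module.Dual k H →ₗ[k] Module.Dual k H :=
  (Coalgebra.comul (R := k) (A := H)).dualMap ∘ₗ TensorProduct.dualDistrib k H H

/-- The coproduct of `H^*`, with `p(x y) = p₁(x) p₂(y)`, for finite-dimensional `H`. -/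
def dualComul [Module.Finite k H] :
    Module.Dual k H →ₗ[k] Module.Dual k H ⊗[k] Module.Dual k H :=
  (TensorProduct.dualDistribEquiv k H H).symm.toLinearMap ∘ₗ (LinearMap.mul' k H).dualMap

variable (S : BijectiveAntipode k H)

/-- `a ↦ c ↦ (x ↦ S⁻¹(c) x a)`. -/
def conj : H →ₗ[k] H →ₗ[k] Module.End k H :=
  ((LinearMap.mul k (Module.End k H)).compl₁₂ (LinearMap.mul k H ∘ₗ S.S.symm.toLinearMap)
    (LinearMap.mul k H).flip).flip

theorem conj_apply (a c x : H) : conj S a c x = S.S.symm c * (x * a) := rfl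

/-- `a ⊗ (b ⊗ c) ↦ (q ↦ q(S⁻¹(c) ? a) ⊗ b)`. -/
def crossAux : H ⊗[k] (H ⊗[k] H) →ₗ[k] Module.Dual k H →ₗ[k] DrinfeldDouble k H :=
  TensorProduct.lift
    ((LinearMap.llcomp k (Module.Dual k H) (Module.Dual k H) (DrinfeldDouble k H)).compl₁₂
      (TensorProduct.mk k (Module.Dual k H) H).flip
      (TensorProduct.lift ((conj S).compr₂ Module.Dual.transpose))) ∘ₗ
    (TensorProduct.leftComm k H H H).toLinearMap

theorem crossAux_tmul (a b c : H) (q : Module.Dual k H) :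
    crossAux S (a ⊗ₜ (b ⊗ₜ c)) q = (q ∘ₗ conj S a c) ⊗ₜ b := rfl

/-- The cross relation of the Drinfel'd double:
`(1 ⋈ h) (q ⋈ 1) = q(S⁻¹(h₃) ? h₁) ⋈ h₂`, i.e. `(h₁ ⇀ q₂) ⋈ (h₂ ↼ q₁)` for the coadjoint actions. -/
def cross : H →ₗ[k] Module.Dual k H →ₗ[k] DrinfeldDouble k H :=
  crossAux S ∘ₗ Coalgebra.comul.lTensor H ∘ₗ Coalgebra.comul

/-- `d ↦ (p ⋈ 1) d (1 ⋈ g)`, as a map on `p ⊗ (d ⊗ g)`. -/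
def outer : Module.Dual k H ⊗[k] (DrinfeldDouble k H ⊗[k] H) →ₗ[k] DrinfeldDouble k H :=
  TensorProduct.map dualMul (LinearMap.mul' k H) ∘ₗ
    (TensorProduct.assoc k (Module.Dual k H) (Module.Dual k H) (H ⊗[k] H)).symm.toLinearMap ∘ₗ
    (TensorProduct.assoc k (Module.Dual k H) H H).toLinearMap.lTensor (Module.Dual k H)

/-- The multiplication of the Drinfel'd double:
`(p ⋈ h) (q ⋈ g) = p * q(S⁻¹(h₃) ? h₁) ⋈ h₂ g`. -/
def mul : DrinfeldDouble k H ⊗[k] DrinfeldDouble k H →ₗ[k] DrinfeldDouble k H :=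
  outer ∘ₗ
    ((TensorProduct.lift (cross S)).rTensor H ∘ₗ
      (TensorProduct.assoc k H (Module.Dual k H) H).symm.toLinearMap).lTensor (Module.Dual k H) ∘ₗ
    (TensorProduct.assoc k (Module.Dual k H) H (DrinfeldDouble k H)).toLinearMap

theorem mul_tmul (p q : Module.Dual k H) (h g : H) :
    mul S ((p ⊗ₜ h) ⊗ₜ (q ⊗ₜ g)) = outer (p ⊗ₜ (cross S h q ⊗ₜ g)) := rfl

/-- The unit of the Drinfel'd double. -/
def one : DrinfeldDouble k H := Coalgebra.counit ⊗ₜ 1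

/-- The coproduct of the Drinfel'd double: `Δ(p ⋈ h) = (p₂ ⋈ h₁) ⊗ (p₁ ⋈ h₂)`. -/
def comul [Module.Finite k H] :
    DrinfeldDouble k H →ₗ[k] DrinfeldDouble k H ⊗[k] DrinfeldDouble k H :=
  (TensorProduct.tensorTensorTensorComm k (Module.Dual k H) (Module.Dual k H) H H).toLinearMap ∘ₗ
    TensorProduct.map
      ((TensorProduct.comm k (Module.Dual k H) (Module.Dual k H)).toLinearMap ∘ₗ dualComul)
      Coalgebra.comul

/-- The counit of the Drinfel'd double: `ε(p ⋈ h) = p(1) ε(h)`. -/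
def counit : DrinfeldDouble k H →ₗ[k] k :=
  LinearMap.mul' k k ∘ₗ TensorProduct.map (LinearMap.applyₗ (1 : H)) Coalgebra.counit

/-- The embedding `h ↦ 1 ⋈ h` of `H` into the Drinfel'd double. -/
def inclH : H →ₗ[k] DrinfeldDouble k H :=
  TensorProduct.mk k (Module.Dual k H) H Coalgebra.counit

/-- The embedding `p ↦ p ⋈ 1` of `H^*` into the Drinfel'd double. -/
def inclDual : Module.Dual k H →ₗ[k] DrinfeldDouble k H :=
  (TensorProduct.mk k (Module.Dual k H) H).flip 1

theorem inclH_mul (h g : H) : mul S (inclH h ⊗ₜ inclH g) = inclH (h * g) := by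
  have hd : ∀ p : Module.Dual k H, dualMul ((Coalgebra.counit : Module.Dual k H) ⊗ₜ p) = p := by
    intro p
    ext x
    have h := congrArg (LinearMap.mul' k k ∘ₗ p.lTensor k)
      (Coalgebra.rTensor_counit_comul (R := k) x)
    simp only [LinearMap.comp_apply, LinearMap.lTensor_tmul, LinearMap.mul'_apply, one_mul] at h
    rw [← h]
    simp only [dualMul, LinearMap.comp_apply, LinearMap.dualMap_apply]
    generalize (Coalgebra.comul x : H ⊗[k] H) = y
    induction y with
    | zero => simp
    | add x y hx hy => simp only [map_add, hx, hy]
    | tmul c d => simp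
  have hc : ∀ x : H ⊗[k] (H ⊗[k] H), crossAux S x (Coalgebra.counit) =
      inclH (TensorProduct.rid k H
        (Coalgebra.counit.lTensor H (TensorProduct.lid k _ (Coalgebra.counit.rTensor _ x)))) := by
    intro x
    induction x with
    | zero => simp
    | add x y hx hy => simp only [map_add, LinearMap.add_apply, hx, hy]
    | tmul a y =>
      induction y with
      | zero => simp
      | add x y hx hy => simp only [map_add, TensorProduct.tmul_add, LinearMap.add_apply, hx, hy]
      | tmul b c =>
        have : (Coalgebra.counit : Module.Dual k H) ∘ₗ conj S a c =
            (Coalgebra.counit (R := k) a * Coalgebra.counit (R := k) c) •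
              (Coalgebra.counit : Module.Dual k H) := by
          ext x
          simp only [LinearMap.comp_apply, conj_apply, Bialgebra.counit_mul, S.counit_symm,
            LinearMap.smul_apply, smul_eq_mul]
          ring
        rw [crossAux_tmul, this]
        simp [inclH, TensorProduct.smul_tmul', smul_smul, mul_comm]
  have hx : cross S h Coalgebra.counit = inclH h := by
    rw [cross, LinearMap.comp_apply, hc, LinearMap.comp_apply]
    have : ∀ y : H ⊗[k] H, TensorProduct.lid k _ (Coalgebra.counit.rTensor _
        (Coalgebra.comul.lTensor H y)) =
        Coalgebra.comul (R := k) (TensorProduct.lid k _ (Coalgebra.counit.rTensor _ y)) := by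
      intro y
      induction y with
      | zero => simp
      | add x y hx hy => simp only [map_add, hx, hy]
      | tmul c d => simp
    rw [this, Coalgebra.rTensor_counit_comul]
    simp
  change mul S ((Coalgebra.counit ⊗ₜ h) ⊗ₜ (Coalgebra.counit ⊗ₜ g)) = _
  rw [mul_tmul, hx]
  simp [outer, inclH, hd]

theorem comul_inclH [Module.Finite k H] (h : H) :
    comul (inclH h) = TensorProduct.map inclH inclH (Coalgebra.comul (R := k) h) := by
  have hd : dualComul (Coalgebra.counit : Module.Dual k H) =
      Coalgebra.counit ⊗ₜ Coalgebra.counit := by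
    rw [dualComul, LinearMap.comp_apply, LinearEquiv.coe_coe, LinearEquiv.symm_apply_eq]
    refine TensorProduct.ext' fun a b => ?_
    simp [TensorProduct.dualDistribEquiv]
  simp only [comul, inclH, LinearMap.comp_apply, TensorProduct.mk_apply, TensorProduct.map_tmul,
    hd, LinearEquiv.coe_coe, TensorProduct.comm_tmul]
  generalize (Coalgebra.comul h : H ⊗[k] H) = y
  induction y with
  | zero => simp
  | add x y hx hy => simp only [map_add, TensorProduct.tmul_add, hx, hy]
  | tmul c d => simp

end DrinfeldDouble

/-- A left `D(H)`-module algebra structure on `V`, for `H` finite-dimensional. -/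
structure DoubleModuleAlgebra [Module.Finite k H] (S : BijectiveAntipode k H)
    (V : Type*) [Ring V] [Algebra k V] where
  /-- the action -/
  act : DrinfeldDouble k H →ₗ[k] Module.End k V
  act_one : act DrinfeldDouble.one = 1
  act_mul : ∀ d e, act (DrinfeldDouble.mul S (d ⊗ₜ e)) = act d * act e
  /-- `d · 1 = ε(d) 1` -/
  act_one_right : ∀ d, act d 1 = algebraMap k V (DrinfeldDouble.counit d)
  /-- `d · (u v) = (d₁ · u) (d₂ · v)` -/
  act_mul_right : ∀ d u v, act d (u * v) = LinearMap.mul' k V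
    (TensorProduct.homTensorHomMap (RingHom.id k) V V V V
      (TensorProduct.map act act (DrinfeldDouble.comul d)) (u ⊗ₜ[k] v))

namespace DoubleModuleAlgebra

variable [Module.Finite k H] {S : BijectiveAntipode k H} {V : Type*} [Ring V] [Algebra k V]
  (M : DoubleModuleAlgebra S V)

/-- The action of `H ⊆ D(H)`. -/
def actH : H →ₗ[k] Module.End k V := M.act ∘ₗ DrinfeldDouble.inclH

/-- The action of `H^* ⊆ D(H)`. -/
def actDual : Module.Dual k H →ₗ[k] Module.End k V := M.act ∘ₗ DrinfeldDouble.inclDual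

/-- The `H`-module algebra underlying a `D(H)`-module algebra. -/
def toModuleAlgebra : ModuleAlgebra k H V where
  act := AlgHom.ofLinearMap M.actH (show M.actH 1 = 1 from M.act_one) fun h g => by
    rw [actH, LinearMap.comp_apply, ← DrinfeldDouble.inclH_mul S, M.act_mul]
    rfl
  act_one_right h := by
    change M.act (DrinfeldDouble.inclH h) 1 = _
    rw [M.act_one_right]
    simp [DrinfeldDouble.inclH, DrinfeldDouble.counit]
  act_mul_right h u v := by
    change M.act (DrinfeldDouble.inclH h) (u * v) = _
    rw [M.act_mul_right, DrinfeldDouble.comul_inclH, TensorProduct.map_map]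
    rfl

/-- Lu's condition `∑ᵢ (pᵢ · u) (hᵢ · v) = v u`, for dual bases `hᵢ` of `H` and `pᵢ` of `H^*`. -/
def IsBraidedCommutative : Prop :=
  ∀ u v : V, ∑ i, M.actDual ((Module.finBasis k H).coord i) u *
    M.actH (Module.finBasis k H i) v = v * u

/-- The smash product `V ⋊ H`. -/
abbrev Smash : Type _ := M.toModuleAlgebra.Smash

/-- The element `v ⋊ h` of the smash product. -/
def smk (v : V) (h : H) : M.Smash := (ModuleAlgebra.Smash.equiv M.toModuleAlgebra).symm (v ⊗ₜ h)

/-- Lu's target map `t(v) = ∑ᵢ (pᵢ · v) ⋊ hᵢ`. -/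
def target : V →ₗ[k] M.Smash :=
  (ModuleAlgebra.Smash.equiv M.toModuleAlgebra).symm.toLinearMap ∘ₗ
    ∑ i, (TensorProduct.mk k V H).flip (Module.finBasis k H i) ∘ₗ
      M.actDual ((Module.finBasis k H).coord i)

/-- Lu's source map `s(v) = v ⋊ 1`. -/
def source : V →ₗ[k] M.Smash :=
  (ModuleAlgebra.Smash.equiv M.toModuleAlgebra).symm.toLinearMap ∘ₗ
    (TensorProduct.mk k V H).flip 1

/-- The bialgebroid structure of `V ⋊ H` over `V` in Lu's theorem:
`Δ(v ⋊ h) = (v ⋊ h₁) ⊗_V (1 ⋊ h₂)` and `ε(v ⋊ h) = ε(h) v`. -/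
def smashBialgebroid : LeftBialgebroidData k V M.Smash where
  source := M.source
  target := M.target
  comul := (bimoduleRelations M.source M.target).mkQ ∘ₗ
    TensorProduct.map (ModuleAlgebra.Smash.equiv M.toModuleAlgebra).symm.toLinearMap
      ((ModuleAlgebra.Smash.equiv M.toModuleAlgebra).symm.toLinearMap ∘ₗ
        TensorProduct.mk k V H 1) ∘ₗ
    (TensorProduct.assoc k V H H).symm.toLinearMap ∘ₗ
    Coalgebra.comul.lTensor V ∘ₗ (ModuleAlgebra.Smash.equiv M.toModuleAlgebra).toLinearMap
  counit := (TensorProduct.rid k V).toLinearMap ∘ₗ Coalgebra.counit.lTensor V ∘ₗ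
    (ModuleAlgebra.Smash.equiv M.toModuleAlgebra).toLinearMap

/-- Lu's antipode `τ(v ⋊ h) = ∑ᵢ (1 ⋊ S(h)) t(S²(hᵢ) · (pᵢ · v))`. -/
def luAntipode : M.Smash →ₗ[k] M.Smash :=
  TensorProduct.lift
    (∑ i, ((LinearMap.mul k M.Smash).flip.compl₁₂
      (M.target ∘ₗ M.actH (S.S (S.S (Module.finBasis k H i))) ∘ₗ
        M.actDual ((Module.finBasis k H).coord i))
      ((ModuleAlgebra.Smash.equiv M.toModuleAlgebra).symm.toLinearMap ∘ₗ
        TensorProduct.mk k V H 1 ∘ₗ S.S.toLinearMap))) ∘ₗ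
    (ModuleAlgebra.Smash.equiv M.toModuleAlgebra).toLinearMap

theorem luAntipode_smk (v : V) (h : H) : M.luAntipode (M.smk v h) =
    ∑ i, M.smk 1 (S.S h) * M.target (M.actH (S.S (S.S (Module.finBasis k H i)))
      (M.actDual ((Module.finBasis k H).coord i) v)) := by
  simp [luAntipode, smk]

end DoubleModuleAlgebra

end Double

/-! ## The ring `T = (A ⊗_B A)^B` of a ring extension -/

section Extension

variable {k A : Type*} [CommRing k] [Ring A] [Algebra k A] (B : Subalgebra k A)

/-- The relations `a b ⊗ a' = a ⊗ b a'` defining `A ⊗_B A` as a quotient of `A ⊗_k A`. -/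
def balancedRelations : Submodule k (A ⊗[k] A) :=
  Submodule.span k {x | ∃ b ∈ B, ∃ a a' : A, x = (a * b) ⊗ₜ[k] a' - a ⊗ₜ[k] (b * a')}

/-- The tensor square `A ⊗_B A`. -/
abbrev TensorSquare : Type _ := (A ⊗[k] A) ⧸ balancedRelations B

namespace TensorSquare

/-- The element `a ⊗_B a'`. -/
def tmul (a a' : A) : TensorSquare B := (balancedRelations B).mkQ (a ⊗ₜ a')

/-- A `B`-balanced bilinear map induces a linear map on `A ⊗_B A`. -/
def lift {P : Type*} [AddCommGroup P] [Module k P] (f : A →ₗ[k] A →ₗ[k] P)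
    (hf : ∀ b ∈ B, ∀ a a', f (a * b) a' = f a (b * a')) : TensorSquare B →ₗ[k] P :=
  (balancedRelations B).liftQ (TensorProduct.lift f) (by
    refine Submodule.span_le.2 ?_
    rintro _ ⟨b, hb, a, a', rfl⟩
    simp [hf b hb a a'])

variable {B}

@[simp]
theorem lift_tmul {P : Type*} [AddCommGroup P] [Module k P] (f : A →ₗ[k] A →ₗ[k] P)
    (hf : ∀ b ∈ B, ∀ a a', f (a * b) a' = f a (b * a')) (a a' : A) :
    lift B f hf (tmul B a a') = f a a' := rfl

theorem tmul_balanced {b : A} (hb : b ∈ B) (a a' : A) :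
    tmul B (a * b) a' = tmul B a (b * a') := by
  rw [← sub_eq_zero, tmul, tmul, ← map_sub]
  exact (Submodule.Quotient.mk_eq_zero _).2 (Submodule.subset_span ⟨b, hb, a, a', rfl⟩)

theorem induction {p : TensorSquare B → Prop} (zero : p 0) (add : ∀ x y, p x → p y → p (x + y))
    (tmul : ∀ a a', p (tmul B a a')) (x : TensorSquare B) : p x := by
  obtain ⟨y, rfl⟩ := Submodule.Quotient.mk_surjective _ x
  induction y with
  | zero => exact zero
  | add x y hx hy => exact add _ _ hx hy
  | tmul a a' => exact tmul a a'

variable (B)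

/-- `(a, a') ↦ a ⊗_B a'` as a bilinear map. -/
def mk : A →ₗ[k] A →ₗ[k] TensorSquare B :=
  (TensorProduct.mk k A A).compr₂ (balancedRelations B).mkQ

/-- The `A`-bimodule structure of `A ⊗_B A`: `a ↦ c ↦ (x ↦ a x c)`. -/
def bimul : A →ₗ[k] A →ₗ[k] Module.End k (TensorSquare B) :=
  LinearMap.mk₂ k
    (fun a c => lift B ((mk B).compl₁₂ (LinearMap.mulLeft k a) (LinearMap.mulRight k c)) (by
      intro b hb x y
      change tmul B (a * (x * b)) (y * c) = tmul B (a * x) (b * y * c)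
      rw [← mul_assoc, tmul_balanced hb, mul_assoc]))
    (fun a a' c => LinearMap.ext fun x => by
      induction x using TensorSquare.induction with
      | zero => simp
      | add x y hx hy => simp only [map_add, hx, hy]
      | tmul x y => simp [add_mul])
    (fun r a c => LinearMap.ext fun x => by
      induction x using TensorSquare.induction with
      | zero => simp
      | add x y hx hy => simp only [map_add, hx, hy]
      | tmul x y => simp)
    (fun a c c' => LinearMap.ext fun x => by
      induction x using TensorSquare.induction with
      | zero => simp
      | add x y hx hy => simp only [map_add, hx, hy]
      | tmul x y => simp [mul_add])
    (fun r a c => LinearMap.ext fun x => by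
      induction x using TensorSquare.induction with
      | zero => simp
      | add x y hx hy => simp only [map_add, hx, hy]
      | tmul x y => simp)

variable {B}

@[simp]
theorem bimul_tmul (a c x y : A) : bimul B a c (tmul B x y) = tmul B (a * x) (y * c) := rfl

theorem bimul_bimul (a c a' c' : A) (x : TensorSquare B) :
    bimul B a c (bimul B a' c' x) = bimul B (a * a') (c' * c) x := by
  induction x using TensorSquare.induction with
  | zero => simp
  | add x y hx hy => simp only [map_add, hx, hy]
  | tmul x y => simp [mul_assoc]

end TensorSquare

open TensorSquare

/-- `T = (A ⊗_B A)^B`, the `B`-central elements of `A ⊗_B A`. -/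
def centralSquare : Submodule k (TensorSquare B) where
  carrier := {t | ∀ b ∈ B, bimul B b 1 t = bimul B 1 b t}
  zero_mem' := by simp
  add_mem' := fun {s t} hs ht b hb => by rw [map_add, map_add, hs b hb, ht b hb]
  smul_mem' := fun r t ht b hb => by rw [map_smul, map_smul, ht b hb]

variable {B}

/-- For `t ∈ T`, the map `a ⊗_B a' ↦ a t a'` on `A ⊗_B A`. -/
def insertCentral (t : centralSquare B) : Module.End k (TensorSquare B) :=
  lift B ((bimul B).compr₂ (LinearMap.applyₗ (t : TensorSquare B))) (by
    intro b hb x y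
    change bimul B (x * b) y t = bimul B x (b * y) t
    have h1 := bimul_bimul x y b 1 (t : TensorSquare B)
    have h2 := bimul_bimul x y 1 b (t : TensorSquare B)
    rw [one_mul] at h1
    rw [mul_one] at h2
    rw [← h1, ← h2, t.2 b hb])

@[simp]
theorem insertCentral_tmul (t : centralSquare B) (x y : A) :
    insertCentral t (tmul B x y) = bimul B x y t := rfl

theorem insertCentral_bimul (t : centralSquare B) (a c : A) (x : TensorSquare B) :
    insertCentral t (bimul B a c x) = bimul B a c (insertCentral t x) := by
  induction x using TensorSquare.induction with
  | zero => simp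
  | add x y hx hy => simp only [map_add, hx, hy]
  | tmul x y => simp [bimul_bimul]

namespace centralSquare

/-- The multiplication `t t' = t'¹ t¹ ⊗ t² t'²` of `T`. -/
instance : Mul (centralSquare B) :=
  ⟨fun t t' => ⟨insertCentral t t', fun b hb => by
    rw [← insertCentral_bimul, ← insertCentral_bimul, t'.2 b hb]⟩⟩

/-- The unit `1 ⊗ 1` of `T`. -/
instance : One (centralSquare B) :=
  ⟨⟨tmul B 1 1, fun b hb => by
    simp only [bimul_tmul, one_mul, mul_one]
    simpa using tmul_balanced hb 1 1⟩⟩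

theorem coe_mul (t t' : centralSquare B) :
    ((t * t' : centralSquare B) : TensorSquare B) = insertCentral t t' := rfl

theorem coe_one : ((1 : centralSquare B) : TensorSquare B) = tmul B 1 1 := rfl

theorem insertCentral_add (s t : centralSquare B) (x : TensorSquare B) :
    insertCentral (s + t) x = insertCentral s x + insertCentral t x := by
  induction x using TensorSquare.induction with
  | zero => simp
  | add x y hx hy => simp only [map_add, hx, hy]; abel
  | tmul x y => simp

theorem insertCentral_smul (r : k) (t : centralSquare B) (x : TensorSquare B) :
    insertCentral (r • t) x = r • insertCentral t x := by
  induction x using TensorSquare.induction with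
  | zero => simp
  | add x y hx hy => simp only [map_add, hx, hy, smul_add]
  | tmul x y => simp

theorem bimul_one_one (x : TensorSquare B) : bimul B 1 1 x = x := by
  induction x using TensorSquare.induction with
  | zero => simp
  | add x y hx hy => simp only [map_add, hx, hy]
  | tmul x y => simp

instance : Ring (centralSquare B) :=
  { (inferInstance : AddCommGroup (centralSquare B)), (inferInstance : Mul (centralSquare B)),
    (inferInstance : One (centralSquare B)) with
    left_distrib := fun s t u => Subtype.ext (map_add (insertCentral s) _ _)
    right_distrib := fun s t u => Subtype.ext (insertCentral_add s t u)
    zero_mul := fun t => Subtype.ext (by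
      have h := insertCentral_smul (0 : k) (0 : centralSquare B) (t : TensorSquare B)
      rwa [zero_smul, zero_smul] at h)
    mul_zero := fun t => Subtype.ext (map_zero (insertCentral t))
    mul_assoc := fun s t u => Subtype.ext (by
      rw [coe_mul, coe_mul, coe_mul]
      induction (u : TensorSquare B) using TensorSquare.induction with
      | zero => simp
      | add x y hx hy => simp only [map_add, hx, hy]
      | tmul x y =>
        rw [insertCentral_tmul, insertCentral_tmul, coe_mul, insertCentral_bimul])
    one_mul := fun t => Subtype.ext (by
      rw [coe_mul]
      induction (t : TensorSquare B) using TensorSquare.induction with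
      | zero => simp
      | add x y hx hy => simp only [map_add, hx, hy]
      | tmul x y => simp [coe_one])
    mul_one := fun t => Subtype.ext (by rw [coe_mul, coe_one, insertCentral_tmul, bimul_one_one]) }

instance : Algebra k (centralSquare B) :=
  Algebra.ofModule (fun r s t => Subtype.ext (insertCentral_smul r s t))
    (fun r s t => Subtype.ext (map_smul (insertCentral s) r (t : TensorSquare B)))

end centralSquare

variable (B)

/-- The centralizer `R` of `B` in `A`. -/
abbrev extCentralizer : Subalgebra k A := Subalgebra.centralizer k (B : Set A)

/-- The map `R → T`, `r ↦ r ⊗ 1`. -/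
def centralInclLeft : extCentralizer B →ₗ[k] centralSquare B :=
  LinearMap.codRestrict _ ((mk B).flip 1 ∘ₗ (extCentralizer B).val.toLinearMap) (by
    intro r b hb
    change bimul B b 1 (tmul B r 1) = bimul B 1 b (tmul B r 1)
    have hr : b * (r : A) = r * b := (Subalgebra.mem_centralizer_iff k).1 r.2 b hb
    have h := tmul_balanced hb (r : A) 1
    simpa [hr] using h)

/-- The map `R → T`, `r ↦ 1 ⊗ r`. -/
def centralInclRight : extCentralizer B →ₗ[k] centralSquare B :=
  LinearMap.codRestrict _ (mk B 1 ∘ₗ (extCentralizer B).val.toLinearMap) (by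
    intro r b hb
    change bimul B b 1 (tmul B 1 r) = bimul B 1 b (tmul B 1 r)
    have hr : b * (r : A) = r * b := (Subalgebra.mem_centralizer_iff k).1 r.2 b hb
    have h := tmul_balanced hb 1 (r : A)
    simpa [hr] using h)

/-- For `r ∈ R`, the map `A ⊗_B A → A`, `a ⊗ a' ↦ a r a'`. -/
def sandwich (r : extCentralizer B) : TensorSquare B →ₗ[k] A :=
  lift B ((LinearMap.mul k A).compl₁₂ (LinearMap.mulRight k (r : A)) LinearMap.id) (by
    intro b hb x y
    have hr : b * (r : A) = r * b := (Subalgebra.mem_centralizer_iff k).1 r.2 b hb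
    change x * b * r * y = x * r * (b * y)
    rw [mul_assoc x b, hr]
    simp only [mul_assoc])

/-- The counit `T → R`, `t ↦ t¹ t²`. -/
def centralCounit : centralSquare B →ₗ[k] extCentralizer B :=
  LinearMap.codRestrict (Subalgebra.toSubmodule (extCentralizer B))
    (sandwich B 1 ∘ₗ (centralSquare B).subtype) (by
    intro t
    refine (Subalgebra.mem_centralizer_iff k).2 fun b hb => ?_
    have h1 : ∀ x : TensorSquare B, b * sandwich B 1 x = sandwich B 1 (bimul B b 1 x) := by
      intro x
      induction x using TensorSquare.induction with
      | zero => simp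
      | add x y hx hy => simp only [map_add, mul_add, hx, hy]
      | tmul x y => simp [sandwich, mul_assoc]
    have h2 : ∀ x : TensorSquare B, sandwich B 1 x * b = sandwich B 1 (bimul B 1 b x) := by
      intro x
      induction x using TensorSquare.induction with
      | zero => simp
      | add x y hx hy => simp only [map_add, add_mul, hx, hy]
      | tmul x y => simp [sandwich, mul_assoc]
    change b * sandwich B 1 t = sandwich B 1 t * b
    rw [h1, h2, t.2 b hb])

/-- `S = End _BA_B`, the `B`-bimodule endomorphisms of `A`. -/
def bimoduleEnd : Submodule k (Module.End k A) where
  carrier := {f | ∀ b ∈ B, ∀ a, f (b * a) = b * f a ∧ f (a * b) = f a * b}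
  zero_mem' := by simp
  add_mem' := fun {f g} hf hg b hb a => by
    simp [(hf b hb a).1, (hf b hb a).2, (hg b hb a).1, (hg b hb a).2, mul_add, add_mul]
  smul_mem' := fun r f hf b hb a => by simp [(hf b hb a).1, (hf b hb a).2]

/-- A left depth two quasibasis: `a ⊗ a' = ∑ᵢ tᵢ βᵢ(a) a'`. -/
structure LeftD2Quasibasis where
  /-- the number of elements -/
  n : ℕ
  /-- the elements `tᵢ` of `T` -/
  t : Fin n → centralSquare B
  /-- the elements `βᵢ` of `S` -/
  β : Fin n → bimoduleEnd B
  eq : ∀ a a' : A, tmul B a a' = ∑ i, bimul B 1 ((β i).1 a * a') (t i)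

/-- A right depth two quasibasis: `a ⊗ a' = ∑ⱼ a γⱼ(a') uⱼ`. -/
structure RightD2Quasibasis where
  /-- the number of elements -/
  n : ℕ
  /-- the elements `uⱼ` of `T` -/
  u : Fin n → centralSquare B
  /-- the elements `γⱼ` of `S` -/
  γ : Fin n → bimoduleEnd B
  eq : ∀ a a' : A, tmul B a a' = ∑ j, bimul B (a * (γ j).1 a') 1 (u j)

variable {B}

/-- For `γ ∈ S`, the map `T → T`, `t ↦ t¹ ⊗ γ(t²)`. -/
def applyRight (γ : bimoduleEnd B) : centralSquare B →ₗ[k] centralSquare B :=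
  LinearMap.codRestrict _
    (lift B ((mk B).compl₂ γ.1) (by
      intro b hb x y
      change tmul B (x * b) (γ.1 y) = tmul B x (γ.1 (b * y))
      rw [(γ.2 b hb y).1, tmul_balanced hb]) ∘ₗ (centralSquare B).subtype) (by
    intro t b hb
    have hf : ∀ b ∈ B, ∀ a a',
        (mk B).compl₂ γ.1 (a * b) a' = (mk B).compl₂ γ.1 a (b * a') := by
      intro b hb x y
      change tmul B (x * b) (γ.1 y) = tmul B x (γ.1 (b * y))
      rw [(γ.2 b hb y).1, tmul_balanced hb]
    have h1 : ∀ x : TensorSquare B, bimul B b 1 (lift B _ hf x) = lift B _ hf (bimul B b 1 x) := by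
      intro x
      induction x using TensorSquare.induction with
      | zero => simp
      | add x y hx hy => simp only [map_add, hx, hy]
      | tmul x y =>
        change tmul B (b * x) (γ.1 y * 1) = tmul B (b * x) (γ.1 (y * 1))
        rw [mul_one, mul_one]
    have h2 : ∀ x : TensorSquare B, bimul B 1 b (lift B _ hf x) = lift B _ hf (bimul B 1 b x) := by
      intro x
      induction x using TensorSquare.induction with
      | zero => simp
      | add x y hx hy => simp only [map_add, hx, hy]
      | tmul x y =>
        change tmul B (1 * x) (γ.1 y * b) = tmul B (1 * x) (γ.1 (y * b))
        rw [(γ.2 b hb y).2]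
    change bimul B b 1 (lift B _ hf t) = bimul B 1 b (lift B _ hf t)
    rw [h1, h2, t.2 b hb])

variable (B) in
/-- The source map `R → T^op`, `r ↦ r ⊗ 1`. -/
def opSource : extCentralizer B →ₗ[k] (centralSquare B)ᵐᵒᵖ :=
  (MulOpposite.opLinearEquiv k).toLinearMap ∘ₗ centralInclLeft B

variable (B) in
/-- The target map `R → T^op`, `r ↦ 1 ⊗ r`. -/
def opTarget : extCentralizer B →ₗ[k] (centralSquare B)ᵐᵒᵖ :=
  (MulOpposite.opLinearEquiv k).toLinearMap ∘ₗ centralInclRight B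

/-- The map `t ↦ ∑ⱼ (t¹ ⊗ γⱼ(t²)) ⊗_k uⱼ`, which represents the coproduct of `T^op`. -/
def opComulRep (q : RightD2Quasibasis B) :
    (centralSquare B)ᵐᵒᵖ →ₗ[k] (centralSquare B)ᵐᵒᵖ ⊗[k] (centralSquare B)ᵐᵒᵖ :=
  ∑ j, (TensorProduct.mk k (centralSquare B)ᵐᵒᵖ (centralSquare B)ᵐᵒᵖ).flip
      (MulOpposite.op (q.u j)) ∘ₗ
    ((MulOpposite.opLinearEquiv k).toLinearMap ∘ₗ applyRight (q.γ j) ∘ₗ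
      (MulOpposite.opLinearEquiv k).symm.toLinearMap)

/-- The left `R`-bialgebroid `T^op` of a depth two extension `A | B`: source `r ↦ r ⊗ 1`, target
`r ↦ 1 ⊗ r`, coproduct `Δ(t) = ∑ⱼ (t¹ ⊗ γⱼ(t²)) ⊗_R uⱼ` and counit `ε(t) = t¹ t²`. -/
def centralSquareOpBialgebroid (q : RightD2Quasibasis B) :
    LeftBialgebroidData k (extCentralizer B) (centralSquare B)ᵐᵒᵖ where
  source := opSource B
  target := opTarget B
  comul := (bimoduleRelations (opSource B) (opTarget B)).mkQ ∘ₗ opComulRep q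
  counit := centralCounit B ∘ₗ (MulOpposite.opLinearEquiv k).symm.toLinearMap

end Extension

/-! ## Hopf–Galois extensions -/

section Galois

variable {k H A : Type*} [Field k] [Ring H] [HopfAlgebra k H] [Ring A] [Algebra k A]
  (ρ : A →ₐ[k] A ⊗[k] H)

/-- The coinvariants `B = {a | ρ(a) = a ⊗ 1}` of a coaction. -/
def coinvariants : Subalgebra k A := AlgHom.equalizer ρ Algebra.TensorProduct.includeLeft

/-- The Galois map `β : A ⊗_B A → A ⊗ H`, `a ⊗ a' ↦ a a'₀ ⊗ a'₁`. -/
def galoisMap : TensorSquare (coinvariants ρ) →ₗ[k] A ⊗[k] H :=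
  TensorSquare.lift _ ((LinearMap.mul k (A ⊗[k] H)).compl₁₂
    (Algebra.TensorProduct.includeLeft : A →ₐ[k] A ⊗[k] H).toLinearMap ρ.toLinearMap) (by
    intro b hb x y
    have hb' : ρ b = b ⊗ₜ 1 := hb
    simp [hb', ← mul_assoc])

/-- `ρ` is a coaction making `A` a right `H`-comodule algebra, and the extension `A | B` of its
coinvariants is `H`-Galois. -/
structure IsHopfGalois : Prop where
  coassoc : ∀ a, TensorProduct.assoc k A H H (ρ.toLinearMap.rTensor H (ρ a)) =
    Coalgebra.comul.lTensor A (ρ a)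
  counit : ∀ a, Coalgebra.counit.lTensor A (ρ a) = a ⊗ₜ[k] (1 : k)
  galois : Function.Bijective (galoisMap ρ)

/-- The map `R ⊗ H^op → A ⊗ H` induced by the inclusion of the centralizer `R` of `B` in `A`. -/
def centralizerInclusion :
    extCentralizer (coinvariants ρ) ⊗[k] Hᵐᵒᵖ →ₗ[k] A ⊗[k] H :=
  TensorProduct.map (extCentralizer (coinvariants ρ)).val.toLinearMap
    (MulOpposite.opLinearEquiv k).symm.toLinearMap

end Galois

end

/-! Since β is bijective, a B-balanced map on A ⊗_B A is the same as a map on A ⊗ H. For r in R the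
map a ⊗ a' ↦ a r a' becomes `sandwichMap`; its value at 1 ⊗ h is r ◁ h, and a₀ (r ◁ a₁) = r a. The
elements c a₀ ⊗ a₁ span A ⊗ H (`bilinear_ext`), so this one identity determines the action and
yields all of its properties by testing on such elements.

β is also B-bilinear, where A ⊗ H carries the two multiplications by b ⊗ 1. Hence it identifies T
with the centralizer of B ⊗ 1 in A ⊗ H, which is R ⊗ H because H is free over k. The same argument
shows that ρ maps R into R ⊗ H. With the action ◁ and this coaction, R is an algebra among the
Yetter–Drinfel'd modules over K = H^op, and it is braided commutative: u₀ (u₁ · v) = v u is the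
identity above for a = u (`isBraidedYetterDrinfeld`). The Yetter–Drinfel'd condition is what makes
action and coaction combine to an action of the Drinfel'd double (`doubleAct_cross`).

Lu's theorem is proved for every braided commutative Yetter–Drinfel'd module algebra V over a
finite-dimensional K with bijective antipode. Braided commutativity gives t(r)(v ⋊ h) = v r₀ ⋊ r₁ h
(`target_mul_smk`): sources multiply V on the left and targets on the right, so they commute. The
Yetter–Drinfel'd condition gives (1 ⋊ h) t(v) = t(h₂ · v)(1 ⋊ h₁) (`smk_mul_target`), which is the
Takeuchi condition in disguise. For the antipode, put θ(v) = S²(v₁) · v₀. This map is multiplicative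
and intertwines action and coaction with their twists by S² (`theta_mul`, `theta_act`,
`coact_theta`), so τ(v ⋊ h) = (1 ⋊ S(h)) t(θ(v)) is anti-multiplicative and sends t to s; its
inverse is v ⋊ h ↦ (1 ⋊ S⁻¹(h)) t(v).

Finally, β carries the product and coproduct of T^op to those of R ⋊ H^op when both are computed in
A ⊗ H (`galoisMap_insertCentral`, `sum_moveLeft_galoisMap`), and Lu's axioms are transported along
this isomorphism. Depth two is read off from coordinates of ρ with respect to a basis of H; the left
quasibasis needs S⁻¹. Bijectivity of S itself follows from Fitting's lemma applied to S² and the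
uniqueness of convolution inverses (`antipode_bijective`). -/

noncomputable section

/-! ## Sweedler sums -/

section Sweedler

open TensorProduct

variable {k M N P Q U W : Type*} [Field k] [AddCommGroup M] [Module k M] [AddCommGroup N]
  [Module k N] [AddCommGroup P] [Module k P] [AddCommGroup Q] [Module k Q]
  [AddCommGroup U] [Module k U] [AddCommGroup W] [Module k W]

variable (k) in
/-- `F` is bilinear. -/
def Bilin (F : M → N → P) : Prop :=
  (∀ n, IsLinearMap k fun m => F m n) ∧ ∀ m, IsLinearMap k fun n => F m n

variable (k) in
/-- `F` is trilinear. -/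
def Trilin (F : M → N → U → P) : Prop :=
  (∀ n u, IsLinearMap k fun m => F m n u) ∧ (∀ m u, IsLinearMap k fun n => F m n u) ∧
    ∀ m n, IsLinearMap k fun u => F m n u

theorem Bilin.exists_eq {F : M → N → P} (hF : Bilin k F) :
    ∃ f : M →ₗ[k] N →ₗ[k] P, F = fun m n => f m n :=
  ⟨LinearMap.mk₂ k F (fun m m' n => (hF.1 n).1 m m') (fun c m n => (hF.1 n).2 c m)
    (fun m n n' => (hF.2 m).1 n n') (fun c m n => (hF.2 m).2 c n), rfl⟩

theorem Trilin.exists_eq {F : M → N → U → P} (hF : Trilin k F) :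
    ∃ f : M →ₗ[k] N →ₗ[k] U →ₗ[k] P, F = fun m n u => f m n u :=
  ⟨LinearMap.mk₂ k (fun m n => (hF.2.2 m n).mk' _)
    (fun m m' n => LinearMap.ext fun u => (hF.1 n u).1 m m')
    (fun c m n => LinearMap.ext fun u => (hF.1 n u).2 c m)
    (fun m n n' => LinearMap.ext fun u => (hF.2.1 m u).1 n n')
    (fun c m n => LinearMap.ext fun u => (hF.2.1 m u).2 c n), rfl⟩

variable [Module.Finite k N] [Module.Finite k U]

/-- `∑ F m n`, where `x = ∑ m ⊗ n` with `n` running through a basis. -/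
def sweedler {P : Type*} [AddCommGroup P] (x : M ⊗[k] N) (F : M → N → P) : P :=
  ∑ i, F (TensorProduct.rid k M (((Module.finBasis k N).coord i).lTensor M x))
    (Module.finBasis k N i)

/-- Independence of the basis. `sweedler` accepts any function as summand, so pushing maps through a
sum (`map_sweedler`) and exchanging sums (`sweedler_comm`) are facts about finite sums; bilinearity
is needed only when the tensor itself is rewritten. -/
theorem sweedler_bundled (x : M ⊗[k] N) (f : M →ₗ[k] N →ₗ[k] P) :
    sweedler x (fun m n => f m n) = TensorProduct.lift f x := by
  induction x with
  | zero => simp [sweedler]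
  | add x y hx hy =>
    rw [map_add, ← hx, ← hy]
    simp only [sweedler, map_add, LinearMap.add_apply, Finset.sum_add_distrib]
  | tmul m n =>
    simp only [sweedler, LinearMap.lTensor_tmul, TensorProduct.rid_tmul, lift.tmul, map_smul,
      LinearMap.smul_apply]
    conv_rhs => rw [← (Module.finBasis k N).sum_repr n, map_sum]
    simp only [map_smul, Module.Basis.coord_apply]

theorem sweedler_tmul {F : M → N → P} (m : M) (n : N) (hF : Bilin k F) :
    sweedler (m ⊗ₜ[k] n) F = F m n := by
  obtain ⟨f, rfl⟩ := hF.exists_eq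
  rw [sweedler_bundled, lift.tmul]

theorem sweedler_self (x : M ⊗[k] N) : sweedler x (fun m n => m ⊗ₜ[k] n) = x := by
  have := sweedler_bundled x (TensorProduct.mk k M N)
  rw [TensorProduct.lift_mk] at this
  exact this

theorem map_sweedler {G P Q : Type*} [AddCommGroup P] [AddCommGroup Q] [FunLike G P Q]
    [AddMonoidHomClass G P Q] (g : G) (x : M ⊗[k] N) (F : M → N → P) :
    g (sweedler x F) = sweedler x fun m n => g (F m n) := map_sum _ _ _

theorem mul_sweedler {L : Type*} [Ring L] (y : L) (x : M ⊗[k] N) (F : M → N → L) :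
    y * sweedler x F = sweedler x fun m n => y * F m n := Finset.mul_sum _ _ _

theorem sweedler_mul_right {L : Type*} [Ring L] (y : L) (x : M ⊗[k] N) (F : M → N → L) :
    sweedler x F * y = sweedler x fun m n => F m n * y := Finset.sum_mul _ _ _

theorem sweedler_tmul_right (y : Q) (x : M ⊗[k] N) (F : M → N → P) :
    sweedler x F ⊗ₜ[k] y = sweedler x fun m n => F m n ⊗ₜ[k] y := TensorProduct.sum_tmul _ _ _

theorem tmul_sweedler (y : Q) (x : M ⊗[k] N) (F : M → N → P) :
    y ⊗ₜ[k] sweedler x F = sweedler x fun m n => y ⊗ₜ[k] F m n := TensorProduct.tmul_sum _ _ _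

theorem sweedler_comm {P : Type*} [AddCommGroup P] (x : M ⊗[k] N) (y : Q ⊗[k] U)
    (F : M → N → Q → U → P) :
    (sweedler x fun m n => sweedler y fun q u => F m n q u) =
      sweedler y fun q u => sweedler x fun m n => F m n q u := Finset.sum_comm

theorem sweedler_map [Module.Finite k W] {F : Q → W → P} (f : M →ₗ[k] Q) (g : N →ₗ[k] W)
    (x : M ⊗[k] N) (hF : Bilin k F) :
    sweedler (TensorProduct.map f g x) F = sweedler x fun m n => F (f m) (g n) := by
  obtain ⟨h, rfl⟩ := hF.exists_eq
  rw [sweedler_bundled]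
  refine Eq.trans ?_ (sweedler_bundled x (h.compl₁₂ f g)).symm
  induction x with
  | zero => simp
  | add x y hx hy => simp only [map_add, hx, hy]
  | tmul m n => rfl

theorem sweedler_mul {A B : Type*} [Ring A] [Algebra k A] [Ring B] [Algebra k B]
    [Module.Finite k B] {F : A → B → P} (x y : A ⊗[k] B) (hF : Bilin k F) :
    sweedler (x * y) F = sweedler x fun a b => sweedler y fun c d => F (a * c) (b * d) := by
  obtain ⟨h, rfl⟩ := hF.exists_eq
  conv_lhs => rw [← sweedler_self x, ← sweedler_self y, sweedler_mul_right]
  simp only [mul_sweedler, sweedler_bundled, map_sweedler, Algebra.TensorProduct.tmul_mul_tmul,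
    lift.tmul]

/-- Coassociativity of a coaction, as an equality of Sweedler sums. -/
theorem sweedler_coassoc [Coalgebra k N] (δ : M →ₗ[k] M ⊗[k] N)
    (hδ : ∀ m, TensorProduct.assoc k M N N (δ.rTensor N (δ m)) =
      Coalgebra.comul.lTensor M (δ m))
    (F : M → N → N → P) (m : M) (hF : Trilin k F) :
    (sweedler (δ m) fun w c => sweedler (δ w) fun u a => F u a c) =
      sweedler (δ m) fun u c => sweedler (Coalgebra.comul (R := k) c) fun a b => F u a b := by
  obtain ⟨f, rfl⟩ := hF.exists_eq
  have h := congrArg (TensorProduct.lift (TensorProduct.uncurry (RingHom.id k) N N P ∘ₗ f)) (hδ m)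
  rw [← sweedler_self (δ m)] at h
  simp only [map_sweedler, LinearMap.rTensor_tmul, LinearMap.lTensor_tmul, lift.tmul,
    LinearMap.comp_apply] at h
  refine Eq.trans ?_ (h.trans ?_)
  · congr 1; funext w c
    conv_rhs => rw [← sweedler_self (δ w)]
    simp only [map_sweedler, sweedler_tmul_right, assoc_tmul, lift.tmul, LinearMap.comp_apply,
      TensorProduct.uncurry_apply]
  · congr 1; funext w c
    conv_lhs => rw [← sweedler_self (Coalgebra.comul (R := k) c)]
    simp only [map_sweedler, TensorProduct.uncurry_apply]

end Sweedler

/-! ### Sums over the coproduct of a bialgebra. -/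

section ComulSum

variable {k K P : Type*} [Field k] [Ring K] [Bialgebra k K] [Module.Finite k K]
  [AddCommGroup P] [Module k P]

variable (k) in
/-- `∑ F h₁ h₂`. -/
abbrev comulSum {P : Type*} [AddCommGroup P] (h : K) (F : K → K → P) : P :=
  sweedler (Coalgebra.comul (R := k) h) F

/-- This is the licence to write h₁, h₂, h₃. The recurring pattern in later proofs is to rebracket
so that two adjacent legs form an inner sum, collapse that sum to a counit by an antipode identity,
and absorb the counit. -/
theorem comulSum_coassoc (F : K → K → K → P) (h : K) (hF : Trilin k F := by
      refine ⟨fun _ _ => ⟨fun _ _ => ?_, fun _ _ => ?_⟩, fun _ _ => ⟨fun _ _ => ?_, fun _ _ => ?_⟩,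
        fun _ _ => ⟨fun _ _ => ?_, fun _ _ => ?_⟩⟩
      all_goals simp [sweedler, mul_add, add_mul, Finset.sum_add_distrib, Finset.smul_sum,
        TensorProduct.tmul_add, TensorProduct.add_tmul, ← TensorProduct.smul_tmul',
        TensorProduct.tmul_smul]) :
    (comulSum k h fun w c => comulSum k w fun u a => F u a c) =
      comulSum k h fun u c => comulSum k c fun a b => F u a b :=
  sweedler_coassoc Coalgebra.comul Coalgebra.coassoc_apply F h hF

theorem comulSum_counit_left (f : K →ₗ[k] P) (h : K) :
    (comulSum k h fun a b => Coalgebra.counit (R := k) a • f b) = f h := by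
  have H := congrArg (f ∘ₗ TensorProduct.lid k K) (Coalgebra.rTensor_counit_comul (R := k) h)
  conv_lhs at H => rw [← sweedler_self (Coalgebra.comul (R := k) h)]
  simpa [map_sweedler] using H

theorem comulSum_counit_right (f : K →ₗ[k] P) (h : K) :
    (comulSum k h fun a b => Coalgebra.counit (R := k) b • f a) = f h := by
  have H := congrArg (f ∘ₗ TensorProduct.rid k K) (Coalgebra.lTensor_counit_comul (R := k) h)
  conv_lhs at H => rw [← sweedler_self (Coalgebra.comul (R := k) h)]
  simpa [map_sweedler] using H

end ComulSum

/-! ## The antipode of a finite-dimensional Hopf algebra -/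

section Antipode

variable {k H A : Type*} [Field k] [Ring H] [HopfAlgebra k H] [Module.Finite k H] [Ring A]
  [Algebra k A]

open HopfAlgebra

theorem comulSum_antipode_mul (h : H) :
    (comulSum k h fun a b => antipode k a * b) = algebraMap k H (Coalgebra.counit h) := by
  have H := mul_antipode_rTensor_comul_apply (R := k) h
  rw [← sweedler_self (Coalgebra.comul (R := k) h)] at H
  simpa [map_sweedler] using H

theorem comulSum_mul_antipode (h : H) :
    (comulSum k h fun a b => a * antipode k b) = algebraMap k H (Coalgebra.counit h) := by
  have H := mul_antipode_lTensor_comul_apply (R := k) h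
  rw [← sweedler_self (Coalgebra.comul (R := k) h)] at H
  simpa [map_sweedler] using H

/-- Uniqueness of convolution inverses: f ∘ S is a right inverse of f and g ∘ S is a left inverse of
g. If the two coincide, then f = f * (g ∘ S) * g = g. In other words S is an epimorphism as far as
algebra maps can tell, even before surjectivity is known. -/
theorem eq_of_comp_antipode_eq (f g : H →ₗ[k] A) (f_one : f 1 = 1) (g_one : g 1 = 1)
    (f_mul : ∀ x y, f (x * y) = f x * f y) (g_mul : ∀ x y, g (x * y) = g x * g y)
    (hfg : ∀ x, f (antipode k x) = g (antipode k x)) : f = g := by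
  ext x
  have h := comulSum_coassoc (k := k) (fun a b c => f a * f (antipode k b) * g c) x
  have h1 : ∀ a c : H, (comulSum k a fun u b => f u * f (antipode k b) * g c) =
      Coalgebra.counit (R := k) a • g c := by
    intro a c
    simp only [← f_mul, ← sweedler_mul_right, ← map_sweedler, comulSum_mul_antipode]
    simp [Algebra.algebraMap_eq_smul_one, f_one]
  have h2 : ∀ a c : H, (comulSum k c fun u b => f a * f (antipode k u) * g b) =
      Coalgebra.counit (R := k) c • f a := by
    intro a c
    simp only [hfg, mul_assoc, ← g_mul, ← mul_sweedler, ← map_sweedler, comulSum_antipode_mul]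
    simp [Algebra.algebraMap_eq_smul_one, g_one]
  simp only [h1, h2, comulSum_counit_left, comulSum_counit_right] at h
  exact h.symm

end Antipode

/-! ### Bijectivity of the antipode, and its effect on the coproduct. -/

section AntipodeBijective

variable {k H A : Type*} [Field k] [Ring H] [HopfAlgebra k H] [Module.Finite k H] [Ring A]
  [Algebra k A]

open HopfAlgebra

/-- An anti-homomorphism to A is a homomorphism to the opposite algebra. -/
theorem eq_of_comp_antipode_eq_of_anti (f g : H →ₗ[k] A) (f_one : f 1 = 1) (g_one : g 1 = 1)
    (f_mul : ∀ x y, f (x * y) = f y * f x) (g_mul : ∀ x y, g (x * y) = g y * g x)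
    (hfg : ∀ x, f (antipode k x) = g (antipode k x)) : f = g := by
  have h := eq_of_comp_antipode_eq ((MulOpposite.opLinearEquiv k).toLinearMap ∘ₗ f)
    ((MulOpposite.opLinearEquiv k).toLinearMap ∘ₗ g) (by simp [f_one]) (by simp [g_one])
    (by simp [f_mul]) (by simp [g_mul]) (by simp [hfg])
  ext x
  simpa using LinearMap.congr_fun h x

-- Let E be a power of the algebra map S² for which H is the direct sum of kernel and image of E.
-- The projection π onto the image along the kernel is an algebra map with π E = E. Cancelling
-- antipodes on the right one after the other, which `eq_of_comp_antipode_eq` permits, gives π = id.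
-- So E, and with it S, is surjective.
variable (k H) in
theorem antipode_bijective : Function.Bijective (antipode k : H →ₗ[k] H) := by
  let D : H →ₐ[k] H := AlgHom.ofLinearMap (antipode k ∘ₗ antipode k)
    (by simp [antipode_one]) (by simp [antipode_mul_antidistrib])
  -- Fitting's lemma. The condition n ≥ 1 lets one factor S be split off from E at the end.
  obtain ⟨n, hn, hn1⟩ := ((LinearMap.eventually_isCompl_ker_pow_range_pow D.toLinearMap).and
    (Filter.eventually_ge_atTop 1)).exists
  let E : H →ₐ[k] H := D ^ n
  have hE : D.toLinearMap ^ n = E.toLinearMap := by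
    ext x
    simp [E, Module.End.pow_apply, AlgHom.coe_pow]
  rw [hE] at hn
  -- E is injective on its image, as the image meets the kernel trivially.
  have huniq : ∀ y z, E (E y) = E (E z) → E y = E z := by
    intro y z h
    rw [← sub_eq_zero]
    refine (Submodule.disjoint_def.1 hn.disjoint) _ ?_ ⟨y - z, map_sub E y z⟩
    rw [LinearMap.mem_ker]
    simp [h]
  have hex : ∀ x, ∃ y, E (E y) = E x := by
    intro x
    obtain ⟨a, ha, b, ⟨y, rfl⟩, rfl⟩ := Submodule.mem_sup.1
      (hn.codisjoint.eq_top ▸ Submodule.mem_top (x := x) :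
        x ∈ LinearMap.ker E.toLinearMap ⊔ LinearMap.range E.toLinearMap)
    have ha' : E a = 0 := ha
    exact ⟨y, by simp [ha']⟩
  choose σ hσ using hex
  -- π(x) is the unique element of the image of E having the same image under E as x. Uniqueness
  -- makes it linear and multiplicative, whatever preimages σ selects.
  let π : H →ₐ[k] H := AlgHom.ofLinearMap
    { toFun := fun x => E (σ x)
      map_add' := fun x y => by
        rw [← map_add]
        exact huniq _ _ (by simp [hσ])
      map_smul' := fun c x => by
        rw [RingHom.id_apply, ← map_smul]
        exact huniq _ _ (by simp [hσ]) }
    (by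
      change E (σ 1) = 1
      rw [← map_one E]
      exact huniq _ _ (by simp [hσ]))
    (by
      intro x y
      change E (σ (x * y)) = E (σ x) * E (σ y)
      rw [← map_mul]
      exact huniq _ _ (by simp [hσ]))
  have hπE : ∀ x, π (E x) = E x := fun x => huniq _ _ (hσ _)
  have hD : ∀ x, D x = antipode k (antipode k x) := fun _ => rfl
  -- Each stage removes one factor S² on the right: the first S from anti-homomorphisms, the second
  -- from homomorphisms.
  have hπ : ∀ m, (∀ x, π ((D ^ m) x) = (D ^ m) x) → ∀ x, π x = x := by
    intro m
    induction m with
    | zero => exact fun h => h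
    | succ m ih =>
      refine fun h => ih fun x => ?_
      have h1 : (π.comp (D ^ m)).toLinearMap ∘ₗ antipode k = (D ^ m).toLinearMap ∘ₗ antipode k := by
        refine eq_of_comp_antipode_eq_of_anti _ _ (by simp [antipode_one]) (by simp [antipode_one])
          (by simp [antipode_mul_antidistrib]) (by simp [antipode_mul_antidistrib]) fun x => ?_
        have := h x
        simpa [pow_succ, AlgHom.mul_apply, hD] using this
      have h2 : (π.comp (D ^ m)).toLinearMap = (D ^ m).toLinearMap :=
        eq_of_comp_antipode_eq _ _ (by simp) (by simp) (by simp) (by simp)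
          fun x => LinearMap.congr_fun h1 x
      exact LinearMap.congr_fun h2 x
  have hid := hπ n hπE
  have hsurj : Function.Surjective E := fun x => ⟨σ x, hid x⟩
  have hS : Function.Surjective (antipode k : H →ₗ[k] H) := fun x => by
    obtain ⟨y, rfl⟩ := hsurj x
    obtain ⟨m, rfl⟩ := Nat.exists_eq_succ_of_ne_zero (Nat.one_le_iff_ne_zero.1 hn1)
    exact ⟨antipode k ((D ^ m) y), by simp [E, pow_succ', AlgHom.mul_apply, hD]⟩
  exact ⟨LinearMap.injective_iff_surjective.2 hS, hS⟩

/-- Both sides are convolution inverses of Δ in Hom(H, H ⊗ H): the right-hand side G is a left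
inverse, by cancelling the inner pair of legs and then the outer one, and Δ ∘ S is a right inverse
because Δ is an algebra map. -/
theorem comul_antipode (h : H) : Coalgebra.comul (R := k) (antipode k h) =
    comulSum k h fun a b => antipode k b ⊗ₜ[k] antipode k a := by
  let G : H →ₗ[k] H ⊗[k] H := TensorProduct.map (antipode k) (antipode k) ∘ₗ
    (TensorProduct.comm k H H).toLinearMap ∘ₗ Coalgebra.comul
  have hG : ∀ h, G h = comulSum k h fun a b => antipode k b ⊗ₜ[k] antipode k a := by
    intro h
    conv_lhs => simp only [G, LinearMap.comp_apply]; rw [← sweedler_self (Coalgebra.comul (R := k) h)]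
    simp [map_sweedler]
  have h1 : ∀ x : H, (comulSum k x fun a b => (antipode k a ⊗ₜ[k] (1 : H)) *
      Coalgebra.comul (R := k) b) = 1 ⊗ₜ[k] x := by
    intro x
    have h2 : ∀ a b : H, (antipode k a ⊗ₜ[k] (1 : H)) * Coalgebra.comul (R := k) b =
        comulSum k b fun c d => (antipode k a * c) ⊗ₜ[k] d := by
      intro a b
      conv_lhs => rw [← sweedler_self (Coalgebra.comul (R := k) b), mul_sweedler]
      simp
    simp only [h2]
    rw [← comulSum_coassoc (fun a b c => (antipode k a * b) ⊗ₜ[k] c) x]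
    simp only [← sweedler_tmul_right, comulSum_antipode_mul, Algebra.algebraMap_eq_smul_one, ← TensorProduct.smul_tmul']
    exact comulSum_counit_left (TensorProduct.mk k H H 1) x
  have h2 : WithConv.toConv G * WithConv.toConv (Coalgebra.comul (R := k) (A := H)) = 1 := by
    ext h
    have : ((WithConv.toConv G * WithConv.toConv (Coalgebra.comul (R := k) (A := H))).ofConv h) =
        comulSum k h fun a b => G a * Coalgebra.comul (R := k) b := by
      rw [LinearMap.convMul_apply]
      conv_lhs => rw [← sweedler_self (Coalgebra.comul (R := k) h)]
      simp [map_sweedler]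
    have h3 : ∀ a b : H, G a * Coalgebra.comul (R := k) b = comulSum k a fun u c =>
        (1 ⊗ₜ[k] antipode k u) * ((antipode k c ⊗ₜ[k] 1) * Coalgebra.comul (R := k) b) := by
      intro a b
      rw [hG, sweedler_mul_right]
      simp [← mul_assoc]
    rw [this]
    simp only [h3]
    rw [comulSum_coassoc (fun u c b => (1 ⊗ₜ[k] antipode k u) * ((antipode k c ⊗ₜ[k] 1) *
      Coalgebra.comul (R := k) b)) h]
    simp only [← mul_sweedler, h1, Algebra.TensorProduct.tmul_mul_tmul, one_mul, ← tmul_sweedler,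
      comulSum_antipode_mul]
    simp [Algebra.algebraMap_eq_smul_one, Algebra.TensorProduct.one_def]
  have h3 := left_inv_eq_right_inv h2 LinearMap.comul_right_inv
  rw [← hG]
  exact (LinearMap.congr_fun (WithConv.toConv_injective h3) h).symm

end AntipodeBijective

/-! ### Counit and product rules for coproduct sums with arbitrary linear summands. -/

section LinearSums

variable {k K P : Type*} [Field k] [Ring K] [Bialgebra k K] [Module.Finite k K]
  [AddCommGroup P] [Module k P]

theorem comulSum_counit_smul (G : K → P) (h : K) (hG : IsLinearMap k G := by
      refine ⟨fun _ _ => ?_, fun _ _ => ?_⟩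
      all_goals simp [sweedler, mul_add, add_mul, Finset.sum_add_distrib, Finset.smul_sum,
        TensorProduct.tmul_add, TensorProduct.add_tmul, ← TensorProduct.smul_tmul',
        TensorProduct.tmul_smul]) :
    (comulSum k h fun a b => Coalgebra.counit (R := k) a • G b) = G h :=
  comulSum_counit_left (hG.mk' G) h

theorem comulSum_smul_counit (G : K → P) (h : K) (hG : IsLinearMap k G := by
      refine ⟨fun _ _ => ?_, fun _ _ => ?_⟩
      all_goals simp [sweedler, mul_add, add_mul, Finset.sum_add_distrib, Finset.smul_sum,
        TensorProduct.tmul_add, TensorProduct.add_tmul, ← TensorProduct.smul_tmul',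
        TensorProduct.tmul_smul]) :
    (comulSum k h fun a b => Coalgebra.counit (R := k) b • G a) = G h :=
  comulSum_counit_right (hG.mk' G) h

theorem comulSum_mul (h g : K) (F : K → K → P) (hF : Bilin k F := by
      refine ⟨fun _ => ⟨fun _ _ => ?_, fun _ _ => ?_⟩, fun _ => ⟨fun _ _ => ?_, fun _ _ => ?_⟩⟩
      all_goals simp [sweedler, mul_add, add_mul, Finset.sum_add_distrib, Finset.smul_sum,
        TensorProduct.tmul_add, TensorProduct.add_tmul, ← TensorProduct.smul_tmul',
        TensorProduct.tmul_smul]) :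
    comulSum k (h * g) F =
      comulSum k h fun a b => comulSum k g fun c d => F (a * c) (b * d) := by
  rw [comulSum, Bialgebra.comul_mul, sweedler_mul _ _ hF]

end LinearSums

/-! ### Cancellation rules for a bijective antipode and its inverse. -/

namespace BijectiveAntipode

variable {k K P : Type*} [Field k] [Ring K] [Bialgebra k K] [Module.Finite k K]
  [AddCommGroup P] [Module k P] (S : BijectiveAntipode k K)

/-- The Hopf algebra structure given by the antipode `S`. -/
abbrev toHopfAlgebra : HopfAlgebra k K where
  antipode := S.S.toLinearMap
  mul_antipode_rTensor_comul := S.mul_antipode_rTensor_comul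
  mul_antipode_lTensor_comul := S.mul_antipode_lTensor_comul

theorem map_one : S.S 1 = 1 :=
  let _ := S.toHopfAlgebra
  HopfAlgebra.antipode_one (R := k) (A := K)

theorem map_mul (a b : K) : S.S (a * b) = S.S b * S.S a :=
  let _ := S.toHopfAlgebra
  HopfAlgebra.antipode_mul_antidistrib (R := k) a b

theorem symm_one : S.S.symm 1 = 1 := by rw [LinearEquiv.symm_apply_eq, S.map_one]

theorem symm_mul (a b : K) : S.S.symm (a * b) = S.S.symm b * S.S.symm a := by
  rw [LinearEquiv.symm_apply_eq, S.map_mul, LinearEquiv.apply_symm_apply,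
    LinearEquiv.apply_symm_apply]

theorem comulSum_apply (h : K) (F : K → K → P) (hF : Bilin k F := by
      refine ⟨fun _ => ⟨fun _ _ => ?_, fun _ _ => ?_⟩, fun _ => ⟨fun _ _ => ?_, fun _ _ => ?_⟩⟩
      all_goals simp [sweedler, mul_add, add_mul, Finset.sum_add_distrib, Finset.smul_sum,
        TensorProduct.tmul_add, TensorProduct.add_tmul, ← TensorProduct.smul_tmul',
        TensorProduct.tmul_smul]) :
    comulSum k (S.S h) F = comulSum k h fun a b => F (S.S b) (S.S a) := by
  obtain ⟨f, rfl⟩ := hF.exists_eq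
  have h1 : Coalgebra.comul (R := k) (S.S h) = comulSum k h fun a b => S.S b ⊗ₜ[k] S.S a :=
    let _ := S.toHopfAlgebra
    comul_antipode (k := k) h
  rw [comulSum, sweedler_bundled, h1, map_sweedler]
  rfl

theorem comulSum_apply_apply (h : K) (F : K → K → P) (hF : Bilin k F := by
      refine ⟨fun _ => ⟨fun _ _ => ?_, fun _ _ => ?_⟩, fun _ => ⟨fun _ _ => ?_, fun _ _ => ?_⟩⟩
      all_goals simp [sweedler, mul_add, add_mul, Finset.sum_add_distrib, Finset.smul_sum,
        TensorProduct.tmul_add, TensorProduct.add_tmul, ← TensorProduct.smul_tmul',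
        TensorProduct.tmul_smul]) :
    comulSum k (S.S (S.S h)) F = comulSum k h fun a b => F (S.S (S.S a)) (S.S (S.S b)) := by
  obtain ⟨f, rfl⟩ := hF.exists_eq
  rw [S.comulSum_apply _ (fun a b => f a b), S.comulSum_apply _ (fun a b => f (S.S b) (S.S a))]

variable (G : K → P) (h : K)

theorem comulSum_antipode_mul (hG : IsLinearMap k G := by
      refine ⟨fun _ _ => ?_, fun _ _ => ?_⟩
      all_goals simp [sweedler, mul_add, add_mul, Finset.sum_add_distrib, Finset.smul_sum,
        TensorProduct.tmul_add, TensorProduct.add_tmul, ← TensorProduct.smul_tmul',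
        TensorProduct.tmul_smul]) :
    (comulSum k h fun a b => G (S.S a * b)) = Coalgebra.counit (R := k) h • G 1 := by
  have h1 : (comulSum k h fun a b => S.S a * b) = algebraMap k K (Coalgebra.counit h) :=
    let _ := S.toHopfAlgebra
    _root_.comulSum_antipode_mul (k := k) h
  have := congrArg (hG.mk' G) h1
  rw [map_sweedler, Algebra.algebraMap_eq_smul_one, map_smul] at this
  exact this

theorem comulSum_mul_antipode (hG : IsLinearMap k G := by
      refine ⟨fun _ _ => ?_, fun _ _ => ?_⟩
      all_goals simp [sweedler, mul_add, add_mul, Finset.sum_add_distrib, Finset.smul_sum,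
        TensorProduct.tmul_add, TensorProduct.add_tmul, ← TensorProduct.smul_tmul',
        TensorProduct.tmul_smul]) :
    (comulSum k h fun a b => G (a * S.S b)) = Coalgebra.counit (R := k) h • G 1 := by
  have h1 : (comulSum k h fun a b => a * S.S b) = algebraMap k K (Coalgebra.counit h) :=
    let _ := S.toHopfAlgebra
    _root_.comulSum_mul_antipode (k := k) h
  have := congrArg (hG.mk' G) h1
  rw [map_sweedler, Algebra.algebraMap_eq_smul_one, map_smul] at this
  exact this

/-- Apply the anti-automorphism S⁻¹ to S(h₁) h₂ = ε(h): the order of the legs is reversed. The next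
lemma comes in the same way from h₁ S(h₂) = ε(h). -/
theorem comulSum_symm_mul (hG : IsLinearMap k G := by
      refine ⟨fun _ _ => ?_, fun _ _ => ?_⟩
      all_goals simp [sweedler, mul_add, add_mul, Finset.sum_add_distrib, Finset.smul_sum,
        TensorProduct.tmul_add, TensorProduct.add_tmul, ← TensorProduct.smul_tmul',
        TensorProduct.tmul_smul]) :
    (comulSum k h fun a b => G (S.S.symm b * a)) = Coalgebra.counit (R := k) h • G 1 := by
  have := S.comulSum_antipode_mul (hG.mk' G ∘ S.S.symm) h
    (((hG.mk' G) ∘ₗ S.S.symm.toLinearMap).isLinear)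
  simpa [symm_mul, symm_one] using this

theorem comulSum_mul_symm (hG : IsLinearMap k G := by
      refine ⟨fun _ _ => ?_, fun _ _ => ?_⟩
      all_goals simp [sweedler, mul_add, add_mul, Finset.sum_add_distrib, Finset.smul_sum,
        TensorProduct.tmul_add, TensorProduct.add_tmul, ← TensorProduct.smul_tmul',
        TensorProduct.tmul_smul]) :
    (comulSum k h fun a b => G (b * S.S.symm a)) = Coalgebra.counit (R := k) h • G 1 := by
  have := S.comulSum_mul_antipode (hG.mk' G ∘ S.S.symm) h
    (((hG.mk' G) ∘ₗ S.S.symm.toLinearMap).isLinear)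
  simpa [symm_mul, symm_one] using this

end BijectiveAntipode

/-! ## Braided commutative Yetter–Drinfel'd module algebras -/

section YetterDrinfeld

variable {k K V P : Type*} [Field k] [Ring K] [Bialgebra k K] [Module.Finite k K]
  [Ring V] [Algebra k V] [AddCommGroup P] [Module k P]

/-- `V` is a braided commutative Yetter–Drinfel'd module algebra: an algebra in the category of
Yetter–Drinfel'd modules, with respect to the action `act` and the coaction `δ`, such that
`u₀ (u₁ · v) = v u`. -/
structure IsBraidedYetterDrinfeld (act : K →ₐ[k] Module.End k V) (δ : V →ₗ[k] V ⊗[k] K) : Prop where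
  act_one : ∀ h, act h 1 = algebraMap k V (Coalgebra.counit h)
  act_mul : ∀ h u v, act h (u * v) = comulSum k h fun a b => act a u * act b v
  coassoc : ∀ v, TensorProduct.assoc k V K K (δ.rTensor K (δ v)) = Coalgebra.comul.lTensor V (δ v)
  counit : ∀ v, Coalgebra.counit.lTensor V (δ v) = v ⊗ₜ[k] (1 : k)
  coact_one : δ 1 = 1 ⊗ₜ 1
  coact_mul : ∀ u v, δ (u * v) =
    sweedler (δ u) fun u₀ u₁ => sweedler (δ v) fun v₀ v₁ => (u₀ * v₀) ⊗ₜ[k] (v₁ * u₁)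
  coact_act : ∀ h v, (comulSum k h fun a b => sweedler (δ (act b v)) fun w c => w ⊗ₜ[k] (c * a)) =
    comulSum k h fun a b => sweedler (δ v) fun w c => act a w ⊗ₜ[k] (b * c)
  braided : ∀ u v, (sweedler (δ u) fun w c => w * act c v) = v * u

namespace IsBraidedYetterDrinfeld

variable {act : K →ₐ[k] Module.End k V} {δ : V →ₗ[k] V ⊗[k] K}
  (Y : IsBraidedYetterDrinfeld act δ) (S : BijectiveAntipode k K)

include Y in
theorem coact_coassoc (F : V → K → K → P) (v : V) (hF : Trilin k F := by
      refine ⟨fun _ _ => ⟨fun _ _ => ?_, fun _ _ => ?_⟩, fun _ _ => ⟨fun _ _ => ?_, fun _ _ => ?_⟩,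
        fun _ _ => ⟨fun _ _ => ?_, fun _ _ => ?_⟩⟩
      all_goals simp [sweedler, mul_add, add_mul, Finset.sum_add_distrib, Finset.smul_sum,
        TensorProduct.tmul_add, TensorProduct.add_tmul, ← TensorProduct.smul_tmul',
        TensorProduct.tmul_smul]) :
    (sweedler (δ v) fun w c => sweedler (δ w) fun u a => F u a c) =
      sweedler (δ v) fun u c => comulSum k c fun a b => F u a b :=
  sweedler_coassoc δ Y.coassoc F v hF

include Y in
theorem coact_counit (f : V →ₗ[k] P) (v : V) :
    (sweedler (δ v) fun w c => Coalgebra.counit (R := k) c • f w) = f v := by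
  have H := congrArg (f ∘ₗ TensorProduct.rid k V) (Y.counit v)
  conv_lhs at H => rw [← sweedler_self (δ v)]
  simpa [map_sweedler] using H

include Y in
theorem coact_act_apply (F : V → K → P) (h : K) (v : V) (hF : Bilin k F := by
      refine ⟨fun _ => ⟨fun _ _ => ?_, fun _ _ => ?_⟩, fun _ => ⟨fun _ _ => ?_, fun _ _ => ?_⟩⟩
      all_goals simp [sweedler, mul_add, add_mul, Finset.sum_add_distrib, Finset.smul_sum,
        TensorProduct.tmul_add, TensorProduct.add_tmul, ← TensorProduct.smul_tmul',
        TensorProduct.tmul_smul]) :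
    (comulSum k h fun a b => sweedler (δ (act b v)) fun w c => F w (c * a)) =
      comulSum k h fun a b => sweedler (δ v) fun w c => F (act a w) (b * c) := by
  obtain ⟨f, rfl⟩ := hF.exists_eq
  have := congrArg (TensorProduct.lift f) (Y.coact_act h v)
  simpa [map_sweedler] using this

-- The usual solved form δ(h · v) = h₂ · v₀ ⊗ h₃ v₁ S⁻¹(h₁) of the Yetter–Drinfel'd condition.
-- Multiplying the unsolved form by S⁻¹ of one further leg isolates δ(h · v), since h₂ S⁻¹(h₁) =
-- ε(h).
include Y in
theorem coact_act_eq (F : V → K → P) (h : K) (v : V) (hF : Bilin k F := by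
      refine ⟨fun _ => ⟨fun _ _ => ?_, fun _ _ => ?_⟩, fun _ => ⟨fun _ _ => ?_, fun _ _ => ?_⟩⟩
      all_goals simp [sweedler, mul_add, add_mul, Finset.sum_add_distrib, Finset.smul_sum,
        TensorProduct.tmul_add, TensorProduct.add_tmul, ← TensorProduct.smul_tmul',
        TensorProduct.tmul_smul]) :
    sweedler (δ (act h v)) F = comulSum k h fun a b => comulSum k b fun c d =>
      sweedler (δ v) fun w e => F (act c w) (d * e * S.S.symm a) := by
  obtain ⟨f, rfl⟩ := hF.exists_eq
  have h1 : ∀ a b : K, (comulSum k b fun c d => sweedler (δ v) fun w e =>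
      f (act c w) (d * e * S.S.symm a)) =
      comulSum k b fun c d => sweedler (δ (act d v)) fun w e => f w (e * (c * S.S.symm a)) := by
    intro a b
    rw [← Y.coact_act_apply (fun w e => f w (e * S.S.symm a)) b v]
    simp [mul_assoc]
  simp only [h1]
  rw [← comulSum_coassoc
    (fun a c d => sweedler (δ (act d v)) fun w e => f w (e * (c * S.S.symm a))) h]
  have h2 : ∀ x d : K, (comulSum k x fun a c => sweedler (δ (act d v)) fun w e =>
      f w (e * (c * S.S.symm a))) =
      Coalgebra.counit (R := k) x • sweedler (δ (act d v)) fun w e => f w e := by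
    intro x d
    have := S.comulSum_mul_symm (fun z => sweedler (δ (act d v)) fun w e => f w (e * z)) x
    simpa using this
  simp only [h2]
  exact (comulSum_counit_smul (fun d => sweedler (δ (act d v)) fun w e => f w e) h).symm

variable (act δ) in
/-- The map `v ↦ S²(v₁) · v₀`. -/
def theta : V →ₗ[k] V := TensorProduct.lift
  (act.toLinearMap ∘ₗ S.S.toLinearMap ∘ₗ S.S.toLinearMap).flip ∘ₗ δ

variable (act δ) in
theorem theta_apply (v : V) : theta act δ S v = sweedler (δ v) fun w c => act (S.S (S.S c)) w := by
  rw [theta, LinearMap.comp_apply, ← sweedler_bundled]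
  rfl

-- Insert the solved form of δ(h · v). As S² S⁻¹ = S, the element acting on v₀ is S²(h₃) S²(v₁)
-- S(h₁) h₂, where S(h₁) h₂ collapses.
include Y in
theorem theta_act (h : K) (v : V) :
    theta act δ S (act h v) = act (S.S (S.S h)) (theta act δ S v) := by
  rw [theta_apply, theta_apply, Y.coact_act_eq S (fun w c => act (S.S (S.S c)) w)]
  have h1 : ∀ a c d : K, (sweedler (δ v) fun w e => act (S.S (S.S (d * e * S.S.symm a))) (act c w)) =
      sweedler (δ v) fun w e => act (S.S (S.S d) * S.S (S.S e) * (S.S a * c)) w := by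
    intro a c d
    congr 1; funext w e
    rw [← Module.End.mul_apply, ← map_mul]
    simp [S.map_mul, mul_assoc]
  simp only [h1]
  rw [← comulSum_coassoc
    (fun a c d => sweedler (δ v) fun w e => act (S.S (S.S d) * S.S (S.S e) * (S.S a * c)) w) h]
  have h2 : ∀ x d : K, (comulSum k x fun a c =>
      sweedler (δ v) fun w e => act (S.S (S.S d) * S.S (S.S e) * (S.S a * c)) w) =
      Coalgebra.counit (R := k) x •
        sweedler (δ v) fun w e => act (S.S (S.S d) * S.S (S.S e)) w := by
    intro x d
    have := S.comulSum_antipode_mul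
      (fun z => sweedler (δ v) fun w e => act (S.S (S.S d) * S.S (S.S e) * z) w) x
    simpa using this
  simp only [h2]
  rw [comulSum_counit_smul (fun d => sweedler (δ v) fun w e => act (S.S (S.S d) * S.S (S.S e)) w) h,
    map_sweedler]
  simp

-- In δ(S²(v₁) · v₀) the second leg acquires the factors v₁ S(v₂), again because S⁻¹ S² = S. They
-- cancel after the coaction is rebracketed, leaving S² of the last leg.
include Y in
theorem coact_theta (F : V → K → P) (v : V) (hF : Bilin k F := by
      refine ⟨fun _ => ⟨fun _ _ => ?_, fun _ _ => ?_⟩, fun _ => ⟨fun _ _ => ?_, fun _ _ => ?_⟩⟩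
      all_goals simp [sweedler, mul_add, add_mul, Finset.sum_add_distrib, Finset.smul_sum,
        TensorProduct.tmul_add, TensorProduct.add_tmul, ← TensorProduct.smul_tmul',
        TensorProduct.tmul_smul]) :
    sweedler (δ (theta act δ S v)) F =
      sweedler (δ v) fun w c => F (theta act δ S w) (S.S (S.S c)) := by
  obtain ⟨f, rfl⟩ := hF.exists_eq
  have h1 : ∀ (w : V) (c : K), (sweedler (δ (act (S.S (S.S c)) w)) fun u a => f u a) =
      sweedler (δ w) fun u e => comulSum k c fun a b => comulSum k b fun c d =>
        f (act (S.S (S.S c)) u) (S.S (S.S d) * (e * S.S a)) := by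
    intro w c
    rw [Y.coact_act_eq S (fun u a => f u a), S.comulSum_apply_apply _ (fun a b => comulSum k b
      fun c d => sweedler (δ w) fun u e => f (act c u) (d * e * S.S.symm a)), sweedler_comm]
    congr 1; funext a b
    rw [S.comulSum_apply_apply _ (fun c d => sweedler (δ w) fun u e =>
      f (act c u) (d * e * S.S.symm (S.S (S.S a)))), sweedler_comm]
    simp [mul_assoc]
  have h2 : (sweedler (δ (theta act δ S v)) fun u a => f u a) =
      sweedler (δ v) fun w c => sweedler (δ (act (S.S (S.S c)) w)) fun u a => f u a := by
    rw [theta_apply]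
    simp only [sweedler_bundled, map_sweedler]
  rw [h2]
  simp only [h1]
  rw [Y.coact_coassoc (fun u e c => comulSum k c fun a b => comulSum k b fun c d =>
        f (act (S.S (S.S c)) u) (S.S (S.S d) * (e * S.S a))) v]
  have h3 : ∀ (u : V) (x : K), (comulSum k x fun e c => comulSum k c fun a b =>
      comulSum k b fun c d => f (act (S.S (S.S c)) u) (S.S (S.S d) * (e * S.S a))) =
      comulSum k x fun c d => f (act (S.S (S.S c)) u) (S.S (S.S d)) := by
    intro u x
    rw [← comulSum_coassoc (fun e a b =>
      comulSum k b fun c d => f (act (S.S (S.S c)) u) (S.S (S.S d) * (e * S.S a))) x]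
    have h4 : ∀ y b : K, (comulSum k y fun e a =>
      comulSum k b fun c d => f (act (S.S (S.S c)) u) (S.S (S.S d) * (e * S.S a))) =
        Coalgebra.counit (R := k) y •
          comulSum k b fun c d => f (act (S.S (S.S c)) u) (S.S (S.S d)) := by
      intro y b
      have := S.comulSum_mul_antipode (fun z =>
        comulSum k b fun c d => f (act (S.S (S.S c)) u) (S.S (S.S d) * z)) y
      simpa using this
    simp only [h4]
    exact comulSum_counit_smul
      (fun b => comulSum k b fun c d => f (act (S.S (S.S c)) u) (S.S (S.S d))) x
  simp only [h3]
  rw [← Y.coact_coassoc (fun u c d => f (act (S.S (S.S c)) u) (S.S (S.S d))) v]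
  congr 1; funext w c
  rw [theta_apply, map_sweedler]
  simp [sweedler]

-- The braided commutation rule u₀ (u₁ · v) = v u read backwards, by means of the inverse braiding:
-- replacing v by S(u₂) · v makes u₁ S(u₂) cancel.
include Y in
theorem mul_eq (u v : V) : u * v = sweedler (δ u) fun w c => act (S.S c) v * w := by
  have h1 : ∀ (w : V) (c : K), act (S.S c) v * w =
      sweedler (δ w) fun x a => x * act (a * S.S c) v := by
    intro w c
    rw [← Y.braided]
    simp
  simp only [h1]
  rw [Y.coact_coassoc (fun x a c => x * act (a * S.S c) v) u]
  have h2 : ∀ (x : V) (y : K), (comulSum k y fun a c => x * act (a * S.S c) v) =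
      Coalgebra.counit (R := k) y • (x * v) := by
    intro x y
    have := S.comulSum_mul_antipode (fun z => x * act z v) y
    simpa using this
  simp only [h2]
  exact (Y.coact_counit (LinearMap.mulRight k v) u).symm

-- Rewrite v₀ x by `mul_eq` and distribute S² over the product. The factor x is then acted on by
-- S²(v₂) S(v₁) = S(v₁ S(v₂)), which is trivial, and S² of the remaining leg acts on v₀ to give
-- θ(v).
include Y in
theorem mul_theta (v x : V) :
    (sweedler (δ v) fun w c => act (S.S (S.S c)) (w * x)) = x * theta act δ S v := by
  have h1 : ∀ (w : V) (c : K), act (S.S (S.S c)) (w * x) = sweedler (δ w) fun u a =>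
      comulSum k c fun b d => act (S.S (S.S b) * S.S a) x * act (S.S (S.S d)) u := by
    intro w c
    rw [Y.mul_eq S w x, map_sweedler]
    congr 1; funext u a
    rw [Y.act_mul, S.comulSum_apply_apply _ (fun b d => act b (act (S.S a) x) * act d u)]
    simp
  simp only [h1]
  rw [Y.coact_coassoc (fun u a c => comulSum k c fun b d =>
    act (S.S (S.S b) * S.S a) x * act (S.S (S.S d)) u) v, theta_apply, mul_sweedler]
  congr 1; funext u z
  rw [← comulSum_coassoc (fun a b d => act (S.S (S.S b) * S.S a) x * act (S.S (S.S d)) u) z]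
  have h2 : ∀ y d : K, (comulSum k y fun a b =>
      act (S.S (S.S b) * S.S a) x * act (S.S (S.S d)) u) =
      Coalgebra.counit (R := k) y • (x * act (S.S (S.S d)) u) := by
    intro y d
    have := S.comulSum_mul_antipode (fun z => act (S.S z) x * act (S.S (S.S d)) u) y
    simpa [S.map_mul, S.map_one] using this
  simp only [h2]
  exact comulSum_counit_smul (fun d => x * act (S.S (S.S d)) u) z

-- As δ(v w) = v₀ w₀ ⊗ w₁ v₁, the inner action by S²(v₁) is handled by `mul_theta`, leaving S²(w₁) ·
-- (w₀ θ(v)). Distributing S²(w₁) produces θ(w)₀ (θ(w)₁ · θ(v)) by `coact_theta`, and braided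
-- commutativity reverses this to θ(v) θ(w).
include Y in
theorem theta_mul (v w : V) :
    theta act δ S (v * w) = theta act δ S v * theta act δ S w := by
  have h1 : theta act δ S (v * w) = sweedler (δ w) fun w₀ w₁ =>
      act (S.S (S.S w₁)) (w₀ * theta act δ S v) := by
    change TensorProduct.lift _ (δ (v * w)) = _
    rw [Y.coact_mul, map_sweedler]
    simp only [map_sweedler]
    rw [sweedler_comm]
    congr 1; funext w₀ w₁
    rw [← Y.mul_theta, map_sweedler]
    simp [S.map_mul]
  rw [h1]
  simp only [Y.act_mul]
  have h2 : ∀ (w₀ : V) (w₁ : K), (comulSum k (S.S (S.S w₁)) fun a b =>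
      act a w₀ * act b (theta act δ S v)) = comulSum k w₁ fun a b =>
      act (S.S (S.S a)) w₀ * act (S.S (S.S b)) (theta act δ S v) := by
    intro w₀ w₁
    rw [S.comulSum_apply_apply _ (fun a b => act a w₀ * act b (theta act δ S v))]
  simp only [h2]
  rw [← Y.coact_coassoc (fun w₀ a b =>
    act (S.S (S.S a)) w₀ * act (S.S (S.S b)) (theta act δ S v)) w,
    ← Y.braided, Y.coact_theta S (fun x b => x * act b (theta act δ S v))]
  congr 1; funext x b
  rw [theta_apply _ _ _ x, sweedler_mul_right]

end IsBraidedYetterDrinfeld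

end YetterDrinfeld

/-! ## The smash product -/

namespace DoubleModuleAlgebra

variable {k K V P : Type*} [Field k] [Ring K] [Bialgebra k K] [Module.Finite k K]
  [Ring V] [Algebra k V] [AddCommGroup P] [Module k P] {S : BijectiveAntipode k K}
  (M : DoubleModuleAlgebra S V)

@[simp] theorem smk_add_left (v w : V) (h : K) : M.smk (v + w) h = M.smk v h + M.smk w h := by
  simp [smk, TensorProduct.add_tmul]

@[simp] theorem smk_add_right (v : V) (h g : K) : M.smk v (h + g) = M.smk v h + M.smk v g := by
  simp [smk, TensorProduct.tmul_add]

@[simp] theorem smk_smul_left (c : k) (v : V) (h : K) : M.smk (c • v) h = c • M.smk v h := by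
  simp [smk, ← TensorProduct.smul_tmul']

@[simp] theorem smk_smul_right (c : k) (v : V) (h : K) : M.smk v (c • h) = c • M.smk v h := by
  simp [smk]

theorem smk_induction {p : M.Smash → Prop} (zero : p 0) (add : ∀ x y, p x → p y → p (x + y))
    (smk : ∀ v h, p (M.smk v h)) (x : M.Smash) : p x :=
  TensorProduct.induction_on
    (motive := fun y : V ⊗[k] K => p ((ModuleAlgebra.Smash.equiv M.toModuleAlgebra).symm y)) x
    zero smk (fun _ _ hx hy => add _ _ hx hy)

/-- The coaction `v ↦ ∑ᵢ (pᵢ · v) ⊗ hᵢ`. -/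
def coaction : V →ₗ[k] V ⊗[k] K :=
  (ModuleAlgebra.Smash.equiv M.toModuleAlgebra).toLinearMap ∘ₗ M.target

theorem source_eq (v : V) : M.source v = M.smk v 1 := rfl

theorem target_eq (v : V) : M.target v = sweedler (M.coaction v) fun w c => M.smk w c := by
  have := congrArg (ModuleAlgebra.Smash.equiv M.toModuleAlgebra).symm
    (sweedler_self (M.coaction v))
  rw [map_sweedler] at this
  exact this.symm

theorem smk_mul_smk (v w : V) (h g : K) : M.smk v h * M.smk w g =
    comulSum k h fun a b => M.smk (v * M.toModuleAlgebra.act a w) (b * g) := by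
  have h1 := M.toModuleAlgebra.smashMul_tmul_tmul v w h g
  rw [← sweedler_self (Coalgebra.comul (R := k) h), map_sweedler] at h1
  have := congrArg (ModuleAlgebra.Smash.equiv M.toModuleAlgebra).symm h1
  rw [map_sweedler] at this
  exact this

theorem one_eq : (1 : M.Smash) = M.smk 1 1 := rfl

theorem source_one : M.source 1 = 1 := rfl

theorem smk_one_mul_smk_one (v : V) (g h : K) : M.smk v h * M.smk 1 g = M.smk v (h * g) := by
  rw [smk_mul_smk]
  have h1 : ∀ a b : K, M.smk (v * M.toModuleAlgebra.act a 1) (b * g) =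
      Coalgebra.counit (R := k) a • M.smk v (b * g) := by
    intro a b
    rw [M.toModuleAlgebra.act_one_right, Algebra.algebraMap_eq_smul_one]
    simp
  simp only [h1]
  exact comulSum_counit_smul (fun b => M.smk v (b * g)) h

theorem source_mul_smk (v w : V) (g : K) : M.source v * M.smk w g = M.smk (v * w) g := by
  rw [source_eq, smk_mul_smk, comulSum, Bialgebra.comul_one, Algebra.TensorProduct.one_def]
  rw [sweedler_tmul]
  · simp
  · refine ⟨fun _ => ⟨fun _ _ => ?_, fun _ _ => ?_⟩, fun _ => ⟨fun _ _ => ?_, fun _ _ => ?_⟩⟩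
    all_goals simp [mul_add, add_mul]

theorem source_mul_smk_one (v : V) (g : K) : M.source v * M.smk 1 g = M.smk v g := by
  rw [source_mul_smk, mul_one]

theorem source_mul (v w : V) : M.source (v * w) = M.source v * M.source w := by
  rw [source_eq M w, source_mul_smk]
  rfl

theorem smk_mul_source (h : K) (w : V) : M.smk 1 h * M.source w =
    comulSum k h fun a b => M.smk (M.toModuleAlgebra.act a w) b := by
  rw [source_eq, smk_mul_smk]
  simp

section

variable (hY : IsBraidedYetterDrinfeld M.toModuleAlgebra.act M.coaction)

include hY

/-- Braided commutativity turns r₀ (r₁ · v) into v r₀ after the coaction is rebracketed. Left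
multiplication by a target thus multiplies V on the right, which is why targets commute with sources
and reverse products. -/
theorem target_mul_smk (r v : V) (h : K) : M.target r * M.smk v h =
    sweedler (M.coaction r) fun w c => M.smk (v * w) (c * h) := by
  rw [target_eq, sweedler_mul_right]
  simp only [smk_mul_smk]
  rw [← hY.coact_coassoc (fun w a b => M.smk (w * M.toModuleAlgebra.act a v) (b * h)) r]
  congr 1; funext w c
  rw [← hY.braided w v]
  simp [sweedler, smk, TensorProduct.sum_tmul]

theorem target_one : M.target 1 = 1 := by
  rw [target_eq, hY.coact_one, sweedler_tmul]
  · rfl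
  · refine ⟨fun _ => ⟨fun _ _ => ?_, fun _ _ => ?_⟩, fun _ => ⟨fun _ _ => ?_, fun _ _ => ?_⟩⟩
    all_goals simp

theorem source_target_comm (r v : V) : M.source r * M.target v = M.target v * M.source r := by
  rw [source_eq M r, target_mul_smk M hY, ← source_eq, target_eq, mul_sweedler]
  simp [source_mul_smk]

theorem target_mul (u v : V) : M.target (u * v) = M.target v * M.target u := by
  conv_rhs => rw [target_eq M u, mul_sweedler]
  simp only [target_mul_smk M hY]
  conv_lhs =>
    change (ModuleAlgebra.Smash.equiv M.toModuleAlgebra).symm (M.coaction (u * v))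
    rw [hY.coact_mul]
  simp only [map_sweedler]
  rfl

/-- Expanded in V ⊗ K, this is the Yetter–Drinfel'd condition itself. -/
theorem smk_mul_target (h : K) (v : V) : M.smk 1 h * M.target v =
    comulSum k h fun a b => M.target (M.toModuleAlgebra.act b v) * M.smk 1 a := by
  simp only [target_mul_smk M hY, one_mul]
  rw [hY.coact_act_apply (fun w c => M.smk w c), target_eq, mul_sweedler]
  simp only [smk_mul_smk, one_mul]
  rw [sweedler_comm]

/-- The inverse of `smk_mul_target`, obtained by inserting h₂ S(h₃) in front of w. -/
theorem target_mul_smk_one (h : K) (w : V) : M.target w * M.smk 1 h =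
    comulSum k h fun a b => M.smk 1 a * M.target (M.toModuleAlgebra.act (S.S b) w) := by
  have h1 : ∀ a b : K, M.smk 1 a * M.target (M.toModuleAlgebra.act (S.S b) w) =
      comulSum k a fun c d => M.target (M.toModuleAlgebra.act (d * S.S b) w) * M.smk 1 c := by
    intro a b
    rw [smk_mul_target M hY]
    simp
  simp only [h1]
  rw [comulSum_coassoc
    (fun c d b => M.target (M.toModuleAlgebra.act (d * S.S b) w) * M.smk 1 c) h]
  have h2 : ∀ c x : K, (comulSum k x fun d b =>
      M.target (M.toModuleAlgebra.act (d * S.S b) w) * M.smk 1 c) =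
      Coalgebra.counit (R := k) x • (M.target w * M.smk 1 c) := by
    intro c x
    have := S.comulSum_mul_antipode (fun z => M.target (M.toModuleAlgebra.act z w) * M.smk 1 c) x
    simpa using this
  simp only [h2]
  exact (comulSum_smul_counit (fun c => M.target w * M.smk 1 c) h).symm

end

end DoubleModuleAlgebra

/-! ### Well-definedness of maps on L ⊗_R L. -/

namespace LeftBialgebroidData

variable {k R L P : Type*} [CommRing k] [Ring R] [Algebra k R] [Ring L] [Algebra k L]
  [AddCommGroup P] [Module k P] (D : LeftBialgebroidData k R L)

theorem proj_target_mul (r : R) (a b : L) :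
    D.proj ((D.target r * a) ⊗ₜ[k] b) = D.proj (a ⊗ₜ[k] (D.source r * b)) := by
  rw [← sub_eq_zero, ← map_sub]
  exact (Submodule.Quotient.mk_eq_zero _).2 (Submodule.subset_span ⟨r, a, b, rfl⟩)

/-- The bialgebroid axioms range over all representatives of Δ(a). For a balanced f, this permits
replacing an arbitrary representative by a standard one on which the computation is explicit. -/
theorem eq_of_proj_eq (f : L ⊗[k] L →ₗ[k] P)
    (hf : ∀ r a b, f ((D.target r * a) ⊗ₜ[k] b) = f (a ⊗ₜ[k] (D.source r * b)))
    {x y : L ⊗[k] L} (h : D.proj x = D.proj y) : f x = f y := by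
  have hle : bimoduleRelations D.source D.target ≤ LinearMap.ker f := by
    refine Submodule.span_le.2 ?_
    rintro _ ⟨r, a, b, rfl⟩
    simp [hf]
  exact congrArg ((bimoduleRelations D.source D.target).liftQ f hle) h

theorem proj_surjective : Function.Surjective D.proj := Submodule.Quotient.mk_surjective _

/-- The relations multiply by t(r) and s(r) on the left, so their span is stable under right
multiplication. Left multiplication requires the Takeuchi condition or commuting images. -/
theorem proj_mul_of_proj_eq {x y : L ⊗[k] L} (h : D.proj x = D.proj y) (z : L ⊗[k] L) :
    D.proj (x * z) = D.proj (y * z) := by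
  refine D.eq_of_proj_eq (D.proj ∘ₗ LinearMap.mulRight k z) (fun r a b => ?_) h
  induction z with
  | zero => simp
  | add z w hz hw =>
    simp only [LinearMap.comp_apply, LinearMap.mulRight_apply, mul_add, map_add] at hz hw ⊢
    rw [hz, hw]
  | tmul c d => simp [mul_assoc, proj_target_mul]

theorem joinRight_proj (x : L ⊗[k] L) (c : L) :
    BimoduleTensor.joinRight D.source D.target (D.proj x) c =
      (bimoduleRelations₃ D.source D.target).mkQ (TensorProduct.assoc k L L L (x ⊗ₜ c)) := rfl

theorem joinLeft_proj (x : L ⊗[k] L) (c : L) :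
    BimoduleTensor.joinLeft D.source D.target (D.proj x) c =
      (bimoduleRelations₃ D.source D.target).mkQ (c ⊗ₜ x) := rfl

theorem comulLeft_tmul (a b : L) : D.comulLeft (a ⊗ₜ b) =
    BimoduleTensor.joinRight D.source D.target (D.comul a) b := rfl

theorem comulRight_tmul (a b : L) : D.comulRight (a ⊗ₜ b) =
    BimoduleTensor.joinLeft D.source D.target (D.comul b) a := rfl

/-- Left linearity of Δ over the target moves t(r) to the second leg of Δ(a), where the second
family of relations in L ⊗_R L ⊗_R L passes it on to b as s(r). `comulRight_balanced` is the mirror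
image. -/
theorem comulLeft_balanced
    (h : ∀ (r : R) (a : L) (x : L ⊗[k] L), D.proj x = D.comul a →
      D.comul (D.target r * a) = D.proj ((1 ⊗ₜ[k] D.target r) * x)) (r : R) (a b : L) :
    D.comulLeft ((D.target r * a) ⊗ₜ b) = D.comulLeft (a ⊗ₜ (D.source r * b)) := by
  obtain ⟨x, hx⟩ := D.proj_surjective (D.comul a)
  rw [comulLeft_tmul, comulLeft_tmul, h r a x hx, ← hx, joinRight_proj, joinRight_proj]
  clear hx
  induction x with
  | zero => simp
  | add x y ihx ihy => simp only [mul_add, TensorProduct.add_tmul, map_add, ihx, ihy]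
  | tmul c d =>
    rw [← sub_eq_zero, ← map_sub]
    refine (Submodule.Quotient.mk_eq_zero _).2
      (Submodule.subset_span (Or.inr ⟨r, c, d, b, by simp⟩))

theorem comulRight_balanced
    (h : ∀ (r : R) (a : L) (x : L ⊗[k] L), D.proj x = D.comul a →
      D.comul (D.source r * a) = D.proj ((D.source r ⊗ₜ[k] 1) * x)) (r : R) (a b : L) :
    D.comulRight ((D.target r * a) ⊗ₜ b) = D.comulRight (a ⊗ₜ (D.source r * b)) := by
  obtain ⟨x, hx⟩ := D.proj_surjective (D.comul b)
  rw [comulRight_tmul, comulRight_tmul, h r b x hx, ← hx, joinLeft_proj, joinLeft_proj]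
  clear hx
  induction x with
  | zero => simp
  | add x y ihx ihy => simp only [mul_add, TensorProduct.tmul_add, map_add, ihx, ihy]
  | tmul c d =>
    rw [← sub_eq_zero, ← map_sub]
    refine (Submodule.Quotient.mk_eq_zero _).2
      (Submodule.subset_span (Or.inl ⟨r, a, c, d, by simp⟩))

end LeftBialgebroidData

/-! ### The left bialgebroid axioms for the smash product. -/

namespace DoubleModuleAlgebra

variable {k K V P : Type*} [Field k] [Ring K] [Bialgebra k K] [Module.Finite k K]
  [Ring V] [Algebra k V] [AddCommGroup P] [Module k P] {S : BijectiveAntipode k K}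
  (M : DoubleModuleAlgebra S V)

/-- The map `v ⋊ h ↦ (v ⋊ h₁) ⊗ (1 ⋊ h₂)`. -/
def comulRep : M.Smash →ₗ[k] M.Smash ⊗[k] M.Smash :=
  TensorProduct.map (ModuleAlgebra.Smash.equiv M.toModuleAlgebra).symm.toLinearMap
      ((ModuleAlgebra.Smash.equiv M.toModuleAlgebra).symm.toLinearMap ∘ₗ
        TensorProduct.mk k V K 1) ∘ₗ
    (TensorProduct.assoc k V K K).symm.toLinearMap ∘ₗ
    Coalgebra.comul.lTensor V ∘ₗ (ModuleAlgebra.Smash.equiv M.toModuleAlgebra).toLinearMap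

theorem comulRep_smk (v : V) (h : K) : M.comulRep (M.smk v h) =
    comulSum k h fun a b => M.smk v a ⊗ₜ[k] M.smk 1 b := by
  simp only [comulRep, smk, LinearMap.comp_apply, LinearEquiv.coe_coe,
    LinearEquiv.apply_symm_apply, LinearMap.lTensor_tmul]
  conv_lhs => rw [← sweedler_self (Coalgebra.comul (R := k) h)]
  simp [map_sweedler, tmul_sweedler]

theorem proj_target_mul (r : V) (a b : M.Smash) :
    M.smashBialgebroid.proj ((M.target r * a) ⊗ₜ[k] b) =
      M.smashBialgebroid.proj (a ⊗ₜ[k] (M.source r * b)) :=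
  M.smashBialgebroid.proj_target_mul r a b

theorem eq_of_proj_eq (f : M.Smash ⊗[k] M.Smash →ₗ[k] P)
    (hf : ∀ r a b, f ((M.target r * a) ⊗ₜ[k] b) = f (a ⊗ₜ[k] (M.source r * b)))
    {x y : M.Smash ⊗[k] M.Smash} (h : M.smashBialgebroid.proj x = M.smashBialgebroid.proj y) :
    f x = f y :=
  M.smashBialgebroid.eq_of_proj_eq f hf h

theorem comul_eq (a : M.Smash) :
    M.smashBialgebroid.comul a = M.smashBialgebroid.proj (M.comulRep a) := rfl

theorem counit_smk (v : V) (h : K) :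
    M.smashBialgebroid.counit (M.smk v h) = Coalgebra.counit (R := k) h • v := by
  simp [smashBialgebroid, smk]

theorem counit_smk_mul_smk (v w : V) (h g : K) :
    M.smashBialgebroid.counit (M.smk v h * M.smk w g) =
      Coalgebra.counit (R := k) g • (v * M.toModuleAlgebra.act h w) := by
  rw [smk_mul_smk, map_sweedler]
  simp only [counit_smk, Bialgebra.counit_mul, mul_smul]
  exact comulSum_smul_counit (k := k)
    (fun a => Coalgebra.counit (R := k) g • (v * M.toModuleAlgebra.act a w)) h
    ⟨fun _ _ => by simp [mul_add], fun c _ => by simp [smul_comm _ c]⟩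

theorem comul_one : M.comulRep 1 = 1 ⊗ₜ[k] 1 := by
  rw [one_eq, comulRep_smk, comulSum, Bialgebra.comul_one, Algebra.TensorProduct.one_def,
    sweedler_tmul]
  refine ⟨fun _ => ⟨fun _ _ => ?_, fun _ _ => ?_⟩, fun _ => ⟨fun _ _ => ?_, fun _ _ => ?_⟩⟩
  all_goals simp [TensorProduct.tmul_add, TensorProduct.add_tmul, ← TensorProduct.smul_tmul']

/-- The standard representative is multiplicative already in L ⊗_k L: second legs lie in 1 ⋊ K,
where they multiply as in K, so the action only affects first legs. -/
theorem comulRep_mul (x y : M.Smash) : M.comulRep (x * y) = M.comulRep x * M.comulRep y := by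
  induction x using M.smk_induction with
  | zero => simp
  | add x x' hx hx' => rw [add_mul, map_add, map_add, add_mul, hx, hx']
  | smk v h =>
  induction y using M.smk_induction with
  | zero => simp
  | add x x' hx hx' => rw [mul_add, map_add, map_add, mul_add, hx, hx']
  | smk w g =>
  have h1 : ∀ a b : K, M.comulRep (M.smk (v * M.toModuleAlgebra.act a w) (b * g)) =
      comulSum k b fun b₁ b₂ => comulSum k g fun g₁ g₂ =>
        M.smk (v * M.toModuleAlgebra.act a w) (b₁ * g₁) ⊗ₜ[k] M.smk 1 (b₂ * g₂) := by
    intro a b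
    rw [comulRep_smk, comulSum_mul (k := k) _ _ (fun c d =>
      M.smk (v * M.toModuleAlgebra.act a w) c ⊗ₜ[k] M.smk 1 d)]
  rw [smk_mul_smk, map_sweedler]
  simp only [h1]
  refine (comulSum_coassoc (k := k) (fun a b₁ b₂ => comulSum k g fun g₁ g₂ =>
    M.smk (v * M.toModuleAlgebra.act a w) (b₁ * g₁) ⊗ₜ[k] M.smk 1 (b₂ * g₂)) h).symm.trans ?_
  rw [comulRep_smk, comulRep_smk, sweedler_mul_right]
  congr 1; funext x b
  refine (sweedler_comm _ _ _).trans ?_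
  rw [mul_sweedler]
  simp only [Algebra.TensorProduct.tmul_mul_tmul, smk_one_mul_smk_one, M.smk_mul_smk v,
    sweedler_tmul_right]

section

variable (hY : IsBraidedYetterDrinfeld M.toModuleAlgebra.act M.coaction)

include hY

/-- s(r) commutes with the targets occurring in the first leg of the relations, and t(r') with the
sources occurring in the second. -/
theorem proj_bimodule_eq {x y : M.Smash ⊗[k] M.Smash}
    (h : M.smashBialgebroid.proj x = M.smashBialgebroid.proj y) (r r' : V) :
    M.smashBialgebroid.proj ((M.source r ⊗ₜ[k] M.target r') * x) =
      M.smashBialgebroid.proj ((M.source r ⊗ₜ[k] M.target r') * y) := by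
  refine M.eq_of_proj_eq
    (M.smashBialgebroid.proj ∘ₗ LinearMap.mulLeft k (M.source r ⊗ₜ[k] M.target r'))
    (fun q a b => ?_) h
  simp only [LinearMap.comp_apply, LinearMap.mulLeft_apply, Algebra.TensorProduct.tmul_mul_tmul]
  rw [← mul_assoc, source_target_comm M hY, mul_assoc, ← mul_assoc (M.target r'),
    ← source_target_comm M hY, mul_assoc (M.source q), proj_target_mul]

/-- On the standard representative, t(r')(1 ⋊ h₂) = r'₀ ⋊ r'₁ h₂. The factor s(r'₀) crosses ⊗_V to
become t(r'₀) on the first leg, and coassociativity of the coaction recombines the result into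
Δ(t(r')(v ⋊ h)). -/
theorem comul_bimodule (r r' : V) (a : M.Smash) (x : M.Smash ⊗[k] M.Smash)
    (hx : M.smashBialgebroid.proj x = M.smashBialgebroid.comul a) :
    M.smashBialgebroid.comul (M.source r * M.target r' * a) =
      M.smashBialgebroid.proj ((M.source r ⊗ₜ[k] M.target r') * x) := by
  rw [comul_eq] at hx ⊢
  rw [M.proj_bimodule_eq hY hx]
  clear hx x
  induction a using M.smk_induction with
  | zero => simp
  | add x y hx hy => simp only [mul_add, map_add, hx, hy]
  | smk v h =>
  have h1 : ∀ (w : V) (c : K), M.comulRep (M.smk (r * (v * w)) (c * h)) =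
      comulSum k c fun c₁ c₂ => comulSum k h fun h₁ h₂ =>
        M.smk (r * (v * w)) (c₁ * h₁) ⊗ₜ[k] M.smk 1 (c₂ * h₂) := by
    intro w c
    rw [comulRep_smk, comulSum_mul (k := k) _ _ (fun a b => M.smk (r * (v * w)) a ⊗ₜ[k] M.smk 1 b)]
  have h2 : ∀ h₁ h₂ : K, M.smashBialgebroid.proj
      ((M.source r * M.smk v h₁) ⊗ₜ[k] (M.target r' * M.smk 1 h₂)) =
      sweedler (M.coaction r') fun w c => comulSum k c fun c₁ c₂ => M.smashBialgebroid.proj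
        (M.smk (r * (v * w)) (c₁ * h₁) ⊗ₜ[k] M.smk 1 (c₂ * h₂)) := by
    intro h₁ h₂
    rw [← hY.coact_coassoc (fun w c₁ c₂ => M.smashBialgebroid.proj
        (M.smk (r * (v * w)) (c₁ * h₁) ⊗ₜ[k] M.smk 1 (c₂ * h₂))) r', target_mul_smk M hY,
      tmul_sweedler, map_sweedler, source_mul_smk]
    congr 1; funext w c
    rw [one_mul, ← M.source_mul_smk_one w, ← proj_target_mul, target_mul_smk M hY,
      sweedler_tmul_right, map_sweedler]
    simp only [mul_assoc]
  rw [mul_assoc, target_mul_smk M hY, mul_sweedler, map_sweedler, map_sweedler, comulRep_smk,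
    mul_sweedler, map_sweedler]
  simp only [source_mul_smk, h1, Algebra.TensorProduct.tmul_mul_tmul]
  simp only [source_mul_smk] at h2
  simp only [h2, map_sweedler]
  rw [sweedler_comm]
  congr 1; funext w c
  rw [sweedler_comm]

theorem comul_source_mul (r : V) (a : M.Smash) (x : M.Smash ⊗[k] M.Smash)
    (hx : M.smashBialgebroid.proj x = M.smashBialgebroid.comul a) :
    M.smashBialgebroid.comul (M.source r * a) =
      M.smashBialgebroid.proj ((M.source r ⊗ₜ[k] 1) * x) := by
  have := M.comul_bimodule hY r 1 a x hx
  rwa [target_one M hY, mul_one] at this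

theorem comul_target_mul (r : V) (a : M.Smash) (x : M.Smash ⊗[k] M.Smash)
    (hx : M.smashBialgebroid.proj x = M.smashBialgebroid.comul a) :
    M.smashBialgebroid.comul (M.target r * a) =
      M.smashBialgebroid.proj ((1 ⊗ₜ[k] M.target r) * x) := by
  have := M.comul_bimodule hY 1 r a x hx
  rwa [source_one M, one_mul] at this

theorem counit_bimodule (r r' : V) (a : M.Smash) :
    M.smashBialgebroid.counit (M.source r * M.target r' * a) =
      r * M.smashBialgebroid.counit a * r' := by
  induction a using M.smk_induction with
  | zero => simp
  | add x y hx hy => simp only [mul_add, map_add, hx, hy, add_mul]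
  | smk v h =>
  rw [mul_assoc, target_mul_smk M hY, mul_sweedler, map_sweedler]
  simp only [source_mul_smk, counit_smk, Bialgebra.counit_mul, mul_smul]
  have := hY.coact_counit (LinearMap.mulLeft k r ∘ₗ
    LinearMap.mulLeft k (Coalgebra.counit (R := k) h • v)) r'
  simpa [mul_assoc] using this

theorem coassoc (a : M.Smash) (x : M.Smash ⊗[k] M.Smash)
    (hx : M.smashBialgebroid.proj x = M.smashBialgebroid.comul a) :
    M.smashBialgebroid.comulLeft x = M.smashBialgebroid.comulRight x := by
  rw [comul_eq] at hx
  rw [M.smashBialgebroid.eq_of_proj_eq _ (M.smashBialgebroid.comulLeft_balanced (M.comul_target_mul hY))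
      hx,
    M.smashBialgebroid.eq_of_proj_eq _ (M.smashBialgebroid.comulRight_balanced (M.comul_source_mul hY))
      hx]
  clear hx x
  induction a using M.smk_induction with
  | zero => simp
  | add x y hx hy => simp only [map_add, hx, hy]
  | smk v h =>
  have h1 : ∀ a b : K, M.smashBialgebroid.comulLeft (M.smk v a ⊗ₜ M.smk 1 b) =
      comulSum k a fun c d => (bimoduleRelations₃ M.smashBialgebroid.source
        M.smashBialgebroid.target).mkQ (M.smk v c ⊗ₜ (M.smk 1 d ⊗ₜ M.smk 1 b)) := by
    intro a b
    rw [LeftBialgebroidData.comulLeft_tmul, comul_eq, LeftBialgebroidData.joinRight_proj,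
      comulRep_smk, sweedler_tmul_right, map_sweedler, map_sweedler]
    rfl
  have h2 : ∀ a b : K, M.smashBialgebroid.comulRight (M.smk v a ⊗ₜ M.smk 1 b) =
      comulSum k b fun c d => (bimoduleRelations₃ M.smashBialgebroid.source
        M.smashBialgebroid.target).mkQ (M.smk v a ⊗ₜ (M.smk 1 c ⊗ₜ M.smk 1 d)) := by
    intro a b
    rw [LeftBialgebroidData.comulRight_tmul, comul_eq, LeftBialgebroidData.joinLeft_proj,
      comulRep_smk, tmul_sweedler, map_sweedler]
  simp only [comulRep_smk, map_sweedler, h1, h2]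
  exact comulSum_coassoc (k := k) (fun a b c =>
    (bimoduleRelations₃ M.smashBialgebroid.source M.smashBialgebroid.target).mkQ
      (M.smk v a ⊗ₜ (M.smk 1 b ⊗ₜ M.smk 1 c))) h

theorem counit_left (a : M.Smash) (x : M.Smash ⊗[k] M.Smash)
    (hx : M.smashBialgebroid.proj x = M.smashBialgebroid.comul a) :
    M.smashBialgebroid.counitLeft x = a := by
  rw [comul_eq] at hx
  rw [M.eq_of_proj_eq _ (fun r a b => ?_) hx]
  · clear hx x
    induction a using M.smk_induction with
    | zero => simp
    | add x y hx hy => simp only [map_add, hx, hy]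
    | smk v h =>
    rw [comulRep_smk, map_sweedler]
    have h1 : ∀ a b : K, M.smashBialgebroid.counitLeft (M.smk v a ⊗ₜ M.smk 1 b) =
        Coalgebra.counit (R := k) a • M.smk v b := by
      intro a b
      change M.source (M.smashBialgebroid.counit (M.smk v a)) * M.smk 1 b = _
      rw [source_mul_smk_one, counit_smk, smk_smul_left]
    simp only [h1]
    exact comulSum_counit_smul (M.smk v) h
  · change M.source (M.smashBialgebroid.counit (M.target r * a)) * b =
      M.source (M.smashBialgebroid.counit a) * (M.source r * b)
    have := M.counit_bimodule hY 1 r a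
    rw [source_one, one_mul, one_mul] at this
    rw [this, source_mul, mul_assoc]

theorem counit_right (a : M.Smash) (x : M.Smash ⊗[k] M.Smash)
    (hx : M.smashBialgebroid.proj x = M.smashBialgebroid.comul a) :
    M.smashBialgebroid.counitRight x = a := by
  rw [comul_eq] at hx
  rw [M.eq_of_proj_eq _ (fun r a b => ?_) hx]
  · clear hx x
    induction a using M.smk_induction with
    | zero => simp
    | add x y hx hy => simp only [map_add, hx, hy]
    | smk v h =>
    rw [comulRep_smk, map_sweedler]
    have h1 : ∀ a b : K, M.smashBialgebroid.counitRight (M.smk v a ⊗ₜ M.smk 1 b) =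
        Coalgebra.counit (R := k) b • M.smk v a := by
      intro a b
      change M.target (M.smashBialgebroid.counit (M.smk 1 b)) * M.smk v a = _
      rw [counit_smk, map_smul, target_one M hY, smul_mul_assoc, one_mul]
    simp only [h1]
    exact comulSum_smul_counit (M.smk v) h
  · change M.target (M.smashBialgebroid.counit b) * (M.target r * a) =
      M.target (M.smashBialgebroid.counit (M.source r * b)) * a
    have := M.counit_bimodule hY r 1 b
    rw [target_one M hY, mul_one, mul_one] at this
    rw [this, target_mul M hY, mul_assoc]

/-- Both sides reduce to t(h₂ · r)(v ⋊ h₁) ⊗ (1 ⋊ h₃): on the left through `smk_mul_target`, on the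
right by moving s(h₂ · r) across ⊗_V. -/
theorem takeuchi_comulRep (r : V) (a : M.Smash) :
    M.smashBialgebroid.proj (M.comulRep a * (M.target r ⊗ₜ[k] 1)) =
      M.smashBialgebroid.proj (M.comulRep a * (1 ⊗ₜ[k] M.source r)) := by
  induction a using M.smk_induction with
  | zero => simp
  | add x y hx hy => simp only [map_add, add_mul, hx, hy]
  | smk v h =>
  have h1 : ∀ x c : K, M.smashBialgebroid.proj ((M.smk v x * M.target r) ⊗ₜ[k] M.smk 1 c) =
      comulSum k x fun a b => M.smashBialgebroid.proj
        ((M.target (M.toModuleAlgebra.act b r) * M.smk v a) ⊗ₜ[k] M.smk 1 c) := by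
    intro x c
    rw [← source_mul_smk_one, mul_assoc, smk_mul_target M hY, mul_sweedler, sweedler_tmul_right,
      map_sweedler]
    simp only [← mul_assoc, source_target_comm M hY]
    simp only [mul_assoc, source_mul_smk_one]
  have h2 : ∀ a x : K, M.smashBialgebroid.proj (M.smk v a ⊗ₜ[k] (M.smk 1 x * M.source r)) =
      comulSum k x fun b c => M.smashBialgebroid.proj
        ((M.target (M.toModuleAlgebra.act b r) * M.smk v a) ⊗ₜ[k] M.smk 1 c) := by
    intro a x
    rw [smk_mul_source, tmul_sweedler, map_sweedler]
    congr 1; funext b c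
    rw [proj_target_mul, M.source_mul_smk_one (M.toModuleAlgebra.act b r)]
  simp only [comulRep_smk, sweedler_mul_right, Algebra.TensorProduct.tmul_mul_tmul, mul_one,
    map_sweedler, h1, h2]
  exact comulSum_coassoc (k := k) (fun a b c => M.smashBialgebroid.proj
        ((M.target (M.toModuleAlgebra.act b r) * M.smk v a) ⊗ₜ[k] M.smk 1 c)) h

theorem smashBialgebroid_isLeftBialgebroid : M.smashBialgebroid.IsLeftBialgebroid where
  source_one := M.source_one
  source_mul := M.source_mul
  target_one := M.target_one hY
  target_mul := M.target_mul hY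
  source_target_comm := M.source_target_comm hY
  comul_bimodule := M.comul_bimodule hY
  counit_bimodule := M.counit_bimodule hY
  coassoc := M.coassoc hY
  counit_left := M.counit_left hY
  counit_right := M.counit_right hY
  takeuchi r a x hx := by
    rw [comul_eq] at hx
    rw [M.smashBialgebroid.proj_mul_of_proj_eq hx, M.smashBialgebroid.proj_mul_of_proj_eq hx]
    exact M.takeuchi_comulRep hY r a
  comul_one := by rw [comul_eq, M.comul_one]
  comul_mul a b x y hx hy := by
    rw [comul_eq] at hx hy
    rw [comul_eq, comulRep_mul, M.smashBialgebroid.proj_mul_of_proj_eq hx]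
    -- Left multiplication by Δ(a) respects the relations precisely because of the Takeuchi
    -- condition.
    refine M.eq_of_proj_eq
      (M.smashBialgebroid.proj ∘ₗ LinearMap.mulLeft k (M.comulRep a)) (fun r c d => ?_) hy.symm
    have h1 := M.smashBialgebroid.proj_mul_of_proj_eq (M.takeuchi_comulRep hY r a) (c ⊗ₜ d)
    simpa [mul_assoc] using h1
  counit_one := by rw [one_eq, counit_smk]; simp
  counit_mul_source a b := by
    induction a using M.smk_induction with
    | zero => simp
    | add x y hx hy => simp only [map_add, add_mul, hx, hy]
    | smk v h =>
    induction b using M.smk_induction with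
    | zero => simp
    | add x y hx hy => simp only [map_add, mul_add, hx, hy]
    | smk w g =>
    change _ = M.smashBialgebroid.counit (M.smk v h * M.smk _ 1)
    rw [counit_smk_mul_smk, counit_smk_mul_smk, counit_smk]
    simp
  counit_mul_target a b := by
    induction a using M.smk_induction with
    | zero => simp
    | add x y hx hy => simp only [map_add, add_mul, hx, hy]
    | smk v h =>
    induction b using M.smk_induction with
    | zero => simp
    | add x y hx hy => simp only [map_add, mul_add, hx, hy]
    | smk w g =>
    change _ = M.smashBialgebroid.counit (M.smk v h * M.target _)
    rw [counit_smk_mul_smk, counit_smk, target_eq, mul_sweedler, map_sweedler]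
    simp only [counit_smk_mul_smk]
    have := hY.coact_counit (LinearMap.mulLeft k v ∘ₗ M.toModuleAlgebra.act h)
      (Coalgebra.counit (R := k) g • w)
    simpa using this.symm

end

end DoubleModuleAlgebra

/-! ### Lu's antipode on the smash product. -/

namespace DoubleModuleAlgebra

variable {k K V P : Type*} [Field k] [Ring K] [Bialgebra k K] [Module.Finite k K]
  [Ring V] [Algebra k V] [AddCommGroup P] [Module k P] {S : BijectiveAntipode k K}
  (M : DoubleModuleAlgebra S V)

/-- The map `v ↦ S²(v₁) · v₀`. -/
abbrev twist : V →ₗ[k] V :=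
  IsBraidedYetterDrinfeld.theta M.toModuleAlgebra.act M.coaction S

theorem luAntipode_smk_eq (v : V) (h : K) :
    M.luAntipode (M.smk v h) = M.smk 1 (S.S h) * M.target (M.twist v) := by
  rw [luAntipode_smk, ← Finset.mul_sum, ← map_sum]
  congr 2
  simp [twist, IsBraidedYetterDrinfeld.theta, coaction, target]
  rfl

/-- The map `v ⋊ h ↦ (1 ⋊ S⁻¹(h)) t(v)`. -/
def luAntipodeInv : M.Smash →ₗ[k] M.Smash :=
  TensorProduct.lift (LinearMap.mk₂ k (fun v h => M.smk 1 (S.S.symm h) * M.target v)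
    (by simp [mul_add]) (by simp) (by simp [add_mul]) (by simp)) ∘ₗ
    (ModuleAlgebra.Smash.equiv M.toModuleAlgebra).toLinearMap

theorem luAntipodeInv_smk (v : V) (h : K) :
    M.luAntipodeInv (M.smk v h) = M.smk 1 (S.S.symm h) * M.target v := by
  simp [luAntipodeInv, smk]

/-- The map `a ⊗ (w ⋊ g) ↦ t(w) a ⊗ (1 ⋊ g)`. -/
def sectionAux : M.Smash ⊗[k] M.Smash →ₗ[k] M.Smash ⊗[k] M.Smash :=
  TensorProduct.lift (TensorProduct.lift (LinearMap.mk₂ k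
    (fun w g => (TensorProduct.mk k M.Smash M.Smash).flip (M.smk 1 g) ∘ₗ
      LinearMap.mulLeft k (M.target w))
    (fun _ _ _ => by ext; simp [add_mul])
    (fun _ _ _ => by ext; simp)
    (fun _ _ _ => by ext; simp) (fun _ _ _ => by ext; simp)) ∘ₗ
    (ModuleAlgebra.Smash.equiv M.toModuleAlgebra).toLinearMap).flip

theorem sectionAux_tmul (a : M.Smash) (w : V) (g : K) :
    M.sectionAux (a ⊗ₜ M.smk w g) = (M.target w * a) ⊗ₜ M.smk 1 g := by
  simp [sectionAux, smk]

/-- `sectionAux` selects in every class the representative whose second leg lies in 1 ⋊ K. It serves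
as Lu's section η, and as a normal form for comparing elements of the balanced tensor product. -/
theorem proj_sectionAux (x : M.Smash ⊗[k] M.Smash) :
    M.smashBialgebroid.proj (M.sectionAux x) = M.smashBialgebroid.proj x := by
  induction x with
  | zero => simp
  | add x y hx hy => simp only [map_add, hx, hy]
  | tmul a b =>
  induction b using M.smk_induction with
  | zero => simp
  | add x y hx hy => simp only [TensorProduct.tmul_add, map_add, hx, hy]
  | smk w g => rw [sectionAux_tmul, proj_target_mul, source_mul_smk_one]

section

variable (hY : IsBraidedYetterDrinfeld M.toModuleAlgebra.act M.coaction)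

include hY

theorem smk_antipode_mul_target (h : K) (v : V) : M.smk 1 (S.S h) * M.target v =
    comulSum k h fun a b => M.target (M.toModuleAlgebra.act (S.S a) v) * M.smk 1 (S.S b) := by
  rw [smk_mul_target M hY,
    S.comulSum_apply _ (fun a b => M.target (M.toModuleAlgebra.act b v) * M.smk 1 a)]

/-- The exchange rule needed for anti-multiplicativity. Moving S(h₂) past the target and using θ(h₁
· w) = S²(h₁) · θ(w) leaves S(h₂) S²(h₁) = S(S(h₁) h₂), which cancels. -/
theorem target_twist_mul_smk (w : V) (h : K) : M.target (M.twist w) * M.smk 1 (S.S h) =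
    comulSum k h fun a b =>
      M.smk 1 (S.S b) * M.target (M.twist (M.toModuleAlgebra.act a w)) := by
  have h1 : ∀ a b : K, M.smk 1 (S.S b) * M.target (M.twist (M.toModuleAlgebra.act a w)) =
      comulSum k b fun c d => M.target (M.toModuleAlgebra.act (S.S (S.S a * c)) (M.twist w)) *
        M.smk 1 (S.S d) := by
    intro a b
    rw [smk_antipode_mul_target M hY, hY.theta_act]
    simp [S.map_mul]
  simp only [h1]
  rw [← comulSum_coassoc (k := k) (fun a c d =>
    M.target (M.toModuleAlgebra.act (S.S (S.S a * c)) (M.twist w)) * M.smk 1 (S.S d)) h]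
  have h2 : ∀ y d : K, (comulSum k y fun a c =>
      M.target (M.toModuleAlgebra.act (S.S (S.S a * c)) (M.twist w)) * M.smk 1 (S.S d)) =
      Coalgebra.counit (R := k) y • (M.target (M.twist w) * M.smk 1 (S.S d)) := by
    intro y d
    have := S.comulSum_antipode_mul (fun z =>
      M.target (M.toModuleAlgebra.act (S.S z) (M.twist w)) * M.smk 1 (S.S d)) y
    simpa [S.map_one] using this
  simp only [h2]
  exact (comulSum_counit_smul (fun d => M.target (M.twist w) * M.smk 1 (S.S d)) h).symm

theorem luAntipode_mul (x y : M.Smash) :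
    M.luAntipode (x * y) = M.luAntipode y * M.luAntipode x := by
  induction x using M.smk_induction with
  | zero => simp
  | add x x' hx hx' => rw [add_mul, map_add, map_add, mul_add, hx, hx']
  | smk v h =>
  induction y using M.smk_induction with
  | zero => simp
  | add x x' hx hx' => rw [mul_add, map_add, map_add, add_mul, hx, hx']
  | smk w g =>
  rw [smk_mul_smk, map_sweedler, luAntipode_smk_eq, luAntipode_smk_eq, mul_assoc,
    ← mul_assoc (M.target _), target_twist_mul_smk M hY, sweedler_mul_right, mul_sweedler]
  congr 1; funext a b
  rw [luAntipode_smk_eq, S.map_mul, ← smk_one_mul_smk_one, hY.theta_mul, target_mul M hY]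
  simp only [mul_assoc]

/-- In τ(r₀ ⋊ r₁) the factor S²(r₁) inside θ meets S(r₂) coming from the exchange rule, and S(r₂)
S²(r₁) = S(S(r₁) r₂) cancels. What remains is t(r₀)(1 ⋊ S(r₁)) = r₀ ⋊ r₁ S(r₂) = r ⋊ 1. -/
theorem luAntipode_target (r : V) : M.luAntipode (M.target r) = M.source r := by
  have h1 : ∀ (w : V) (c : K), M.luAntipode (M.smk w c) = sweedler (M.coaction w) fun u d =>
      comulSum k c fun a b =>
        M.target (M.toModuleAlgebra.act (S.S (S.S d * a)) u) * M.smk 1 (S.S b) := by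
    intro w c
    rw [luAntipode_smk_eq, smk_antipode_mul_target M hY, sweedler_comm]
    congr 1; funext a b
    rw [twist, IsBraidedYetterDrinfeld.theta_apply, map_sweedler, map_sweedler, sweedler_mul_right]
    simp [S.map_mul]
  have h2 : ∀ (u : V) (x : K), (comulSum k x fun d c => comulSum k c fun a b =>
        M.target (M.toModuleAlgebra.act (S.S (S.S d * a)) u) * M.smk 1 (S.S b)) =
      M.target u * M.smk 1 (S.S x) := by
    intro u x
    rw [← comulSum_coassoc (k := k) (fun d a b =>
        M.target (M.toModuleAlgebra.act (S.S (S.S d * a)) u) * M.smk 1 (S.S b)) x]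
    have h3 : ∀ y b : K, (comulSum k y fun d a =>
        M.target (M.toModuleAlgebra.act (S.S (S.S d * a)) u) * M.smk 1 (S.S b)) =
        Coalgebra.counit (R := k) y • (M.target u * M.smk 1 (S.S b)) := by
      intro y b
      have := S.comulSum_antipode_mul (fun z =>
        M.target (M.toModuleAlgebra.act (S.S z) u) * M.smk 1 (S.S b)) y
      simpa [S.map_one] using this
    simp only [h3]
    exact comulSum_counit_smul (fun b => M.target u * M.smk 1 (S.S b)) x
  rw [target_eq, map_sweedler]
  simp only [h1]
  rw [hY.coact_coassoc (k := k) (fun u d c => comulSum k c fun a b =>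
        M.target (M.toModuleAlgebra.act (S.S (S.S d * a)) u) * M.smk 1 (S.S b)) r]
  simp only [h2]
  simp only [target_mul_smk M hY, one_mul]
  rw [hY.coact_coassoc (k := k) (fun w a c => M.smk w (a * S.S c)) r]
  have h4 : ∀ (w : V) (x : K), (comulSum k x fun a c => M.smk w (a * S.S c)) =
      Coalgebra.counit (R := k) x • M.source w := fun w x => S.comulSum_mul_antipode (M.smk w) x
  simp only [h4]
  exact hY.coact_counit M.source r

theorem luAntipode_one : M.luAntipode 1 = 1 := by
  rw [← M.target_one hY, luAntipode_target M hY, source_one]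
  exact (M.target_one hY).symm

theorem twist_one : M.twist 1 = 1 := by
  rw [twist, IsBraidedYetterDrinfeld.theta_apply, hY.coact_one, sweedler_tmul]
  · simp [S.map_one]
  · refine ⟨fun _ => ⟨fun _ _ => ?_, fun _ _ => ?_⟩, fun _ => ⟨fun _ _ => ?_, fun _ _ => ?_⟩⟩
    all_goals simp

theorem luAntipode_smk_one (h : K) : M.luAntipode (M.smk 1 h) = M.smk 1 (S.S h) := by
  rw [luAntipode_smk_eq, twist_one M hY, target_one M hY, mul_one]

/-- The counit axioms allow t(θ(v)) to be replaced by θ(v) ⋊ 1 as right factor under ε. -/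
theorem counit_luAntipode_smk (v : V) (h : K) :
    M.smashBialgebroid.counit (M.luAntipode (M.smk v h)) =
      M.toModuleAlgebra.act (S.S h) (M.twist v) := by
  have h1 := (M.smashBialgebroid_isLeftBialgebroid hY).counit_mul_target (M.smk 1 (S.S h))
    (M.smk (M.twist v) 1)
  rw [counit_smk_mul_smk, counit_smk, Bialgebra.counit_one, one_smul, one_smul, one_mul] at h1
  rw [luAntipode_smk_eq]
  exact h1.symm

theorem luAntipode_luAntipodeInv (x : M.Smash) : M.luAntipode (M.luAntipodeInv x) = x := by
  induction x using M.smk_induction with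
  | zero => simp
  | add x y hx hy => rw [map_add, map_add, hx, hy]
  | smk v h =>
  rw [luAntipodeInv_smk, luAntipode_mul M hY, luAntipode_target M hY, luAntipode_smk_one M hY,
    LinearEquiv.apply_symm_apply, source_mul_smk_one]

theorem luAntipodeInv_surjective : Function.Surjective M.luAntipodeInv := by
  intro x
  induction x using M.smk_induction with
  | zero => exact ⟨0, map_zero _⟩
  | add x y hx hy =>
    obtain ⟨x, rfl⟩ := hx
    obtain ⟨y, rfl⟩ := hy
    exact ⟨x + y, map_add _ _ _⟩
  | smk v h =>
  -- The preimage comes from v ⋊ h = τ(t(v))(1 ⋊ h) = (1 ⋊ S(v₁)) t(θ(v₀)) (1 ⋊ h), with the target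
  -- then moved to the far right by `target_mul_smk_one`.
  refine ⟨sweedler (M.coaction v) fun u c => comulSum k h fun a b =>
    M.smk (M.toModuleAlgebra.act (S.S b) (M.twist u)) (S.S (S.S c * a)), ?_⟩
  rw [← source_mul_smk_one, ← luAntipode_target M hY, target_eq, map_sweedler, map_sweedler,
    sweedler_mul_right]
  congr 1; funext u c
  rw [luAntipode_smk_eq, mul_assoc, target_mul_smk_one M hY, mul_sweedler, map_sweedler]
  congr 1; funext a b
  rw [luAntipodeInv_smk, LinearEquiv.symm_apply_apply, ← smk_one_mul_smk_one, mul_assoc]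

/-- `luAntipodeInv` is a right inverse of τ and is surjective, hence a two-sided inverse. -/
theorem luAntipode_bijective : Function.Bijective M.luAntipode := by
  refine ⟨fun x y h => ?_, fun x => ⟨_, M.luAntipode_luAntipodeInv hY x⟩⟩
  obtain ⟨x, rfl⟩ := M.luAntipodeInv_surjective hY x
  obtain ⟨y, rfl⟩ := M.luAntipodeInv_surjective hY y
  rw [luAntipode_luAntipodeInv M hY, luAntipode_luAntipodeInv M hY] at h
  rw [h]

/-- The map a ⊗ b ↦ τ(a) b is balanced because τ(t(r) a) = τ(a) s(r). On the standard
representative, t(θ(v)) is moved past 1 ⋊ h₂, and S(h₁) h₂ cancels. -/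
theorem luAntipode_left (a : M.Smash) (x : M.Smash ⊗[k] M.Smash)
    (hx : M.smashBialgebroid.proj x = M.smashBialgebroid.comul a) :
    LinearMap.mul' k M.Smash (M.luAntipode.rTensor M.Smash x) =
      M.target (M.smashBialgebroid.counit (M.luAntipode a)) := by
  rw [comul_eq] at hx
  have h0 := M.eq_of_proj_eq (LinearMap.mul' k M.Smash ∘ₗ M.luAntipode.rTensor M.Smash)
    (fun r a b => by
      simp [luAntipode_mul M hY, luAntipode_target M hY, mul_assoc]) hx
  rw [LinearMap.comp_apply, LinearMap.comp_apply] at h0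
  rw [h0]
  clear h0 hx x
  induction a using M.smk_induction with
  | zero => simp
  | add x y hx hy => simp only [map_add, hx, hy]
  | smk v h =>
  rw [counit_luAntipode_smk M hY, comulRep_smk, map_sweedler, map_sweedler]
  have h1 : ∀ a b : K, LinearMap.mul' k M.Smash
      (M.luAntipode.rTensor M.Smash (M.smk v a ⊗ₜ M.smk 1 b)) = comulSum k b fun c d =>
        M.smk 1 (S.S a * c) * M.target (M.toModuleAlgebra.act (S.S d) (M.twist v)) := by
    intro a b
    rw [LinearMap.rTensor_tmul, LinearMap.mul'_apply, luAntipode_smk_eq, mul_assoc,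
      target_mul_smk_one M hY, mul_sweedler]
    simp only [← mul_assoc, smk_one_mul_smk_one]
  simp only [h1]
  refine (comulSum_coassoc (k := k) (fun a c d => M.smk 1 (S.S a * c) *
    M.target (M.toModuleAlgebra.act (S.S d) (M.twist v))) h).symm.trans ?_
  have h2 : ∀ y d : K, (comulSum k y fun a c => M.smk 1 (S.S a * c) *
      M.target (M.toModuleAlgebra.act (S.S d) (M.twist v))) = Coalgebra.counit (R := k) y •
      M.target (M.toModuleAlgebra.act (S.S d) (M.twist v)) := by
    intro y d
    have := S.comulSum_antipode_mul (fun z => M.smk 1 z *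
      M.target (M.toModuleAlgebra.act (S.S d) (M.twist v))) y
    rwa [← one_eq, one_mul] at this
  simp only [h2]
  exact comulSum_counit_smul (fun d => M.target (M.toModuleAlgebra.act (S.S d) (M.twist v))) h

theorem sectionAux_balanced (r : V) (a b : M.Smash) :
    M.sectionAux ((M.target r * a) ⊗ₜ b) = M.sectionAux (a ⊗ₜ (M.source r * b)) := by
  induction b using M.smk_induction with
  | zero => simp
  | add x y hx hy => simp only [mul_add, TensorProduct.tmul_add, map_add, hx, hy]
  | smk w g => rw [source_mul_smk, sectionAux_tmul, sectionAux_tmul, target_mul M hY, mul_assoc]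

/-- No balancedness of a ⊗ b ↦ a τ(b) is available, hence the section. With second legs in 1 ⋊ K,
where τ is just S, the axiom reduces to h₁ S(h₂) = ε(h). -/
theorem luAntipode_right : ∃ η : BimoduleTensor M.source M.target →ₗ[k] M.Smash ⊗[k] M.Smash,
    (∀ y, M.smashBialgebroid.proj (η y) = y) ∧
    ∀ a, LinearMap.mul' k M.Smash (M.luAntipode.lTensor M.Smash
      (η (M.smashBialgebroid.comul a))) = M.source (M.smashBialgebroid.counit a) := by
  refine ⟨(bimoduleRelations M.source M.target).liftQ M.sectionAux ?_, ?_, ?_⟩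
  · refine Submodule.span_le.2 ?_
    rintro _ ⟨r, a, b, rfl⟩
    simp [M.sectionAux_balanced hY]
  · intro y
    obtain ⟨x, rfl⟩ := M.smashBialgebroid.proj_surjective y
    exact M.proj_sectionAux x
  · intro a
    change LinearMap.mul' k M.Smash (M.luAntipode.lTensor M.Smash
      (M.sectionAux (M.comulRep a))) = _
    induction a using M.smk_induction with
    | zero => simp
    | add x y hx hy => simp only [map_add, hx, hy]
    | smk v h =>
    rw [comulRep_smk, map_sweedler, map_sweedler, map_sweedler, counit_smk, map_smul]
    simp only [sectionAux_tmul, LinearMap.lTensor_tmul, LinearMap.mul'_apply,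
      luAntipode_smk_one M hY, target_one M hY, one_mul, smk_one_mul_smk_one]
    exact S.comulSum_mul_antipode (M.smk v) h

theorem smashBialgebroid_isLuHopfAlgebroid :
    M.smashBialgebroid.IsLuHopfAlgebroid M.luAntipode where
  isLeftBialgebroid := M.smashBialgebroid_isLeftBialgebroid hY
  bijective := M.luAntipode_bijective hY
  antipode_one := M.luAntipode_one hY
  antipode_mul := M.luAntipode_mul hY
  antipode_target := M.luAntipode_target hY
  antipode_left := M.luAntipode_left hY
  antipode_right := M.luAntipode_right hY

end

end DoubleModuleAlgebra

/-! ## The action of the Drinfel'd double on a Yetter–Drinfel'd module algebra -/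

namespace IsBraidedYetterDrinfeld

variable {k K V P : Type*} [Field k] [Ring K] [Bialgebra k K] [Module.Finite k K]
  [Ring V] [Algebra k V] [AddCommGroup P] [Module k P]
  {act : K →ₐ[k] Module.End k V} {δ : V →ₗ[k] V ⊗[k] K}
  (Y : IsBraidedYetterDrinfeld act δ) (S : BijectiveAntipode k K)

/-- The map `w ↦ c ↦ p(c) w`. -/
def evalSmul (p : Module.Dual k K) : V →ₗ[k] K →ₗ[k] V := (LinearMap.lsmul k V ∘ₗ p).flip

theorem evalSmul_apply (p : Module.Dual k K) (w : V) (c : K) : evalSmul p w c = p c • w := rfl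

variable (δ) in
/-- The action `p · v = v₀ p(v₁)` of the dual. -/
def coactDual : Module.Dual k K →ₗ[k] Module.End k V where
  toFun p := (TensorProduct.rid k V).toLinearMap ∘ₗ p.lTensor V ∘ₗ δ
  map_add' p q := by ext; simp [LinearMap.lTensor_add]
  map_smul' c p := by ext; simp [LinearMap.lTensor_smul]

theorem coactDual_apply (p : Module.Dual k K) (v : V) :
    coactDual δ p v = sweedler (δ v) fun w c => evalSmul p w c := by
  change TensorProduct.rid k V (p.lTensor V (δ v)) = _
  conv_lhs => rw [← sweedler_self (δ v)]
  simp [map_sweedler, evalSmul_apply]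

variable (act δ) in
/-- The action of the Drinfel'd double on `V`. -/
def doubleAct : DrinfeldDouble k K →ₗ[k] Module.End k V :=
  TensorProduct.lift ((LinearMap.mul k (Module.End k V)).compl₁₂ (coactDual δ) act.toLinearMap)

theorem doubleAct_tmul (p : Module.Dual k K) (h : K) :
    doubleAct act δ (p ⊗ₜ h) = coactDual δ p * act h := rfl

include Y in
theorem coactDual_counit : coactDual δ Coalgebra.counit = 1 := by
  ext v
  rw [coactDual_apply]
  exact Y.coact_counit LinearMap.id v

include Y in
theorem coactDual_dualMul (p q : Module.Dual k K) :
    coactDual δ (DrinfeldDouble.dualMul (p ⊗ₜ q)) = coactDual δ p * coactDual δ q := by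
  ext v
  have h1 : ∀ c : K, DrinfeldDouble.dualMul (p ⊗ₜ[k] q) c = comulSum k c fun a b => p a * q b := by
    intro c
    change TensorProduct.dualDistrib k K K (p ⊗ₜ q) (Coalgebra.comul (R := k) c) = _
    conv_lhs => rw [← sweedler_self (Coalgebra.comul (R := k) c)]
    simp [map_sweedler]
  have h2 : ∀ (u : V) (c : K), evalSmul (DrinfeldDouble.dualMul (p ⊗ₜ[k] q)) u c =
      comulSum k c fun a b => evalSmul q (evalSmul p u a) b := by
    intro u c
    rw [evalSmul_apply, h1]
    simp only [sweedler, Finset.sum_smul, evalSmul_apply, smul_smul, mul_comm]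
  have h3 : ∀ (w : V) (a : K), coactDual δ p (evalSmul q w a) =
      sweedler (δ w) fun u b => evalSmul q (evalSmul p u b) a := by
    intro w a
    rw [evalSmul_apply, map_smul, coactDual_apply, ← evalSmul_apply, ← LinearMap.flip_apply,
      map_sweedler]
    rfl
  rw [Module.End.mul_apply, coactDual_apply, coactDual_apply q, map_sweedler]
  simp only [h2, h3]
  exact (Y.coact_coassoc (fun u a b => evalSmul q (evalSmul p u a) b) v).symm

theorem doubleAct_outer (p : Module.Dual k K) (d : DrinfeldDouble k K) (g : K)
    (Y : IsBraidedYetterDrinfeld act δ) :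
    doubleAct act δ (DrinfeldDouble.outer (p ⊗ₜ (d ⊗ₜ g))) =
      coactDual δ p * doubleAct act δ d * act g := by
  induction d using TensorProduct.induction_on with
  | zero => simp
  | add d e hd he =>
    simp only [TensorProduct.add_tmul, TensorProduct.tmul_add, map_add, hd, he, mul_add, add_mul]
  | tmul q f =>
    change doubleAct act δ (DrinfeldDouble.dualMul (p ⊗ₜ q) ⊗ₜ (f * g)) = _
    rw [doubleAct_tmul, doubleAct_tmul, Y.coactDual_dualMul, map_mul]
    simp only [mul_assoc]

theorem cross_eq (h : K) (q : Module.Dual k K) :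
    DrinfeldDouble.cross S h q = comulSum k h fun a x => comulSum k x fun b c =>
      (q ∘ₗ DrinfeldDouble.conj S a c) ⊗ₜ[k] b := by
  change (LinearMap.applyₗ q ∘ₗ DrinfeldDouble.crossAux S)
    (Coalgebra.comul.lTensor K (Coalgebra.comul (R := k) h)) = _
  conv_lhs => rw [← sweedler_self (Coalgebra.comul (R := k) h), map_sweedler, map_sweedler]
  congr 1; funext a x
  rw [LinearMap.lTensor_tmul]
  conv_lhs => rw [← sweedler_self (Coalgebra.comul (R := k) x), tmul_sweedler, map_sweedler]
  rfl

-- The cross relation of the double is the Yetter–Drinfel'd condition. The left side applied to v is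
-- (h₂ · v)₀ weighted by q(S⁻¹(h₃) (h₂ · v)₁ h₁); the condition turns it into h₁ · v₀ weighted by
-- q(S⁻¹(h₃) h₂ v₁), and S⁻¹(h₃) h₂ cancels.
include Y in
theorem doubleAct_cross (h : K) (q : Module.Dual k K) :
    doubleAct act δ (DrinfeldDouble.cross S h q) = act h * coactDual δ q := by
  ext v
  have h2 : ∀ a b c : K, doubleAct act δ ((q ∘ₗ DrinfeldDouble.conj S a c) ⊗ₜ[k] b) v =
      sweedler (δ (act b v)) fun w d => evalSmul q w (S.S.symm c * (d * a)) := by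
    intro a b c
    rw [doubleAct_tmul, Module.End.mul_apply, coactDual_apply]
    rfl
  have h3 : ∀ y c : K, (comulSum k y fun a b =>
      sweedler (δ (act b v)) fun w d => evalSmul q w (S.S.symm c * (d * a))) =
      comulSum k y fun a b => sweedler (δ v) fun w d =>
        evalSmul q (act a w) (S.S.symm c * b * d) := by
    intro y c
    rw [Y.coact_act_apply (fun w d => evalSmul q w (S.S.symm c * d))]
    simp only [mul_assoc]
  have h4 : ∀ a x : K, (comulSum k x fun b c => sweedler (δ v) fun w d =>
        evalSmul q (act a w) (S.S.symm c * b * d)) = Coalgebra.counit (R := k) x •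
        sweedler (δ v) fun w d => evalSmul q (act a w) d := by
    intro a x
    have := S.comulSum_symm_mul
      (fun z => sweedler (δ v) fun w d => evalSmul q (act a w) (z * d)) x
    simpa using this
  rw [cross_eq, map_sweedler, ← LinearMap.applyₗ_apply_apply (R := k), map_sweedler]
  simp only [map_sweedler, LinearMap.applyₗ_apply_apply, h2]
  refine (comulSum_coassoc (k := k) (fun a b c =>
    sweedler (δ (act b v)) fun w d => evalSmul q w (S.S.symm c * (d * a))) h).symm.trans ?_
  simp only [h3]
  rw [comulSum_coassoc (k := k) (fun a b c => sweedler (δ v) fun w d =>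
        evalSmul q (act a w) (S.S.symm c * b * d)) h]
  simp only [h4]
  rw [comulSum_smul_counit (k := k) (fun a => sweedler (δ v) fun w d => evalSmul q (act a w) d) h,
    Module.End.mul_apply, coactDual_apply, map_sweedler]
  simp [evalSmul_apply]

include Y in
theorem doubleAct_mul (d e : DrinfeldDouble k K) :
    doubleAct act δ (DrinfeldDouble.mul S (d ⊗ₜ e)) = doubleAct act δ d * doubleAct act δ e := by
  induction d using TensorProduct.induction_on with
  | zero => simp
  | add d d' hd hd' => simp only [TensorProduct.add_tmul, map_add, hd, hd', add_mul]
  | tmul p h =>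
  induction e using TensorProduct.induction_on with
  | zero => simp
  | add d d' hd hd' => simp only [TensorProduct.tmul_add, map_add, hd, hd', mul_add]
  | tmul q g =>
  rw [DrinfeldDouble.mul_tmul, doubleAct_outer _ _ _ Y, Y.doubleAct_cross S, doubleAct_tmul,
    doubleAct_tmul]
  simp only [mul_assoc]

/-- The flip in the co-opposite coproduct of the dual pairs the legs in the order v₁ u₁, the order
in which the coaction of a product multiplies them. -/
theorem map_doubleAct_apply (z : Module.Dual k K ⊗[k] Module.Dual k K) (a b : K) (u v : V) :
    LinearMap.mul' k V (TensorProduct.homTensorHomMap (RingHom.id k) V V V V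
      (TensorProduct.map (doubleAct act δ) (doubleAct act δ)
        (TensorProduct.tensorTensorTensorComm k (Module.Dual k K) (Module.Dual k K) K K
          (TensorProduct.comm k (Module.Dual k K) (Module.Dual k K) z ⊗ₜ (a ⊗ₜ b))))
        (u ⊗ₜ[k] v)) =
      sweedler (δ (act a u)) fun x c => sweedler (δ (act b v)) fun y d =>
        TensorProduct.dualDistrib k K K z (d ⊗ₜ c) • (x * y) := by
  induction z with
  | zero => simp [sweedler]
  | add z z' hz hz' =>
    simp only [map_add, TensorProduct.add_tmul, LinearMap.add_apply, hz, hz', add_smul, sweedler,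
      Finset.sum_add_distrib]
  | tmul p q =>
    simp only [TensorProduct.comm_tmul, TensorProduct.tensorTensorTensorComm_tmul,
      TensorProduct.map_tmul, TensorProduct.homTensorHomMap_apply, LinearMap.mul'_apply,
      doubleAct_tmul, Module.End.mul_apply, coactDual_apply, sweedler_mul_right, mul_sweedler,
      TensorProduct.dualDistrib_apply, evalSmul_apply, smul_mul_smul_comm,
      mul_comm (q _)]
    exact sweedler_comm _ _ _

include Y in
theorem coactDual_mul (p : Module.Dual k K) (u v : V) : coactDual δ p (u * v) =
    sweedler (δ u) fun x c => sweedler (δ v) fun y d => p (d * c) • (x * y) := by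
  change TensorProduct.rid k V (p.lTensor V (δ (u * v))) = _
  rw [Y.coact_mul]
  simp [map_sweedler]

include Y in
theorem doubleAct_apply_mul (d : DrinfeldDouble k K) (u v : V) :
    doubleAct act δ d (u * v) = LinearMap.mul' k V
      (TensorProduct.homTensorHomMap (RingHom.id k) V V V V
        (TensorProduct.map (doubleAct act δ) (doubleAct act δ) (DrinfeldDouble.comul d))
          (u ⊗ₜ[k] v)) := by
  induction d using TensorProduct.induction_on with
  | zero => simp
  | add d e hd he => simp only [map_add, LinearMap.add_apply, hd, he]
  | tmul p h =>
  let Λ : K ⊗[k] K →ₗ[k] V := LinearMap.mul' k V ∘ₗ LinearMap.applyₗ (u ⊗ₜ[k] v) ∘ₗ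
    TensorProduct.homTensorHomMap (RingHom.id k) V V V V ∘ₗ
    TensorProduct.map (doubleAct act δ) (doubleAct act δ) ∘ₗ
    (TensorProduct.tensorTensorTensorComm k (Module.Dual k K) (Module.Dual k K) K K).toLinearMap ∘ₗ
    TensorProduct.mk k _ _ (TensorProduct.comm k (Module.Dual k K) (Module.Dual k K)
      (DrinfeldDouble.dualComul p))
  change _ = Λ (Coalgebra.comul (R := k) h)
  have h2 : TensorProduct.dualDistrib k K K (DrinfeldDouble.dualComul p) =
      p ∘ₗ LinearMap.mul' k K :=
    (TensorProduct.dualDistribEquiv k K K).apply_symm_apply ((LinearMap.mul' k K).dualMap p)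
  rw [doubleAct_tmul, Module.End.mul_apply, Y.act_mul, map_sweedler]
  conv_rhs => rw [← sweedler_self (Coalgebra.comul (R := k) h), map_sweedler]
  congr 1; funext a b
  refine Eq.trans ?_ (map_doubleAct_apply (DrinfeldDouble.dualComul p) a b u v).symm
  rw [Y.coactDual_mul, h2]
  rfl

/-- A braided commutative Yetter–Drinfel'd module algebra as a module algebra over the Drinfel'd
double. -/
def toDoubleModuleAlgebra : DoubleModuleAlgebra S V where
  act := doubleAct act δ
  act_one := by
    rw [DrinfeldDouble.one, doubleAct_tmul, Y.coactDual_counit, map_one, one_mul]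
  act_mul := Y.doubleAct_mul S
  act_one_right d := by
    induction d using TensorProduct.induction_on with
    | zero => simp
    | add d e hd he => simp only [map_add, LinearMap.add_apply, hd, he]
    | tmul p h =>
    have h1 : coactDual δ p 1 = algebraMap k V (p 1) := by
      change TensorProduct.rid k V (p.lTensor V (δ 1)) = _
      rw [Y.coact_one]
      simp [Algebra.algebraMap_eq_smul_one]
    rw [doubleAct_tmul, Module.End.mul_apply, Y.act_one, Algebra.algebraMap_eq_smul_one, map_smul,
      h1, ← algebraMap_smul V (Coalgebra.counit (R := k) h), smul_eq_mul, ← map_mul, mul_comm]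
    rfl
  act_mul_right := Y.doubleAct_apply_mul

theorem toDoubleModuleAlgebra_actH (h : K) : (Y.toDoubleModuleAlgebra S).actH h = act h := by
  change coactDual δ Coalgebra.counit * act h = _
  rw [Y.coactDual_counit, one_mul]

theorem toDoubleModuleAlgebra_act :
    (Y.toDoubleModuleAlgebra S).toModuleAlgebra.act = act :=
  AlgHom.ext (Y.toDoubleModuleAlgebra_actH S)

theorem toDoubleModuleAlgebra_actDual (p : Module.Dual k K) :
    (Y.toDoubleModuleAlgebra S).actDual p = coactDual δ p := by
  change coactDual δ p * act 1 = _
  rw [map_one, mul_one]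

theorem toDoubleModuleAlgebra_coaction : (Y.toDoubleModuleAlgebra S).coaction = δ := by
  ext v
  conv_rhs => rw [← sweedler_self (δ v)]
  simp only [DoubleModuleAlgebra.coaction, DoubleModuleAlgebra.target,
    toDoubleModuleAlgebra_actDual]
  simp
  rfl

/-- `sweedler` sums over the same basis that provides the dual bases in Lu's condition, so the two
forms of braided commutativity agree definitionally. -/
theorem toDoubleModuleAlgebra_isBraided : (Y.toDoubleModuleAlgebra S).IsBraidedCommutative := by
  intro u v
  simp only [toDoubleModuleAlgebra_actDual, toDoubleModuleAlgebra_actH]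
  exact Y.braided u v

end IsBraidedYetterDrinfeld

/-! ## Hopf–Galois extensions: the Miyashita–Ulbrich action -/

section Antipodes

variable (k H : Type*) [Field k] [Ring H] [HopfAlgebra k H] [Module.Finite k H]

/-- The bijective antipode of a finite-dimensional Hopf algebra. -/
def HopfAlgebra.bijectiveAntipode : BijectiveAntipode k H where
  S := LinearEquiv.ofBijective (HopfAlgebra.antipode k) (antipode_bijective k H)
  mul_antipode_rTensor_comul := HopfAlgebra.mul_antipode_rTensor_comul
  mul_antipode_lTensor_comul := HopfAlgebra.mul_antipode_lTensor_comul

end Antipodes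

/-! ### The antipode of the opposite bialgebra. -/

section OppositeAntipode

variable {k H P : Type*} [Field k] [Ring H] [Bialgebra k H] [Module.Finite k H]
  [AddCommGroup P] [Module k P]

theorem comulSum_op (h : H) (F : Hᵐᵒᵖ → Hᵐᵒᵖ → P) (hF : Bilin k F := by
      refine ⟨fun _ => ⟨fun _ _ => ?_, fun _ _ => ?_⟩, fun _ => ⟨fun _ _ => ?_, fun _ _ => ?_⟩⟩
      all_goals simp [sweedler, mul_add, add_mul, Finset.sum_add_distrib, Finset.smul_sum,
        TensorProduct.tmul_add, TensorProduct.add_tmul, ← TensorProduct.smul_tmul',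
        TensorProduct.tmul_smul]) :
    comulSum k (MulOpposite.op h) F =
      comulSum k h fun a b => F (MulOpposite.op a) (MulOpposite.op b) := by
  rw [comulSum, MulOpposite.comul_def]
  exact sweedler_map _ _ _ hF

/-- The antipode `S⁻¹` of `H^op`. -/
def BijectiveAntipode.opposite (S : BijectiveAntipode k H) : BijectiveAntipode k Hᵐᵒᵖ where
  S := (MulOpposite.opLinearEquiv k).symm ≪≫ₗ S.S.symm ≪≫ₗ MulOpposite.opLinearEquiv k
  mul_antipode_rTensor_comul := by
    ext h
    obtain ⟨h, rfl⟩ := MulOpposite.op_surjective h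
    have h1 := S.comulSum_mul_symm MulOpposite.op h
    simp only [LinearMap.comp_apply]
    conv_lhs => rw [← sweedler_self (Coalgebra.comul (R := k) (MulOpposite.op h)), map_sweedler,
      map_sweedler]
    simp only [LinearMap.rTensor_tmul, LinearMap.mul'_apply]
    refine (comulSum_op (k := k) _ _).trans (h1.trans ?_)
    simp [Algebra.algebraMap_eq_smul_one, MulOpposite.counit_def]
  mul_antipode_lTensor_comul := by
    ext h
    obtain ⟨h, rfl⟩ := MulOpposite.op_surjective h
    have h1 := S.comulSum_symm_mul MulOpposite.op h
    simp only [LinearMap.comp_apply]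
    conv_lhs => rw [← sweedler_self (Coalgebra.comul (R := k) (MulOpposite.op h)), map_sweedler,
      map_sweedler]
    simp only [LinearMap.lTensor_tmul, LinearMap.mul'_apply]
    refine (comulSum_op (k := k) _ _).trans (h1.trans ?_)
    simp [Algebra.algebraMap_eq_smul_one, MulOpposite.counit_def]

end OppositeAntipode

namespace IsHopfGalois

variable {k H A P : Type*} [Field k] [Ring H] [HopfAlgebra k H]
  [Ring A] [Algebra k A] {ρ : A →ₐ[k] A ⊗[k] H} [AddCommGroup P] [Module k P]

open TensorSquare

theorem mem_coinvariants {b : A} : b ∈ coinvariants ρ ↔ ρ b = b ⊗ₜ 1 := Iff.rfl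

theorem galoisMap_tmul (a a' : A) :
    galoisMap ρ (tmul _ a a') = (a ⊗ₜ 1) * ρ a' := rfl

theorem galoisMap_bimul (a c : A) (x : TensorSquare (coinvariants ρ)) :
    galoisMap ρ (bimul _ a c x) = (a ⊗ₜ 1) * galoisMap ρ x * ρ c := by
  induction x using TensorSquare.induction with
  | zero => simp
  | add x y hx hy => simp only [map_add, hx, hy, mul_add, add_mul]
  | tmul x y => simp [galoisMap_tmul, ← mul_assoc]

theorem sandwich_tmul {B : Subalgebra k A} (r : extCentralizer B) (a c : A) :
    sandwich B r (tmul B a c) = a * r * c := rfl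

theorem sandwich_bimul {B : Subalgebra k A} (r : extCentralizer B) (a c : A) (x : TensorSquare B) :
    sandwich B r (bimul B a c x) = a * sandwich B r x * c := by
  induction x using TensorSquare.induction with
  | zero => simp
  | add x y hx hy => simp only [map_add, hx, hy, mul_add, add_mul]
  | tmul x y => simp [sandwich_tmul, mul_assoc]

theorem sandwich_add {B : Subalgebra k A} (r r' : extCentralizer B) (x : TensorSquare B) :
    sandwich B (r + r') x = sandwich B r x + sandwich B r' x := by
  induction x using TensorSquare.induction with
  | zero => simp
  | add x y hx hy => simp only [map_add, hx, hy]; abel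
  | tmul x y => simp [sandwich_tmul, mul_add, add_mul]

theorem sandwich_smul {B : Subalgebra k A} (c : k) (r : extCentralizer B) (x : TensorSquare B) :
    sandwich B (c • r) x = c • sandwich B r x := by
  induction x using TensorSquare.induction with
  | zero => simp
  | add x y hx hy => simp only [map_add, hx, hy, smul_add]
  | tmul x y => simp [sandwich_tmul]

theorem commute_centralizer {B : Subalgebra k A} (r : extCentralizer B) {b : A} (hb : b ∈ B) :
    b * (r : A) = r * b := (Subalgebra.mem_centralizer_iff k).1 r.2 b hb

variable (hρ : IsHopfGalois ρ)

/-- The Galois map as a linear equivalence. -/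
def equiv : TensorSquare (coinvariants ρ) ≃ₗ[k] A ⊗[k] H :=
  LinearEquiv.ofBijective (galoisMap ρ) hρ.galois

theorem equiv_apply (x : TensorSquare (coinvariants ρ)) : hρ.equiv x = galoisMap ρ x := rfl

/-- The map `A ⊗ H → A` with `a a'₀ ⊗ a'₁ ↦ a r a'`. -/
def sandwichMap (r : extCentralizer (coinvariants ρ)) : A ⊗[k] H →ₗ[k] A :=
  sandwich (coinvariants ρ) r ∘ₗ hρ.equiv.symm.toLinearMap

theorem sandwichMap_galoisMap (r : extCentralizer (coinvariants ρ))
    (x : TensorSquare (coinvariants ρ)) :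
    hρ.sandwichMap r (galoisMap ρ x) = sandwich _ r x := by
  rw [sandwichMap, ← hρ.equiv_apply, LinearMap.comp_apply, LinearEquiv.coe_coe,
    LinearEquiv.symm_apply_apply]

theorem sandwichMap_mul (r : extCentralizer (coinvariants ρ)) (a c : A) (x : A ⊗[k] H) :
    hρ.sandwichMap r ((a ⊗ₜ 1) * x * ρ c) = a * hρ.sandwichMap r x * c := by
  obtain ⟨x, rfl⟩ := hρ.galois.2 x
  rw [← galoisMap_bimul, sandwichMap_galoisMap, sandwichMap_galoisMap, sandwich_bimul]

theorem sandwichMap_coact (r : extCentralizer (coinvariants ρ)) (a c : A) :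
    hρ.sandwichMap r ((c ⊗ₜ 1) * ρ a) = c * r * a := by
  rw [← galoisMap_tmul, sandwichMap_galoisMap, sandwich_tmul]

/-- The Miyashita–Ulbrich action `r ◁ h`. -/
def miyashitaUlbrich (h : H) :
    extCentralizer (coinvariants ρ) →ₗ[k] extCentralizer (coinvariants ρ) where
  toFun r := ⟨hρ.sandwichMap r (1 ⊗ₜ h), by
    refine (Subalgebra.mem_centralizer_iff k).2 fun b hb => ?_
    have h1 := hρ.sandwichMap_mul r b 1 (1 ⊗ₜ h)
    have h2 := hρ.sandwichMap_mul r 1 b (1 ⊗ₜ h)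
    rw [mul_one] at h1
    rw [one_mul, mem_coinvariants.1 hb] at h2
    rw [← h1, ← h2]
    simp⟩
  map_add' r r' := Subtype.ext (sandwich_add r r' _)
  map_smul' c r := Subtype.ext (sandwich_smul c r _)

theorem sandwichMap_one_tmul (r : extCentralizer (coinvariants ρ)) (h : H) :
    hρ.sandwichMap r (1 ⊗ₜ h) = hρ.miyashitaUlbrich h r := rfl

theorem sandwichMap_tmul (r : extCentralizer (coinvariants ρ)) (a : A) (h : H) :
    hρ.sandwichMap r (a ⊗ₜ h) = a * hρ.miyashitaUlbrich h r := by
  have h1 := hρ.sandwichMap_mul r a 1 (1 ⊗ₜ h)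
  rw [map_one, mul_one, mul_one] at h1
  simpa [← sandwichMap_one_tmul] using h1

/-- On x = (c ⊗ 1) ρ(a) the factor 1 ⊗ h commutes with c ⊗ 1, so both sides equal c (r ◁ h) a. For x
= 1 ⊗ g this gives r ◁ (h g) = (r ◁ h) ◁ g. -/
theorem sandwichMap_one_tmul_mul (r : extCentralizer (coinvariants ρ)) (h : H) (x : A ⊗[k] H) :
    hρ.sandwichMap r ((1 ⊗ₜ h) * x) = hρ.sandwichMap (hρ.miyashitaUlbrich h r) x := by
  obtain ⟨x, rfl⟩ := hρ.galois.2 x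
  induction x using TensorSquare.induction with
  | zero => simp
  | add x y hx hy => simp only [map_add, mul_add, hx, hy]
  | tmul c a =>
    rw [galoisMap_tmul, sandwichMap_coact, ← sandwichMap_one_tmul, ← sandwichMap_mul, ← mul_assoc]
    simp

theorem miyashitaUlbrich_one (r : extCentralizer (coinvariants ρ)) :
    hρ.miyashitaUlbrich 1 r = r := by
  have h := hρ.sandwichMap_coact r 1 1
  simp only [map_one, mul_one, one_mul, ← Algebra.TensorProduct.one_def] at h
  exact Subtype.ext h

theorem miyashitaUlbrich_mul (h g : H) (r : extCentralizer (coinvariants ρ)) :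
    hρ.miyashitaUlbrich (h * g) r = hρ.miyashitaUlbrich g (hρ.miyashitaUlbrich h r) := by
  have h1 := hρ.sandwichMap_one_tmul_mul r h (1 ⊗ₜ g)
  rw [Algebra.TensorProduct.tmul_mul_tmul, one_mul] at h1
  exact Subtype.ext h1

/-- The Miyashita–Ulbrich action, as a linear map on `H^op`. -/
def actLinear : Hᵐᵒᵖ →ₗ[k] Module.End k (extCentralizer (coinvariants ρ)) where
  toFun h := hρ.miyashitaUlbrich h.unop
  map_add' g h := LinearMap.ext fun r => Subtype.ext <|
    (congrArg (hρ.sandwichMap r) (TensorProduct.tmul_add (1 : A) g.unop h.unop)).trans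
      (map_add _ _ _)
  map_smul' c h := LinearMap.ext fun r => Subtype.ext <|
    (congrArg (hρ.sandwichMap r) (TensorProduct.tmul_smul c (1 : A) h.unop)).trans
      (map_smul _ _ _)

theorem actLinear_mul (g h : Hᵐᵒᵖ) :
    hρ.actLinear (g * h) = hρ.actLinear g * hρ.actLinear h :=
  LinearMap.ext fun r => hρ.miyashitaUlbrich_mul h.unop g.unop r

theorem actLinear_one : hρ.actLinear 1 = 1 := LinearMap.ext fun r => hρ.miyashitaUlbrich_one r

/-- The Miyashita–Ulbrich action, as a left action of `H^op`. -/
def act : Hᵐᵒᵖ →ₐ[k] Module.End k (extCentralizer (coinvariants ρ)) :=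
  AlgHom.ofLinearMap hρ.actLinear hρ.actLinear_one hρ.actLinear_mul

theorem act_op (h : H) (r : extCentralizer (coinvariants ρ)) :
    hρ.miyashitaUlbrich h r = hρ.act (MulOpposite.op h) r := rfl

/-! ### The module algebra axioms for the Miyashita–Ulbrich action. -/

section Finite

variable [Module.Finite k H]

theorem sweedler_tmul_one_mul {F : A → H → P} (c : A) (x : A ⊗[k] H) (hF : Bilin k F := by
      refine ⟨fun _ => ⟨fun _ _ => ?_, fun _ _ => ?_⟩, fun _ => ⟨fun _ _ => ?_, fun _ _ => ?_⟩⟩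
      all_goals simp [sweedler, mul_add, add_mul, Finset.sum_add_distrib, Finset.smul_sum,
        TensorProduct.tmul_add, TensorProduct.add_tmul, ← TensorProduct.smul_tmul',
        TensorProduct.tmul_smul]) :
    sweedler ((c ⊗ₜ 1) * x) F = sweedler x fun a h => F (c * a) h := by
  obtain ⟨f, rfl⟩ := hF.exists_eq
  rw [sweedler_bundled]
  conv_lhs => rw [← sweedler_self x, mul_sweedler, map_sweedler]
  simp

include hρ in
/-- Bilinear maps on `A × H` which agree on all `c a₀ ⊗ a₁` are equal. -/
theorem bilinear_ext {F G : A → H → P} (hF : Bilin k F) (hG : Bilin k G)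
    (h : ∀ c a, (sweedler (ρ a) fun x h => F (c * x) h) = sweedler (ρ a) fun x h => G (c * x) h)
    (a : A) (g : H) : F a g = G a g := by
  have h1 : ∀ c a, sweedler ((c ⊗ₜ 1) * ρ a) F = sweedler ((c ⊗ₜ 1) * ρ a) G := fun c a => by
    rw [sweedler_tmul_one_mul c _ hF, sweedler_tmul_one_mul c _ hG, h]
  rw [← sweedler_tmul a g hF, ← sweedler_tmul a g hG]
  obtain ⟨x, hx⟩ := hρ.galois.2 (a ⊗ₜ[k] g)
  rw [← hx]
  obtain ⟨f, rfl⟩ := hF.exists_eq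
  obtain ⟨f', rfl⟩ := hG.exists_eq
  simp only [sweedler_bundled] at h1 ⊢
  clear hx
  induction x using TensorSquare.induction with
  | zero => simp
  | add x y hx hy => simp only [map_add, hx, hy]
  | tmul x y => exact h1 x y

include hρ in
theorem coact_coassoc (F : A → H → H → P) (a : A) (hF : Trilin k F := by
      refine ⟨fun _ _ => ⟨fun _ _ => ?_, fun _ _ => ?_⟩, fun _ _ => ⟨fun _ _ => ?_, fun _ _ => ?_⟩,
        fun _ _ => ⟨fun _ _ => ?_, fun _ _ => ?_⟩⟩
      all_goals simp [sweedler, mul_add, add_mul, Finset.sum_add_distrib, Finset.smul_sum,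
        TensorProduct.tmul_add, TensorProduct.add_tmul, ← TensorProduct.smul_tmul',
        TensorProduct.tmul_smul]) :
    (sweedler (ρ a) fun w c => sweedler (ρ w) fun u h => F u h c) =
      sweedler (ρ a) fun u c => comulSum k c fun g h => F u g h :=
  sweedler_coassoc ρ.toLinearMap hρ.coassoc F a hF

include hρ in
theorem coact_counit (f : A →ₗ[k] P) (a : A) :
    (sweedler (ρ a) fun w c => Coalgebra.counit (R := k) c • f w) = f a := by
  have H := congrArg (f ∘ₗ TensorProduct.rid k A) (hρ.counit a)
  conv_lhs at H => rw [← sweedler_self (ρ a)]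
  simpa [map_sweedler] using H

/-- `a₀ (r ◁ a₁) = r a`. -/
theorem coact_miyashitaUlbrich (r : extCentralizer (coinvariants ρ)) (c a : A) :
    (sweedler (ρ a) fun x h => c * x * (hρ.miyashitaUlbrich h r : A)) = c * r * a := by
  rw [← hρ.sandwichMap_coact]
  conv_rhs => rw [← sweedler_self (ρ a), mul_sweedler, map_sweedler]
  simp [sandwichMap_tmul]

theorem coact_act_op (r : extCentralizer (coinvariants ρ)) (c a : A) :
    (sweedler (ρ a) fun x h => c * x * (hρ.act (MulOpposite.op h) r : A)) = c * r * a :=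
  hρ.coact_miyashitaUlbrich r c a

theorem act_one_right (h : H) : hρ.act (MulOpposite.op h) 1 =
    algebraMap k (extCentralizer (coinvariants ρ)) (Coalgebra.counit h) := by
  have := hρ.bilinear_ext (P := A) (F := fun a h => a * (hρ.act (MulOpposite.op h) 1 : A))
    (G := fun a h => Coalgebra.counit (R := k) h • a) ?_ ?_ ?_ 1 h
  · refine Subtype.ext ?_
    rw [one_mul] at this
    rw [this, Algebra.algebraMap_eq_smul_one]
    rfl
  · refine ⟨fun _ => ⟨fun _ _ => ?_, fun _ _ => ?_⟩, fun _ => ⟨fun _ _ => ?_, fun _ _ => ?_⟩⟩ <;>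
      simp [mul_add, add_mul]
  · exact ⟨fun _ => ⟨smul_add _, fun _ _ => smul_comm _ _ _⟩,
      fun _ => ⟨fun _ _ => by simp [add_smul], fun _ _ => by simp [mul_smul]⟩⟩
  · intro c a
    rw [coact_act_op]
    refine Eq.trans ?_ (hρ.coact_counit (LinearMap.mulLeft k c) a).symm
    simp

/-- Tested on c a₀ ⊗ a₁: a₀ (r ◁ a₁)(r' ◁ a₂) = r a₀ (r' ◁ a₁) = r r' a. -/
theorem act_mul_right (h : H) (r r' : extCentralizer (coinvariants ρ)) :
    hρ.act (MulOpposite.op h) (r * r') = comulSum k h fun a b =>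
      hρ.act (MulOpposite.op a) r * hρ.act (MulOpposite.op b) r' := by
  have := hρ.bilinear_ext (P := A)
    (F := fun a h => a * (hρ.act (MulOpposite.op h) (r * r') : A))
    (G := fun a h => comulSum k h fun p q =>
      a * hρ.act (MulOpposite.op p) r * hρ.act (MulOpposite.op q) r') ?_ ?_ ?_ 1 h
  · refine Subtype.ext ?_
    rw [one_mul] at this
    rw [this]
    simp only [comulSum, one_mul]
    exact (map_sweedler (extCentralizer (coinvariants ρ)).val (Coalgebra.comul (R := k) h)
      fun a b =>
      hρ.act (MulOpposite.op a) r * hρ.act (MulOpposite.op b) r').symm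
  · refine ⟨fun _ => ⟨fun _ _ => ?_, fun _ _ => ?_⟩, fun _ => ⟨fun _ _ => ?_, fun _ _ => ?_⟩⟩ <;>
      simp [mul_add, add_mul]
  · refine ⟨fun _ => ⟨fun _ _ => ?_, fun _ _ => ?_⟩, fun _ => ⟨fun _ _ => ?_, fun _ _ => ?_⟩⟩ <;>
      simp [sweedler, mul_add, add_mul, Finset.sum_add_distrib, Finset.smul_sum]
  · intro c a
    rw [coact_act_op]
    refine Eq.trans ?_ (hρ.coact_coassoc (fun x p q => c * x * (hρ.act (MulOpposite.op p) r : A) *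
      (hρ.act (MulOpposite.op q) r' : A)) a)
    simp only [← sweedler_mul_right, coact_act_op]
    simp [mul_assoc]

end Finite

end IsHopfGalois

/-! ## The coaction on the centralizer -/

namespace IsHopfGalois

variable {k H A P : Type*} [Field k] [Ring H] [HopfAlgebra k H]
  [Ring A] [Algebra k A] {ρ : A →ₐ[k] A ⊗[k] H} [AddCommGroup P] [Module k P]
  [Module.Finite k H]

open TensorSquare

variable (ρ) in
/-- The elements of `A ⊗ H` commuting with all `b ⊗ 1` for `b` in `B`. -/
def tensorCentralizer : Submodule k (A ⊗[k] H) where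
  carrier := {x | ∀ b ∈ coinvariants ρ, (b ⊗ₜ[k] (1 : H)) * x = x * b ⊗ₜ[k] (1 : H)}
  zero_mem' := by simp
  add_mem' := fun {x y} hx hy b hb => by rw [mul_add, add_mul, hx b hb, hy b hb]
  smul_mem' := fun c x hx b hb => by rw [mul_smul_comm, smul_mul_assoc, hx b hb]

theorem centralizerInclusion_tmul (r : extCentralizer (coinvariants ρ)) (h : Hᵐᵒᵖ) :
    centralizerInclusion ρ (r ⊗ₜ h) = (r : A) ⊗ₜ h.unop := rfl

theorem centralizerInclusion_mem (x : extCentralizer (coinvariants ρ) ⊗[k] Hᵐᵒᵖ) :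
    centralizerInclusion ρ x ∈ tensorCentralizer ρ := by
  induction x with
  | zero => simp
  | add x y hx hy => rw [map_add]; exact add_mem hx hy
  | tmul r h =>
    intro b hb
    simp [centralizerInclusion_tmul, commute_centralizer r hb]

theorem centralizerInclusion_injective : Function.Injective (centralizerInclusion ρ) :=
  TensorProduct.map_injective_of_flat_flat _ _ Subtype.val_injective
    (MulOpposite.opLinearEquiv k).symm.injective

variable (k H A) in
/-- The coordinates of an element of `A ⊗ H` with respect to a basis of `H`. -/
def coordMap (i : Fin (Module.finrank k H)) : A ⊗[k] H →ₗ[k] A :=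
  (TensorProduct.rid k A).toLinearMap ∘ₗ ((Module.finBasis k H).coord i).lTensor A

theorem coordMap_mul_left (i : Fin (Module.finrank k H)) (a : A) (x : A ⊗[k] H) :
    coordMap k H A i ((a ⊗ₜ 1) * x) = a * coordMap k H A i x := by
  induction x with
  | zero => simp
  | add x y hx hy => simp only [map_add, mul_add, hx, hy]
  | tmul u h => simp [coordMap]

theorem coordMap_mul_right (i : Fin (Module.finrank k H)) (a : A) (x : A ⊗[k] H) :
    coordMap k H A i (x * (a ⊗ₜ 1)) = coordMap k H A i x * a := by
  induction x with
  | zero => simp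
  | add x y hx hy => simp only [map_add, add_mul, hx, hy]
  | tmul u h => simp [coordMap]

theorem sum_coordMap (x : A ⊗[k] H) (F : A → H → P) :
    sweedler x F = ∑ i, F (coordMap k H A i x) (Module.finBasis k H i) := rfl

/-- Taking coordinates with respect to a basis of H is A-bilinear, so an element commuting with B ⊗
1 has all its coordinates in R. -/
theorem exists_centralizerInclusion {x : A ⊗[k] H} (hx : x ∈ tensorCentralizer ρ) :
    ∃ y, centralizerInclusion ρ y = x := by
  have h3 : ∀ i, coordMap k H A i x ∈ extCentralizer (coinvariants ρ) := fun i =>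
    (Subalgebra.mem_centralizer_iff k).2 fun b hb => by
      rw [← coordMap_mul_left, ← coordMap_mul_right, hx b hb]
  refine ⟨∑ i, (⟨coordMap k H A i x, h3 i⟩ : extCentralizer (coinvariants ρ)) ⊗ₜ
    MulOpposite.op (Module.finBasis k H i), ?_⟩
  rw [map_sum]
  exact sweedler_self x

variable (ρ) in
/-- The identification of `R ⊗ H^op` with the centralizer of `B ⊗ 1` in `A ⊗ H`. -/
def centralizerEquiv : extCentralizer (coinvariants ρ) ⊗[k] Hᵐᵒᵖ ≃ₗ[k] tensorCentralizer ρ :=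
  LinearEquiv.ofBijective ((centralizerInclusion ρ).codRestrict _ centralizerInclusion_mem)
    ⟨fun _ _ h => centralizerInclusion_injective (congrArg Subtype.val h),
      fun x => (exists_centralizerInclusion x.2).imp fun _ h => Subtype.ext h⟩

theorem centralizerInclusion_symm (x : tensorCentralizer ρ) :
    centralizerInclusion ρ ((centralizerEquiv ρ).symm x) = x :=
  congrArg Subtype.val ((centralizerEquiv ρ).apply_symm_apply x)

/-- Apply ρ to b r = r b and use ρ(b) = b ⊗ 1. -/
theorem coaction_mem (r : extCentralizer (coinvariants ρ)) : ρ r ∈ tensorCentralizer ρ := by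
  intro b hb
  rw [← mem_coinvariants.1 hb, ← map_mul, ← map_mul, commute_centralizer r hb]

variable (ρ) in
/-- The coaction of `H^op` on the centralizer of the coinvariants. -/
def coact : extCentralizer (coinvariants ρ) →ₗ[k] extCentralizer (coinvariants ρ) ⊗[k] Hᵐᵒᵖ :=
  (centralizerEquiv ρ).symm.toLinearMap ∘ₗ
    (ρ.toLinearMap ∘ₗ (extCentralizer (coinvariants ρ)).val.toLinearMap).codRestrict _ coaction_mem

theorem centralizerInclusion_coact (r : extCentralizer (coinvariants ρ)) :
    centralizerInclusion ρ (coact ρ r) = ρ r := centralizerInclusion_symm _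

theorem coaction_eq (r : extCentralizer (coinvariants ρ)) :
    ρ r = sweedler (coact ρ r) fun w c => (w : A) ⊗ₜ[k] c.unop := by
  rw [← centralizerInclusion_coact]
  conv_lhs => rw [← sweedler_self (coact ρ r), map_sweedler]
  rfl

theorem sweedler_centralizerInclusion {F : A → H → P}
    (x : extCentralizer (coinvariants ρ) ⊗[k] Hᵐᵒᵖ) (hF : Bilin k F := by
      refine ⟨fun _ => ⟨fun _ _ => ?_, fun _ _ => ?_⟩, fun _ => ⟨fun _ _ => ?_, fun _ _ => ?_⟩⟩
      all_goals simp [sweedler, mul_add, add_mul, Finset.sum_add_distrib, Finset.smul_sum,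
        TensorProduct.tmul_add, TensorProduct.add_tmul, ← TensorProduct.smul_tmul',
        TensorProduct.tmul_smul]) :
    sweedler (centralizerInclusion ρ x) F = sweedler x fun w c => F w c.unop :=
  sweedler_map _ _ _ hF

variable (hρ : IsHopfGalois ρ)

/-- The Yetter–Drinfel'd condition for the Miyashita–Ulbrich action and the coaction. -/
theorem coaction_act (h : H) (r : extCentralizer (coinvariants ρ)) :
    (comulSum k h fun p q => ((1 : A) ⊗ₜ[k] p) * ρ (hρ.act (MulOpposite.op q) r)) =
      comulSum k h fun p q => sweedler (coact ρ r) fun w c =>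
        (hρ.act (MulOpposite.op p) w : A) ⊗ₜ[k] (c.unop * q) := by
  have := hρ.bilinear_ext
    (F := fun a h => comulSum k h fun p q => (a ⊗ₜ[k] p) * ρ (hρ.act (MulOpposite.op q) r))
    (G := fun a h => comulSum k h fun p q => sweedler (coact ρ r) fun w c =>
        (a * hρ.act (MulOpposite.op p) w : A) ⊗ₜ[k] (c.unop * q)) ?_ ?_ ?_ 1 h
  · simpa using this
  · refine ⟨fun _ => ⟨fun _ _ => ?_, fun _ _ => ?_⟩, fun _ => ⟨fun _ _ => ?_, fun _ _ => ?_⟩⟩ <;>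
      simp [sweedler, mul_add, add_mul, Finset.sum_add_distrib, Finset.smul_sum,
        TensorProduct.tmul_add, TensorProduct.add_tmul, ← TensorProduct.smul_tmul']
  · refine ⟨fun _ => ⟨fun _ _ => ?_, fun _ _ => ?_⟩, fun _ => ⟨fun _ _ => ?_, fun _ _ => ?_⟩⟩ <;>
      simp [sweedler, mul_add, add_mul, Finset.sum_add_distrib, Finset.smul_sum,
        TensorProduct.tmul_add, TensorProduct.add_tmul, ← TensorProduct.smul_tmul']
  -- On c a₀ ⊗ a₁ the left side is (c ⊗ 1) ρ(a₀ (r ◁ a₁)) = (c ⊗ 1) ρ(r) ρ(a), as ρ is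
  -- multiplicative. The right side is c a₀ (r₀ ◁ a₁) ⊗ r₁ a₂ = c r₀ a₀ ⊗ r₁ a₁, which is the same
  -- element.
  · intro c a
    have h1 := hρ.coact_coassoc (fun x p q => ((c * x) ⊗ₜ[k] p) *
      ρ (hρ.act (MulOpposite.op q) r)) a
    have h2 := hρ.coact_coassoc (fun x p q => sweedler (coact ρ r) fun w e =>
        (c * x * hρ.act (MulOpposite.op p) w : A) ⊗ₜ[k] (e.unop * q)) a
    refine h1.symm.trans (Eq.trans ?_ h2)
    have h3 : ∀ x : A, (sweedler (ρ x) fun y p => (c * y) ⊗ₜ[k] p) = (c ⊗ₜ 1) * ρ x := by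
      intro x
      conv_rhs => rw [← sweedler_self (ρ x), mul_sweedler]
      simp
    have h4 : ∀ (x : A) (q : H), (sweedler (ρ x) fun y p => sweedler (coact ρ r) fun w e =>
        (c * y * hρ.act (MulOpposite.op p) w : A) ⊗ₜ[k] (e.unop * q)) =
        sweedler (coact ρ r) fun w e => (c * w * x) ⊗ₜ[k] (e.unop * q) := by
      intro x q
      rw [sweedler_comm]
      simp only [← sweedler_tmul_right, coact_act_op]
    simp only [← sweedler_mul_right, h3, h4]
    simp only [mul_assoc, ← mul_sweedler]
    have h5 := congrArg ρ (hρ.coact_act_op r 1 a)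
    simp only [one_mul, map_sweedler, map_mul] at h5
    rw [h5, coaction_eq r]
    conv_lhs => rw [← sweedler_self (ρ a), sweedler_mul_right, mul_sweedler]
    simp only [mul_sweedler]
    rw [sweedler_comm]
    simp

end IsHopfGalois

theorem map_assoc_rTensor {k M N M' N' : Type*} [CommRing k] [AddCommGroup M] [Module k M]
    [AddCommGroup N] [Module k N] [AddCommGroup M'] [Module k M'] [AddCommGroup N'] [Module k N']
    (δ : M →ₗ[k] M ⊗[k] N) (δ' : M' →ₗ[k] M' ⊗[k] N') (f : M →ₗ[k] M') (e : N →ₗ[k] N')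
    (h : ∀ m, TensorProduct.map f e (δ m) = δ' (f m)) (x : M ⊗[k] N) :
    TensorProduct.map f (TensorProduct.map e e) (TensorProduct.assoc k M N N (δ.rTensor N x)) =
      TensorProduct.assoc k M' N' N' (δ'.rTensor N' (TensorProduct.map f e x)) := by
  induction x with
  | zero => simp
  | add x y hx hy => simp only [map_add, hx, hy]
  | tmul m n =>
    rw [TensorProduct.map_tmul, LinearMap.rTensor_tmul, LinearMap.rTensor_tmul, ← h]
    generalize δ m = y
    induction y with
    | zero => simp
    | add x y hx hy => simp only [map_add, TensorProduct.add_tmul, hx, hy]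
    | tmul r g => rfl

namespace IsHopfGalois

variable {k H A P : Type*} [Field k] [Ring H] [HopfAlgebra k H]
  [Ring A] [Algebra k A] {ρ : A →ₐ[k] A ⊗[k] H} [AddCommGroup P] [Module k P]
  [Module.Finite k H]

open TensorSquare

variable (hρ : IsHopfGalois ρ)

-- R ⊗ H^op ⊗ H^op embeds into A ⊗ H ⊗ H by flatness over the field k, so coassociativity is
-- inherited from ρ.
include hρ in
theorem coact_assoc (r : extCentralizer (coinvariants ρ)) :
    TensorProduct.assoc k _ Hᵐᵒᵖ Hᵐᵒᵖ ((coact ρ).rTensor Hᵐᵒᵖ (coact ρ r)) =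
      Coalgebra.comul.lTensor _ (coact ρ r) := by
  let e : Hᵐᵒᵖ →ₗ[k] H := (MulOpposite.opLinearEquiv k).symm.toLinearMap
  have he : Function.Injective e := (MulOpposite.opLinearEquiv k).symm.injective
  let J := TensorProduct.map (extCentralizer (coinvariants ρ)).val.toLinearMap
    (TensorProduct.map e e)
  have hJ : Function.Injective J := TensorProduct.map_injective_of_flat_flat _ _
    Subtype.val_injective (TensorProduct.map_injective_of_flat_flat _ _ he he)
  have h2 : ∀ x, J (TensorProduct.assoc k _ Hᵐᵒᵖ Hᵐᵒᵖ ((coact ρ).rTensor Hᵐᵒᵖ x)) =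
      TensorProduct.assoc k A H H (ρ.toLinearMap.rTensor H (centralizerInclusion ρ x)) :=
    map_assoc_rTensor _ _ _ _ centralizerInclusion_coact
  have h3 : ∀ x, J (Coalgebra.comul.lTensor _ x) =
      Coalgebra.comul.lTensor A (centralizerInclusion ρ x) := by
    intro x
    induction x with
    | zero => simp
    | add x y hx hy => simp only [map_add, hx, hy]
    | tmul r h =>
      have : TensorProduct.map e e (Coalgebra.comul h) = Coalgebra.comul (R := k) h.unop := by
        conv_lhs => rw [← sweedler_self (Coalgebra.comul (R := k) h), map_sweedler]
        refine (comulSum_op h.unop fun a b => e a ⊗ₜ[k] e b).trans ?_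
        exact sweedler_self _
      simp [J, centralizerInclusion_tmul, this]
  apply hJ
  rw [h2, h3, centralizerInclusion_coact]
  exact hρ.coassoc r

include hρ in
theorem counit_coact (r : extCentralizer (coinvariants ρ)) :
    Coalgebra.counit.lTensor _ (coact ρ r) = r ⊗ₜ[k] (1 : k) := by
  have hJ : Function.Injective ((extCentralizer (coinvariants ρ)).val.toLinearMap.rTensor k) :=
    Module.Flat.rTensor_preserves_injective_linearMap _ Subtype.val_injective
  have h3 : ∀ x, (extCentralizer (coinvariants ρ)).val.toLinearMap.rTensor k
      (Coalgebra.counit.lTensor _ x) = Coalgebra.counit.lTensor A (centralizerInclusion ρ x) := by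
    intro x
    induction x with
    | zero => simp
    | add x y hx hy => simp only [map_add, hx, hy]
    | tmul r h => rfl
  apply hJ
  rw [h3, centralizerInclusion_coact]
  exact hρ.counit r

/-- The centralizer of the coinvariants is a braided commutative Yetter–Drinfel'd module algebra
over `H^op`. -/
theorem isBraidedYetterDrinfeld : IsBraidedYetterDrinfeld hρ.act (coact ρ) where
  act_one h := hρ.act_one_right h.unop
  act_mul h u v := (hρ.act_mul_right h.unop u v).trans
    (comulSum_op h.unop fun a b => hρ.act a u * hρ.act b v).symm
  coassoc := hρ.coact_assoc
  counit := hρ.counit_coact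
  coact_one := by
    apply centralizerInclusion_injective
    rw [centralizerInclusion_coact, OneMemClass.coe_one, map_one]
    rfl
  coact_mul u v := by
    apply centralizerInclusion_injective
    rw [centralizerInclusion_coact, Subalgebra.coe_mul, map_mul, coaction_eq u, coaction_eq v]
    simp only [map_sweedler, sweedler_mul_right, mul_sweedler]
    rw [sweedler_comm]
    simp [centralizerInclusion_tmul]
  coact_act h v := by
    obtain ⟨h, rfl⟩ := MulOpposite.op_surjective h
    apply centralizerInclusion_injective
    refine Eq.trans (congrArg _ (comulSum_op h fun a b => sweedler (coact ρ (hρ.act b v))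
      fun w c => w ⊗ₜ[k] (c * a))) (Eq.trans ?_ (congrArg _ (comulSum_op h fun a b =>
      sweedler (coact ρ v) fun w c => hρ.act a w ⊗ₜ[k] (b * c))).symm)
    have h1 := hρ.coaction_act h v
    simp only [coaction_eq, mul_sweedler] at h1
    simpa [map_sweedler, centralizerInclusion_tmul] using h1
  -- This is a₀ (v ◁ a₁) = v a for a = u.
  braided u v := by
    apply Subtype.ext
    have h1 := hρ.coact_act_op v 1 u
    simp only [one_mul] at h1
    rw [← centralizerInclusion_coact, sweedler_centralizerInclusion] at h1
    exact (map_sweedler (extCentralizer (coinvariants ρ)).val (coact ρ u)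
      fun w c => w * hρ.act c v).trans h1

/-! ### Depth two -/

-- β is injective and turns left and right multiplication by b into multiplication by b ⊗ 1, because
-- ρ(b) = b ⊗ 1.
include hρ in
theorem mem_centralSquare_iff {t : TensorSquare (coinvariants ρ)} :
    t ∈ centralSquare (coinvariants ρ) ↔ galoisMap ρ t ∈ tensorCentralizer ρ := by
  refine forall₂_congr fun b hb => ?_
  rw [← hρ.galois.1.eq_iff, galoisMap_bimul, galoisMap_bimul, mem_coinvariants.1 hb, map_one,
    mul_one, ← Algebra.TensorProduct.one_def, one_mul]

/-- The element `β⁻¹(1 ⊗ h)` of `T`. -/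
def translation (h : H) : centralSquare (coinvariants ρ) :=
  ⟨hρ.equiv.symm (1 ⊗ₜ h), hρ.mem_centralSquare_iff.2 (by
    rw [← hρ.equiv_apply, LinearEquiv.apply_symm_apply]
    intro b _
    simp)⟩

theorem galoisMap_translation (h : H) :
    galoisMap ρ (hρ.translation h : TensorSquare (coinvariants ρ)) = 1 ⊗ₜ h :=
  hρ.equiv.apply_symm_apply _

variable (ρ) in
/-- The coordinates of the coaction. -/
def coactCoord (i : Fin (Module.finrank k H)) : bimoduleEnd (coinvariants ρ) :=
  ⟨coordMap k H A i ∘ₗ ρ.toLinearMap, fun b hb a => by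
    simp only [LinearMap.comp_apply, AlgHom.toLinearMap_apply, map_mul, mem_coinvariants.1 hb,
      coordMap_mul_left, coordMap_mul_right, and_self]⟩

theorem coactCoord_apply (i : Fin (Module.finrank k H)) (a : A) :
    (coactCoord ρ i).1 a = coordMap k H A i (ρ a) := rfl

/-- The right quasibasis of a Hopf–Galois extension. -/
def rightQuasibasis : RightD2Quasibasis (coinvariants ρ) where
  n := Module.finrank k H
  u i := hρ.translation (Module.finBasis k H i)
  γ := coactCoord ρ
  eq a a' := by
    apply hρ.galois.1
    -- Under β the claim says that (a ⊗ 1) ρ(a') is expanded in the basis of H.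
    simp only [map_sum, galoisMap_bimul, galoisMap_translation, coactCoord_apply, galoisMap_tmul]
    conv_lhs => rw [← sweedler_self (ρ a'), mul_sweedler]
    rw [sum_coordMap]
    simp

-- The left side is a₀ ⊗ S⁻¹(a₂) a₁. This recovers a ⊗ 1 from the coordinates of ρ(a) by left
-- multiplications by elements 1 ⊗ g, which is what a left quasibasis requires.
include hρ in
theorem antipode_symm_mul_coaction (a : A) : (sweedler (ρ a) fun x h =>
    ((1 : A) ⊗ₜ[k] (HopfAlgebra.bijectiveAntipode k H).S.symm h) * ρ x) = a ⊗ₜ[k] (1 : H) := by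
  have h1 := hρ.coact_coassoc (fun x p q => x ⊗ₜ[k]
    ((HopfAlgebra.bijectiveAntipode k H).S.symm q * p)) a
  have h2 : ∀ (x : A) (h : H), (comulSum k h fun p q => x ⊗ₜ[k]
      ((HopfAlgebra.bijectiveAntipode k H).S.symm q * p)) = Coalgebra.counit (R := k) h • x ⊗ₜ 1 :=
    fun x h => (HopfAlgebra.bijectiveAntipode k H).comulSum_symm_mul (fun g => x ⊗ₜ[k] g) h
  simp only [h2] at h1
  refine Eq.trans ?_ (h1.trans (hρ.coact_counit ((TensorProduct.mk k A H).flip 1) a))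
  congr 1
  funext x h
  conv_lhs => rw [← sweedler_self (ρ x), mul_sweedler]
  simp

/-- The left quasibasis of a Hopf–Galois extension. -/
def leftQuasibasis : LeftD2Quasibasis (coinvariants ρ) where
  n := Module.finrank k H
  t i := hρ.translation ((HopfAlgebra.bijectiveAntipode k H).S.symm (Module.finBasis k H i))
  β := coactCoord ρ
  eq a a' := by
    apply hρ.galois.1
    simp only [map_sum, galoisMap_bimul, galoisMap_translation, coactCoord_apply, galoisMap_tmul]
    rw [← hρ.antipode_symm_mul_coaction a, sweedler_mul_right, sum_coordMap]
    simp [← mul_assoc, ← Algebra.TensorProduct.one_def]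

end IsHopfGalois

/-! ## Transport of Hopf algebroid structures along isomorphisms -/

namespace LeftBialgebroidData

namespace IsHom

variable {k R L L' : Type*} [CommRing k] [Ring R] [Algebra k R] [Ring L] [Algebra k L]
  [Ring L'] [Algebra k L'] {D : LeftBialgebroidData k R L} {D' : LeftBialgebroidData k R L'}

section Hom

variable {F : L →ₐ[k] L'} (hF : IsHom D D' F (AlgHom.id k R))

include hF in
theorem map_relations : bimoduleRelations D.source D.target ≤
    (bimoduleRelations D'.source D'.target).comap
      (TensorProduct.map F.toLinearMap F.toLinearMap) := by
  refine Submodule.span_le.2 ?_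
  rintro _ ⟨r, a, b, rfl⟩
  refine Submodule.subset_span ⟨r, F a, F b, ?_⟩
  simp [hF.map_source, hF.map_target]

include hF in
theorem map_relations₃ : bimoduleRelations₃ D.source D.target ≤
    (bimoduleRelations₃ D'.source D'.target).comap (TensorProduct.map F.toLinearMap
      (TensorProduct.map F.toLinearMap F.toLinearMap)) := by
  refine Submodule.span_le.2 ?_
  rintro _ (⟨r, a, b, c, rfl⟩ | ⟨r, a, b, c, rfl⟩)
  · refine Submodule.subset_span (Or.inl ⟨r, F a, F b, F c, ?_⟩)
    simp [hF.map_source, hF.map_target]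
  · refine Submodule.subset_span (Or.inr ⟨r, F a, F b, F c, ?_⟩)
    simp [hF.map_source, hF.map_target]

/-- The map `L ⊗_R L → L' ⊗_R L'`. -/
def tensorMap : BimoduleTensor D.source D.target →ₗ[k] BimoduleTensor D'.source D'.target :=
  Submodule.mapQ _ _ _ hF.map_relations

/-- The map `L ⊗_R L ⊗_R L → L' ⊗_R L' ⊗_R L'`. -/
def tensorMap₃ : BimoduleTensor₃ D.source D.target →ₗ[k] BimoduleTensor₃ D'.source D'.target :=
  Submodule.mapQ _ _ _ hF.map_relations₃

theorem tensorMap_proj (x : L ⊗[k] L) : hF.tensorMap (D.proj x) =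
    D'.proj (TensorProduct.map F.toLinearMap F.toLinearMap x) := rfl

theorem tensorMap₃_mkQ (x : L ⊗[k] (L ⊗[k] L)) :
    hF.tensorMap₃ ((bimoduleRelations₃ D.source D.target).mkQ x) =
    (bimoduleRelations₃ D'.source D'.target).mkQ (TensorProduct.map F.toLinearMap
      (TensorProduct.map F.toLinearMap F.toLinearMap) x) := rfl

theorem tensorMap_comul (a : L) : hF.tensorMap (D.comul a) = D'.comul (F a) := by
  obtain ⟨x, hx⟩ := D.proj_surjective (D.comul a)
  rw [← hx, tensorMap_proj, hF.map_comul a x hx]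

theorem tensorMap₃_comulLeft (x : L ⊗[k] L) : hF.tensorMap₃ (D.comulLeft x) =
    D'.comulLeft (TensorProduct.map F.toLinearMap F.toLinearMap x) := by
  induction x with
  | zero => simp
  | add x y hx hy => simp only [map_add, hx, hy]
  | tmul a b =>
    obtain ⟨x, hx⟩ := D.proj_surjective (D.comul a)
    rw [TensorProduct.map_tmul, comulLeft_tmul, comulLeft_tmul, ← hx, AlgHom.toLinearMap_apply,
      ← hF.tensorMap_comul, ← hx, tensorMap_proj, joinRight_proj, joinRight_proj]
    rw [tensorMap₃_mkQ]
    congr 1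
    clear hx
    induction x with
    | zero => simp
    | add x y hx hy => simp only [map_add, TensorProduct.add_tmul, hx, hy]
    | tmul a b => rfl

theorem tensorMap₃_comulRight (x : L ⊗[k] L) : hF.tensorMap₃ (D.comulRight x) =
    D'.comulRight (TensorProduct.map F.toLinearMap F.toLinearMap x) := by
  induction x with
  | zero => simp
  | add x y hx hy => simp only [map_add, hx, hy]
  | tmul a b =>
    obtain ⟨x, hx⟩ := D.proj_surjective (D.comul b)
    rw [TensorProduct.map_tmul, comulRight_tmul, comulRight_tmul, ← hx, AlgHom.toLinearMap_apply,
      AlgHom.toLinearMap_apply, ← hF.tensorMap_comul, ← hx, tensorMap_proj, joinLeft_proj,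
      joinLeft_proj]
    rfl

end Hom

variable {e : L ≃ₐ[k] L'} (he : IsHom D D' (e : L →ₐ[k] L') (AlgHom.id k R))

theorem map_symm_map (x : L ⊗[k] L) : TensorProduct.map (e.symm : L' →ₐ[k] L).toLinearMap
    (e.symm : L' →ₐ[k] L).toLinearMap (TensorProduct.map (e : L →ₐ[k] L').toLinearMap
    (e : L →ₐ[k] L').toLinearMap x) = x := by
  induction x with
  | zero => simp
  | add x y hx hy => simp only [map_add, hx, hy]
  | tmul a b => simp

-- Only the coproduct needs care, since an arbitrary representative of the coproduct in L' must be
-- compared with the image of one from L; the inverse images of the relations in L' hold in L ⊗_R L.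
include he in
theorem symm : IsHom D' D (e.symm : L' →ₐ[k] L) (AlgHom.id k R) where
  map_source r := e.injective (by simpa using (he.map_source r).symm)
  map_target r := e.injective (by simpa using (he.map_target r).symm)
  map_comul a x hx := by
    obtain ⟨y, hy⟩ := D.proj_surjective (D.comul (e.symm a))
    have h1 := he.map_comul _ y hy
    simp only [AlgEquiv.coe_toAlgHom, AlgEquiv.apply_symm_apply] at h1
    change D.comul (e.symm a) = _
    rw [← hy]
    conv_lhs => rw [← map_symm_map (e := e) y]
    refine D'.eq_of_proj_eq (D.proj ∘ₗ TensorProduct.map (e.symm : L' →ₐ[k] L).toLinearMap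
      (e.symm : L' →ₐ[k] L).toLinearMap) ?_ (h1.symm.trans hx.symm)
    intro r a b
    have h2 : e.symm (D'.target r) = D.target r :=
      e.injective (by simpa using (he.map_target r).symm)
    have h3 : e.symm (D'.source r) = D.source r :=
      e.injective (by simpa using (he.map_source r).symm)
    simp [h2, h3, D.proj_target_mul]
  map_counit a := by simpa using (he.map_counit (e.symm a)).symm

theorem tensorMap_injective : Function.Injective he.tensorMap := by
  refine Function.LeftInverse.injective (g := he.symm.tensorMap) fun y => ?_
  obtain ⟨x, rfl⟩ := D.proj_surjective y
  rw [tensorMap_proj, tensorMap_proj, map_symm_map]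

theorem tensorMap₃_injective : Function.Injective he.tensorMap₃ := by
  refine Function.LeftInverse.injective (g := he.symm.tensorMap₃) fun y => ?_
  obtain ⟨x, rfl⟩ := Submodule.mkQ_surjective _ y
  rw [tensorMap₃_mkQ, tensorMap₃_mkQ]
  congr 1
  induction x with
  | zero => simp
  | add x y hx hy => simp only [map_add, hx, hy]
  | tmul a b =>
    rw [TensorProduct.map_tmul, TensorProduct.map_tmul, map_symm_map]
    simp

theorem map_mul_map (x y : L ⊗[k] L) : TensorProduct.map (e : L →ₐ[k] L').toLinearMap
    (e : L →ₐ[k] L').toLinearMap (x * y) =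
    TensorProduct.map (e : L →ₐ[k] L').toLinearMap (e : L →ₐ[k] L').toLinearMap x *
    TensorProduct.map (e : L →ₐ[k] L').toLinearMap (e : L →ₐ[k] L').toLinearMap y :=
  map_mul (Algebra.TensorProduct.map (e : L →ₐ[k] L') (e : L →ₐ[k] L')) x y

include he in
theorem proj_eq_comul {x : L ⊗[k] L} {a : L} (hx : D.proj x = D.comul a) :
    D'.proj (TensorProduct.map (e : L →ₐ[k] L').toLinearMap (e : L →ₐ[k] L').toLinearMap x) =
      D'.comul (e a) :=
  (he.map_comul a x hx).symm

include he in
theorem proj_eq_iff {x y : L ⊗[k] L} : D.proj x = D.proj y ↔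
    D'.proj (TensorProduct.map (e : L →ₐ[k] L').toLinearMap (e : L →ₐ[k] L').toLinearMap x) =
    D'.proj (TensorProduct.map (e : L →ₐ[k] L').toLinearMap (e : L →ₐ[k] L').toLinearMap y) :=
  he.tensorMap_injective.eq_iff.symm

include he in
theorem comul_eq_iff {a : L} {y : L ⊗[k] L} : D.comul a = D.proj y ↔ D'.comul (e a) =
    D'.proj (TensorProduct.map (e : L →ₐ[k] L').toLinearMap (e : L →ₐ[k] L').toLinearMap y) := by
  rw [← he.tensorMap_injective.eq_iff, tensorMap_comul]
  rfl

-- Every axiom is an equality in L, R, L ⊗_R L or L ⊗_R L ⊗_R L, and the induced maps to the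
-- corresponding spaces for L' are injective.
include he in
theorem isLeftBialgebroid (h : D'.IsLeftBialgebroid) : D.IsLeftBialgebroid := by
  have hs : ∀ r, e (D.source r) = D'.source r := he.map_source
  have ht : ∀ r, e (D.target r) = D'.target r := he.map_target
  have hε : ∀ a, D'.counit (e a) = D.counit a := he.map_counit
  exact
  { source_one := e.injective (by rw [hs, h.source_one, map_one])
    source_mul := fun r r' => e.injective (by rw [map_mul e, hs, hs, hs, h.source_mul])
    target_one := e.injective (by rw [ht, h.target_one, map_one])
    target_mul := fun r r' => e.injective (by rw [map_mul e, ht, ht, ht, h.target_mul])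
    source_target_comm := fun r r' => e.injective (by
      rw [map_mul e, map_mul e, hs, ht, h.source_target_comm])
    comul_bimodule := fun r r' a x hx => by
      rw [he.comul_eq_iff, map_mul_map, map_mul e, map_mul e, hs, ht,
        h.comul_bimodule r r' _ _ (he.proj_eq_comul hx)]
      simp [hs, ht]
    counit_bimodule := fun r r' a => by
      rw [← hε, map_mul e, map_mul e, hs, ht, h.counit_bimodule, hε]
    coassoc := fun a x hx => by
      apply he.tensorMap₃_injective
      rw [tensorMap₃_comulLeft, tensorMap₃_comulRight]
      exact h.coassoc _ _ (he.proj_eq_comul hx)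
    counit_left := fun a x hx => by
      apply e.injective
      rw [← h.counit_left _ _ (he.proj_eq_comul hx)]
      clear hx
      induction x with
      | zero => simp
      | add x y hx hy => simp only [map_add, hx, hy]
      | tmul a b => simp [counitLeft, hs, hε]
    counit_right := fun a x hx => by
      apply e.injective
      rw [← h.counit_right _ _ (he.proj_eq_comul hx)]
      clear hx
      induction x with
      | zero => simp
      | add x y hx hy => simp only [map_add, hx, hy]
      | tmul a b => simp [counitRight, ht, hε]
    takeuchi := fun r a x hx => by
      have := h.takeuchi r _ _ (he.proj_eq_comul hx)
      rw [he.proj_eq_iff, map_mul_map, map_mul_map]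
      simpa [hs, ht] using this
    comul_one := by
      rw [he.comul_eq_iff, map_one, h.comul_one]
      simp
    comul_mul := fun a b x y hx hy => by
      rw [he.comul_eq_iff, map_mul e, map_mul_map]
      exact h.comul_mul _ _ _ _ (he.proj_eq_comul hx) (he.proj_eq_comul hy)
    counit_one := by rw [← hε, map_one, h.counit_one]
    counit_mul_source := fun a b => by
      rw [← hε, ← hε, map_mul e, h.counit_mul_source, map_mul e, hs, hε]
    counit_mul_target := fun a b => by
      rw [← hε, ← hε, map_mul e, h.counit_mul_target, map_mul e, ht, hε] }

include he in
theorem isLuHopfAlgebroid {τ : L' →ₗ[k] L'} (h : D'.IsLuHopfAlgebroid τ) :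
    D.IsLuHopfAlgebroid (e.symm.toLinearMap ∘ₗ τ ∘ₗ e.toLinearMap) := by
  have hs : ∀ r, e (D.source r) = D'.source r := he.map_source
  have ht : ∀ r, e (D.target r) = D'.target r := he.map_target
  have hε : ∀ a, D'.counit (e a) = D.counit a := he.map_counit
  have hτ : ∀ a, (e.symm.toLinearMap ∘ₗ τ ∘ₗ e.toLinearMap) a = e.symm (τ (e a)) := fun _ => rfl
  refine
  { isLeftBialgebroid := he.isLeftBialgebroid h.isLeftBialgebroid
    bijective := e.symm.bijective.comp (h.bijective.comp e.bijective)
    antipode_one := by rw [hτ, map_one, h.antipode_one, map_one]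
    antipode_mul := fun a b => by rw [hτ, map_mul e, h.antipode_mul, map_mul]; rfl
    antipode_target := fun r => by
      rw [hτ, ht, h.antipode_target, AlgEquiv.symm_apply_eq, hs]
    antipode_left := fun a x hx => by
      apply e.injective
      rw [ht, ← hε, hτ, AlgEquiv.apply_symm_apply, ← h.antipode_left _ _ (he.proj_eq_comul hx)]
      clear hx
      induction x with
      | zero => simp
      | add x y hx hy => simp only [map_add, hx, hy]
      | tmul a b => simp
    antipode_right := ?_ }
  obtain ⟨η, h1, h2⟩ := h.antipode_right
  -- The section for L is the section for L' conjugated by the isomorphism.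
  refine ⟨TensorProduct.map (e.symm : L' →ₐ[k] L).toLinearMap (e.symm : L' →ₐ[k] L).toLinearMap ∘ₗ
    η ∘ₗ he.tensorMap, fun y => ?_, fun a => ?_⟩
  · apply he.tensorMap_injective
    have h3 := he.symm.tensorMap_proj (η (he.tensorMap y))
    rw [h1] at h3
    refine (congrArg he.tensorMap h3.symm).trans ?_
    obtain ⟨x, rfl⟩ := D.proj_surjective y
    rw [tensorMap_proj, tensorMap_proj, map_symm_map]
    rfl
  · apply e.injective
    rw [hs, ← hε, ← h2, LinearMap.comp_apply, LinearMap.comp_apply, tensorMap_comul]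
    change e (LinearMap.mul' k L (LinearMap.lTensor L _ (TensorProduct.map _ _
      (η (D'.comul (e a)))))) = _
    generalize η (D'.comul (e a)) = z
    induction z with
    | zero => simp
    | add x y hx hy => simp only [map_add, hx, hy]
    | tmul a b => simp

end IsHom

end LeftBialgebroidData

/-! ## The isomorphism of `T^op` with the smash product -/

namespace IsHopfGalois

variable {k H A P : Type*} [Field k] [Ring H] [HopfAlgebra k H]
  [Ring A] [Algebra k A] {ρ : A →ₐ[k] A ⊗[k] H} [AddCommGroup P] [Module k P]
  [Module.Finite k H]

open TensorSquare

variable (hρ : IsHopfGalois ρ) {S : BijectiveAntipode k Hᵐᵒᵖ}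
  (M : DoubleModuleAlgebra S (extCentralizer (coinvariants ρ)))

/-- The inclusion of the smash product into `A ⊗ H`. -/
def embed : M.Smash →ₗ[k] A ⊗[k] H :=
  centralizerInclusion ρ ∘ₗ (ModuleAlgebra.Smash.equiv M.toModuleAlgebra).toLinearMap

theorem embed_smk (r : extCentralizer (coinvariants ρ)) (h : Hᵐᵒᵖ) :
    embed M (M.smk r h) = (r : A) ⊗ₜ h.unop := rfl

theorem embed_injective : Function.Injective (embed M) :=
  centralizerInclusion_injective.comp (ModuleAlgebra.Smash.equiv M.toModuleAlgebra).injective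

theorem smash_eq_sweedler (y : M.Smash) :
    y = sweedler (ModuleAlgebra.Smash.equiv M.toModuleAlgebra y) fun r h => M.smk r h := by
  have := congrArg (ModuleAlgebra.Smash.equiv M.toModuleAlgebra).symm
    (sweedler_self (ModuleAlgebra.Smash.equiv M.toModuleAlgebra y))
  rw [map_sweedler] at this
  exact this.symm

theorem embed_eq_sweedler (y : M.Smash) : embed M y =
    sweedler (ModuleAlgebra.Smash.equiv M.toModuleAlgebra y) fun r h => (r : A) ⊗ₜ[k] h.unop := by
  conv_lhs => rw [smash_eq_sweedler M y, map_sweedler]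
  rfl

/-- The map `a ⊗ g ↦ ∑ a (r ◁ g₁) ⊗ h g₂` for `y = ∑ r ⋊ h`. -/
def mulAux (y : M.Smash) (a : A) (g : H) : A ⊗[k] H :=
  sweedler (ModuleAlgebra.Smash.equiv M.toModuleAlgebra y) fun r h => comulSum k g fun p q =>
    (a * hρ.act (MulOpposite.op p) r : A) ⊗ₜ[k] (h.unop * q)

theorem bilin_mulAux (y : M.Smash) : Bilin k (hρ.mulAux M y) := by
  refine ⟨fun _ => ⟨fun _ _ => ?_, fun _ _ => ?_⟩, fun _ => ⟨fun _ _ => ?_, fun _ _ => ?_⟩⟩ <;>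
      simp [mulAux, sweedler, mul_add, add_mul, Finset.sum_add_distrib, Finset.smul_sum,
        TensorProduct.add_tmul, ← TensorProduct.smul_tmul']

/-- Products in the smash product and in T are both expressed through `mulAux`, so that they can be
compared inside A ⊗ H. The factor h g₂ appears in this order because the product of H^op is unfolded
in H. -/
theorem embed_mul (hact : M.toModuleAlgebra.act = hρ.act) (y y' : M.Smash) :
    embed M (y * y') = sweedler (embed M y) (hρ.mulAux M y') := by
  obtain ⟨g, hg⟩ := (hρ.bilin_mulAux M y').exists_eq
  rw [hg, sweedler_bundled]
  induction y using M.smk_induction with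
  | zero => simp
  | add x y hx hy => simp only [add_mul, map_add, hx, hy]
  | smk r h =>
    obtain ⟨h, rfl⟩ := MulOpposite.op_surjective h
    have h1 : g r h = hρ.mulAux M y' r h := by rw [hg]
    rw [embed_smk, TensorProduct.lift.tmul, MulOpposite.unop_op, h1, mulAux]
    conv_lhs => rw [smash_eq_sweedler M y', mul_sweedler, map_sweedler]
    congr 1
    funext w c
    rw [M.smk_mul_smk, map_sweedler, hact]
    refine (comulSum_op h fun a b => embed M (M.smk (r * hρ.act a w) (b * c))).trans ?_
    simp [embed_smk]

/-- If β(t) = ∑ r ⊗ h, then β(c t a) = ∑ c r a₀ ⊗ h a₁, and r a₀ ⊗ a₁ = a₀ (r ◁ a₁) ⊗ a₂ brings it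
to the form of `mulAux`. -/
theorem galoisMap_insertCentral (t : centralSquare (coinvariants ρ)) (y : M.Smash)
    (hy : embed M y = galoisMap ρ (t : TensorSquare (coinvariants ρ)))
    (x : TensorSquare (coinvariants ρ)) :
    galoisMap ρ (insertCentral t x) = sweedler (galoisMap ρ x) (hρ.mulAux M y) := by
  obtain ⟨g, hg⟩ := (hρ.bilin_mulAux M y).exists_eq
  rw [hg, sweedler_bundled]
  induction x using TensorSquare.induction with
  | zero => simp
  | add x y hx hy => simp only [map_add, hx, hy]
  | tmul c a =>
    rw [← sweedler_bundled, ← hg, galoisMap_tmul, insertCentral_tmul, galoisMap_bimul, ← hy,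
      sweedler_tmul_one_mul c _ (hρ.bilin_mulAux M y), embed_eq_sweedler]
    simp only [mulAux]
    rw [sweedler_comm, mul_sweedler, sweedler_mul_right]
    congr 1
    funext r h
    rw [← hρ.coact_coassoc (fun x p q => (c * x * hρ.act (MulOpposite.op p) r : A) ⊗ₜ[k]
      (h.unop * q)) a]
    simp only [← sweedler_tmul_right, coact_act_op]
    conv_lhs => rw [← sweedler_self (ρ a), mul_sweedler]
    simp

/-- The restriction of the Galois map to `T`. -/
def centralSquareEquiv : centralSquare (coinvariants ρ) ≃ₗ[k] tensorCentralizer ρ :=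
  LinearEquiv.ofBijective ((galoisMap ρ ∘ₗ (centralSquare (coinvariants ρ)).subtype).codRestrict _
    fun t => hρ.mem_centralSquare_iff.1 t.2)
    ⟨fun _ _ h => Subtype.ext (hρ.galois.1 (congrArg Subtype.val h)), fun x => by
      obtain ⟨t, ht⟩ := hρ.galois.2 x
      exact ⟨⟨t, hρ.mem_centralSquare_iff.2 (ht ▸ x.2)⟩, Subtype.ext ht⟩⟩

/-- The restriction of the Galois map to `T`, as a linear map from `T^op` to the smash product. -/
def smashLinearEquiv : (centralSquare (coinvariants ρ))ᵐᵒᵖ ≃ₗ[k] M.Smash :=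
  (MulOpposite.opLinearEquiv k).symm ≪≫ₗ hρ.centralSquareEquiv ≪≫ₗ (centralizerEquiv ρ).symm ≪≫ₗ
    (ModuleAlgebra.Smash.equiv M.toModuleAlgebra).symm

theorem embed_smashLinearEquiv (t : (centralSquare (coinvariants ρ))ᵐᵒᵖ) :
    embed M (hρ.smashLinearEquiv M t) =
      galoisMap ρ (t.unop : TensorSquare (coinvariants ρ)) :=
  centralizerInclusion_symm _

/-- The isomorphism of `T^op` with the smash product given by the Galois map. -/
def smashEquiv (hact : M.toModuleAlgebra.act = hρ.act) :
    (centralSquare (coinvariants ρ))ᵐᵒᵖ ≃ₐ[k] M.Smash :=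
  AlgEquiv.ofLinearEquiv (hρ.smashLinearEquiv M)
    (embed_injective M (by
      rw [embed_smashLinearEquiv, MulOpposite.unop_one, centralSquare.coe_one, galoisMap_tmul,
        map_one, mul_one]
      rfl))
    (fun t t' => embed_injective M (by
      rw [embed_smashLinearEquiv, MulOpposite.unop_mul, centralSquare.coe_mul,
        hρ.galoisMap_insertCentral M t'.unop (hρ.smashLinearEquiv M t')
          (hρ.embed_smashLinearEquiv M t'), hρ.embed_mul M hact, embed_smashLinearEquiv]))

theorem embed_smashEquiv (hact : M.toModuleAlgebra.act = hρ.act)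
    (t : (centralSquare (coinvariants ρ))ᵐᵒᵖ) :
    embed M (hρ.smashEquiv M hact t) = galoisMap ρ (t.unop : TensorSquare (coinvariants ρ)) :=
  hρ.embed_smashLinearEquiv M t

theorem embed_target (hcoact : M.coaction = coact ρ) (r : extCentralizer (coinvariants ρ)) :
    embed M (M.target r) = ρ r := by
  rw [← centralizerInclusion_coact, ← hcoact]
  rfl

/-! ### Compatibility with the coproducts -/

/-- The map `x ⊗ (w ⊗ g) ↦ x ρ(w) ⊗ (1 ⊗ g)`. -/
def moveLeft (ρ : A →ₐ[k] A ⊗[k] H) (x : A ⊗[k] H) : A ⊗[k] H →ₗ[k] (A ⊗[k] H) ⊗[k] (A ⊗[k] H) :=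
  TensorProduct.map (LinearMap.mulLeft k x ∘ₗ ρ.toLinearMap) (TensorProduct.mk k A H 1)

theorem moveLeft_tmul (x : A ⊗[k] H) (w : A) (g : H) :
    moveLeft ρ x (w ⊗ₜ g) = (x * ρ w) ⊗ₜ (1 ⊗ₜ g) := rfl

/-- The relation defining ⊗_R, seen in A ⊗ H, but valid for every a in A and not only in R. This is
what allows the coefficients γⱼ(a) of a quasibasis to cross the tensor sign. -/
theorem moveLeft_mul_coaction (x y : A ⊗[k] H) (a : A) :
    moveLeft ρ (x * ρ a) y = moveLeft ρ x ((a ⊗ₜ 1) * y) := by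
  induction y with
  | zero => simp
  | add x y hx hy => simp only [mul_add, map_add, hx, hy]
  | tmul w g => simp [moveLeft_tmul, mul_assoc]

variable (k H A) in
/-- The map `a ⊗ h ↦ (a ⊗ h₁) ⊗ (1 ⊗ h₂)`. -/
def tensorComul : A ⊗[k] H →ₗ[k] (A ⊗[k] H) ⊗[k] (A ⊗[k] H) :=
  TensorProduct.map LinearMap.id (TensorProduct.mk k A H 1) ∘ₗ
    (TensorProduct.assoc k A H H).symm.toLinearMap ∘ₗ Coalgebra.comul.lTensor A

theorem tensorComul_tmul (a : A) (h : H) : tensorComul k H A (a ⊗ₜ h) =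
    comulSum k h fun p q => (a ⊗ₜ[k] p) ⊗ₜ[k] ((1 : A) ⊗ₜ[k] q) := by
  rw [tensorComul, LinearMap.comp_apply, LinearMap.comp_apply, LinearMap.lTensor_tmul,
    ← sweedler_self (Coalgebra.comul (R := k) h), tmul_sweedler, map_sweedler, map_sweedler]
  rfl

include hρ in
theorem moveLeft_coaction (c a : A) :
    moveLeft ρ (c ⊗ₜ 1) (ρ a) = tensorComul k H A ((c ⊗ₜ 1) * ρ a) := by
  have h1 := hρ.coact_coassoc (fun x p q => ((c * x) ⊗ₜ[k] p) ⊗ₜ[k] ((1 : A) ⊗ₜ[k] q)) a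
  conv_lhs => rw [← sweedler_self (ρ a), map_sweedler]
  conv_rhs => rw [← sweedler_self (ρ a), mul_sweedler, map_sweedler]
  simp only [moveLeft_tmul, Algebra.TensorProduct.tmul_mul_tmul, one_mul, tensorComul_tmul]
  refine Eq.trans ?_ h1
  congr 1
  funext x h
  conv_lhs => rw [← sweedler_self (ρ x), mul_sweedler, sweedler_tmul_right]
  simp

theorem applyRight_balanced {B : Subalgebra k A} (γ : bimoduleEnd B) :
    ∀ b ∈ B, ∀ a a', (TensorSquare.mk B).compl₂ γ.1 (a * b) a' =
      (TensorSquare.mk B).compl₂ γ.1 a (b * a') := by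
  intro b hb x y
  change tmul B (x * b) (γ.1 y) = tmul B x (γ.1 (b * y))
  rw [(γ.2 b hb y).1, tmul_balanced hb]

-- For x = c ⊗ a, move γⱼ(a) to the second factor and sum: the quasibasis identity for 1 ⊗ a gives
-- ∑ⱼ (γⱼ(a) ⊗ 1) β(uⱼ) = ρ(a), whatever the quasibasis. Coassociativity of ρ, in the form of
-- `moveLeft_coaction`, does the rest.
include hρ in
theorem sum_moveLeft_galoisMap (q : RightD2Quasibasis (coinvariants ρ))
    (x : TensorSquare (coinvariants ρ)) :
    ∑ j, moveLeft ρ (galoisMap ρ (TensorSquare.lift _ ((TensorSquare.mk _).compl₂ (q.γ j).1)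
      (applyRight_balanced (q.γ j)) x))
      (galoisMap ρ (q.u j : TensorSquare (coinvariants ρ))) =
      tensorComul k H A (galoisMap ρ x) := by
  induction x using TensorSquare.induction with
  | zero => simp [moveLeft]
  | add x y hx hy =>
    rw [map_add, map_add, ← hx, ← hy, ← Finset.sum_add_distrib]
    refine Finset.sum_congr rfl fun j _ => ?_
    rw [map_add, map_add]
    generalize galoisMap ρ (q.u j : TensorSquare (coinvariants ρ)) = z
    induction z with
    | zero => simp
    | add z w hz hw => simp only [map_add, hz, hw]; abel
    | tmul w g => simp only [moveLeft_tmul, add_mul, TensorProduct.add_tmul]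
  | tmul c a =>
    rw [galoisMap_tmul, ← hρ.moveLeft_coaction]
    have h1 := congrArg (galoisMap ρ) (q.eq 1 a)
    simp only [map_sum, galoisMap_bimul, galoisMap_tmul, map_one, mul_one, one_mul,
      ← Algebra.TensorProduct.one_def] at h1
    rw [h1, map_sum]
    refine Finset.sum_congr rfl fun j _ => ?_
    rw [← moveLeft_mul_coaction]
    rfl

/-- Left multiplication by t(w) becomes right multiplication by ρ(w) in A ⊗ H, since t(w)(v ⋊ h) = v
w₀ ⋊ w₁ h and the product w₁ h is that of H^op. So `moveLeft` is the normal form `sectionAux`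
computed in A ⊗ H. -/
theorem map_embed_sectionAux (hY : IsBraidedYetterDrinfeld M.toModuleAlgebra.act M.coaction)
    (hcoact : M.coaction = coact ρ) (x y : M.Smash) :
    TensorProduct.map (embed M) (embed M) (M.sectionAux (x ⊗ₜ y)) =
      moveLeft ρ (embed M x) (embed M y) := by
  have h1 : ∀ (w : extCentralizer (coinvariants ρ)) (x : M.Smash),
      embed M (M.target w * x) = embed M x * ρ w := by
    intro w x
    induction x using M.smk_induction with
    | zero => simp
    | add x y hx hy => simp only [mul_add, add_mul, map_add, hx, hy]
    | smk v h =>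
      rw [M.target_mul_smk hY, map_sweedler, hcoact, coaction_eq, mul_sweedler]
      simp [embed_smk]
  induction y using M.smk_induction with
  | zero => simp
  | add y z hy hz => simp only [TensorProduct.tmul_add, map_add, hy, hz]
  | smk w g =>
    rw [M.sectionAux_tmul, TensorProduct.map_tmul, h1, embed_smk, embed_smk, moveLeft_tmul]
    rfl

theorem map_embed_comulRep (x : M.Smash) :
    TensorProduct.map (embed M) (embed M) (M.comulRep x) = tensorComul k H A (embed M x) := by
  induction x using M.smk_induction with
  | zero => simp
  | add x y hx hy => simp only [map_add, hx, hy]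
  | smk v h =>
    obtain ⟨h, rfl⟩ := MulOpposite.op_surjective h
    rw [M.comulRep_smk, embed_smk, tensorComul_tmul, map_sweedler]
    exact comulSum_op h fun a b =>
      TensorProduct.map (embed M) (embed M) (M.smk v a ⊗ₜ[k] M.smk 1 b)

end IsHopfGalois

/-! ## The Hopf algebroid `T^op` -/

namespace IsHopfGalois

variable {k H A P : Type*} [Field k] [Ring H] [HopfAlgebra k H]
  [Ring A] [Algebra k A] {ρ : A →ₐ[k] A ⊗[k] H} [AddCommGroup P] [Module k P]
  [Module.Finite k H]

open TensorSquare

variable (hρ : IsHopfGalois ρ) {S : BijectiveAntipode k Hᵐᵒᵖ}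
  (M : DoubleModuleAlgebra S (extCentralizer (coinvariants ρ)))

theorem opComulRep_apply {B : Subalgebra k A} (q : RightD2Quasibasis B)
    (t : (centralSquare B)ᵐᵒᵖ) : opComulRep q t = ∑ j,
      (MulOpposite.op (applyRight (q.γ j) t.unop)) ⊗ₜ[k] (MulOpposite.op (q.u j)) := by
  simp [opComulRep]

include hρ in
theorem counit_galoisMap (x : TensorSquare (coinvariants ρ)) :
    TensorProduct.rid k A (Coalgebra.counit.lTensor A (galoisMap ρ x)) = sandwich _ 1 x := by
  induction x using TensorSquare.induction with
  | zero => simp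
  | add x y hx hy => simp only [map_add, hx, hy]
  | tmul c a =>
    rw [galoisMap_tmul, sandwich_tmul, OneMemClass.coe_one, mul_one]
    have h1 := hρ.coact_counit (LinearMap.mulLeft k c) a
    conv_lhs => rw [← sweedler_self (ρ a), mul_sweedler, map_sweedler, map_sweedler]
    simpa using h1

theorem counit_embed (y : M.Smash) : (M.smashBialgebroid.counit y : A) =
    TensorProduct.rid k A (Coalgebra.counit.lTensor A (embed M y)) := by
  induction y using M.smk_induction with
  | zero => simp
  | add x y hx hy => simp only [map_add, Subalgebra.coe_add, hx, hy]
  | smk v h =>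
    rw [M.counit_smk, embed_smk]
    simp [MulOpposite.counit_def]

variable (hact : M.toModuleAlgebra.act = hρ.act) (hcoact : M.coaction = coact ρ)

-- Source, target and counit are compared by evaluating β. For the coproduct both sides are brought
-- to normal form by `sectionAux` and compared in (A ⊗ H) ⊗ (A ⊗ H), where flatness makes the
-- embedding injective.
include hcoact in
theorem smashEquiv_isHom (q : RightD2Quasibasis (coinvariants ρ)) :
    LeftBialgebroidData.IsHom (centralSquareOpBialgebroid q) M.smashBialgebroid
      (hρ.smashEquiv M hact : (centralSquare (coinvariants ρ))ᵐᵒᵖ →ₐ[k] M.Smash)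
      (AlgHom.id k _) := by
  have hY : IsBraidedYetterDrinfeld M.toModuleAlgebra.act M.coaction := by
    rw [hact, hcoact]
    exact hρ.isBraidedYetterDrinfeld
  have hs : ∀ r, hρ.smashEquiv M hact (opSource _ r) = M.source r := fun r =>
    embed_injective M (by
      rw [embed_smashEquiv]
      refine (galoisMap_tmul (r : A) 1).trans ?_
      rw [map_one, mul_one]
      rfl)
  have ht : ∀ r, hρ.smashEquiv M hact (opTarget _ r) = M.target r := fun r =>
    embed_injective M (by
      rw [embed_smashEquiv, embed_target M hcoact]
      refine (galoisMap_tmul 1 (r : A)).trans ?_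
      rw [← Algebra.TensorProduct.one_def, one_mul])
  refine ⟨hs, ht, fun t x hx => ?_, fun t => Subtype.ext ?_⟩
  · let F := (hρ.smashEquiv M hact :
      (centralSquare (coinvariants ρ))ᵐᵒᵖ →ₐ[k] M.Smash).toLinearMap
    have h1 : M.smashBialgebroid.proj (TensorProduct.map F F x) =
        M.smashBialgebroid.proj (TensorProduct.map F F (opComulRep q t)) := by
      refine (centralSquareOpBialgebroid q).eq_of_proj_eq
        (M.smashBialgebroid.proj ∘ₗ TensorProduct.map F F) (fun r a b => ?_) hx
      change M.smashBialgebroid.proj (hρ.smashEquiv M hact (opTarget _ r * a) ⊗ₜ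
        hρ.smashEquiv M hact b) = M.smashBialgebroid.proj (hρ.smashEquiv M hact a ⊗ₜ
        hρ.smashEquiv M hact (opSource _ r * b))
      rw [map_mul, map_mul, ht, hs, M.proj_target_mul]
    refine Eq.trans ?_ h1.symm
    change M.smashBialgebroid.proj (M.comulRep (hρ.smashEquiv M hact t)) = _
    -- The standard representative of Δ is already in normal form, so once the other side is
    -- normalised the equality holds before projecting to ⊗_R.
    rw [← M.proj_sectionAux (TensorProduct.map F F (opComulRep q t))]
    congr 1
    apply TensorProduct.map_injective_of_flat_flat _ _ (embed_injective M) (embed_injective M)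
    rw [map_embed_comulRep, embed_smashEquiv, opComulRep_apply, ← hρ.sum_moveLeft_galoisMap q,
      map_sum, map_sum, map_sum]
    refine Finset.sum_congr rfl fun j _ => ?_
    rw [TensorProduct.map_tmul, map_embed_sectionAux M hY hcoact]
    congr 1
    · exact congrArg (moveLeft ρ) (hρ.embed_smashEquiv M hact
        (MulOpposite.op (applyRight (q.γ j) t.unop))).symm
    · exact (hρ.embed_smashEquiv M hact (MulOpposite.op (q.u j))).symm
  · change (M.smashBialgebroid.counit (hρ.smashEquiv M hact t) : A) =
      sandwich _ 1 (t.unop : TensorSquare (coinvariants ρ))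
    rw [counit_embed, embed_smashEquiv, hρ.counit_galoisMap]

end IsHopfGalois

/-! ### The structure theorem for T^op. -/

open MulOpposite in
theorem mainTheorem1 {k H A : Type*} [Field k] [Ring H] [HopfAlgebra k H] [Module.Finite k H]
    [Ring A] [Algebra k A] (ρ : A →ₐ[k] A ⊗[k] H) (hρ : IsHopfGalois ρ) :
    -- the extension `A | B` has depth two
    Nonempty (LeftD2Quasibasis (coinvariants ρ)) ∧
    Nonempty (RightD2Quasibasis (coinvariants ρ)) ∧
    ∃ (S : BijectiveAntipode k Hᵐᵒᵖ)
      (M : DoubleModuleAlgebra S (extCentralizer (coinvariants ρ))),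
      -- the antipode of `H^op` is the inverse of that of `H`
      (∀ h : H, S.S (op (HopfAlgebra.antipode k h)) = op h) ∧
      -- `H^op` acts on `R` by the Miyashita-Ulbrich action
      (∀ (h : H) (r : extCentralizer (coinvariants ρ)) (t : TensorSquare (coinvariants ρ)),
        galoisMap ρ t = 1 ⊗ₜ[k] h →
          (M.actH (op h) r : A) = sandwich (coinvariants ρ) r t) ∧
      -- the dual of `H^op` acts on `R` through the coaction
      (∀ (p : Module.Dual k Hᵐᵒᵖ) (r : extCentralizer (coinvariants ρ)),
        (M.actDual p r : A) = TensorProduct.rid k A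
          ((p ∘ₗ (opLinearEquiv k).toLinearMap).lTensor A (ρ r))) ∧
      M.IsBraidedCommutative ∧
      -- `R ⋊ H^op` is a Hopf algebroid with Lu's structure
      M.smashBialgebroid.IsLuHopfAlgebroid M.luAntipode ∧
      -- the target map is the coaction: `t(r) = r₀ ⋊ r₁`
      (∀ r : extCentralizer (coinvariants ρ), centralizerInclusion ρ
        (ModuleAlgebra.Smash.equiv M.toModuleAlgebra (M.target r)) = ρ r) ∧
      -- `τ(r ⋊ h) = (1 ⋊ S̄(h)) (w₀ ⋊ w₁)` where `w = r₀ ◁ S̄²(r₁)`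
      (∀ (r w : extCentralizer (coinvariants ρ)) (h : Hᵐᵒᵖ)
        (x y : extCentralizer (coinvariants ρ) ⊗[k] Hᵐᵒᵖ),
        centralizerInclusion ρ x = ρ r →
        w = TensorProduct.lift
          (M.actH ∘ₗ S.S.toLinearMap ∘ₗ S.S.toLinearMap).flip x →
        centralizerInclusion ρ y = ρ w →
        M.luAntipode (M.smk r h) =
          M.smk 1 (S.S h) * (ModuleAlgebra.Smash.equiv M.toModuleAlgebra).symm y) ∧
      -- `β` is an isomorphism of bialgebroids from `T^op` to `R ⋊ H^op`, and `T^op` is a Hopf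
      -- algebroid with the corresponding antipode
      ∃ Φ : (centralSquare (coinvariants ρ))ᵐᵒᵖ ≃ₐ[k] M.Smash,
        (∀ t : centralSquare (coinvariants ρ), centralizerInclusion ρ
          (ModuleAlgebra.Smash.equiv M.toModuleAlgebra (Φ (op t))) =
            galoisMap ρ (t : TensorSquare (coinvariants ρ))) ∧
        ∀ q : RightD2Quasibasis (coinvariants ρ),
          LeftBialgebroidData.IsHom (centralSquareOpBialgebroid q) M.smashBialgebroid
            (Φ : (centralSquare (coinvariants ρ))ᵐᵒᵖ →ₐ[k] M.Smash) (AlgHom.id k _) ∧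
          (centralSquareOpBialgebroid q).IsLuHopfAlgebroid
            (Φ.symm.toLinearMap ∘ₗ M.luAntipode ∘ₗ Φ.toLinearMap) := by

  have Y := hρ.isBraidedYetterDrinfeld
  let S := (HopfAlgebra.bijectiveAntipode k H).opposite
  let M := Y.toDoubleModuleAlgebra S
  have hact : M.toModuleAlgebra.act = hρ.act := Y.toDoubleModuleAlgebra_act S
  have hcoact : M.coaction = IsHopfGalois.coact ρ := Y.toDoubleModuleAlgebra_coaction S
  have hY : IsBraidedYetterDrinfeld M.toModuleAlgebra.act M.coaction := by
    rw [hact, hcoact]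
    exact Y
  have hτ := M.smashBialgebroid_isLuHopfAlgebroid hY
  refine ⟨⟨hρ.leftQuasibasis⟩, ⟨hρ.rightQuasibasis⟩, S, M, fun h => ?_, fun h r t ht => ?_,
    fun p r => ?_, Y.toDoubleModuleAlgebra_isBraided S, hτ, fun r => ?_,
    fun r w h x y hx hw hy => ?_, hρ.smashEquiv M hact,
    fun t => hρ.embed_smashEquiv M hact (op t), fun q => ?_⟩
  · exact congrArg op ((HopfAlgebra.bijectiveAntipode k H).S.symm_apply_apply h)
  · rw [Y.toDoubleModuleAlgebra_actH, ← IsHopfGalois.act_op, ← IsHopfGalois.sandwichMap_one_tmul,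
      ← ht, IsHopfGalois.sandwichMap_galoisMap]
  · rw [Y.toDoubleModuleAlgebra_actDual, IsBraidedYetterDrinfeld.coactDual_apply,
      IsHopfGalois.coaction_eq, map_sweedler, map_sweedler]
    refine (map_sweedler (extCentralizer (coinvariants ρ)).val _ _).trans ?_
    simp [IsBraidedYetterDrinfeld.evalSmul_apply]
  · exact IsHopfGalois.embed_target M hcoact r
  -- Injectivity of R ⊗ H^op → A ⊗ H forces x and y to be the coactions of r and w, and then w is
  -- θ(r).
  · have hx' : x = IsHopfGalois.coact ρ r := IsHopfGalois.centralizerInclusion_injective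
      (hx.trans (IsHopfGalois.centralizerInclusion_coact r).symm)
    have hy' : y = M.coaction w := by
      rw [hcoact]
      exact IsHopfGalois.centralizerInclusion_injective
        (hy.trans (IsHopfGalois.centralizerInclusion_coact w).symm)
    have hw' : w = M.twist r := by
      rw [hw, hx', ← hcoact]
      rfl
    rw [M.luAntipode_smk_eq, hy', hw']
    rfl
  · have h := hρ.smashEquiv_isHom M hact hcoact q
    exact ⟨h, h.isLuHopfAlgebroid hτ⟩

end
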